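/- **Definitions.** For $s,k\ge 0$, an *edge-labelled tree* is a finite rooted unordered tree of height at most $k$ whose edges carry labels from $\Sigma=\{1,\dots,s\}$. (The height is the maximal number of edges on a root-to-leaf path.) Its *edge representation* is the structure whose universe is the set of edges, with one unary relation for each label and a unary parent function that maps an edge to its parent edge and loops on the edges that originate in the root. The empty structure represents the root-only tree. Write $\mathsf E_k\Sigma$ for the class of these structures. Unlabelled trees of height at most $n$ are represented by their set of nodes with the parent-child relation; write $\mathsf M^n1$ for the class of these trees. A *quantifier-free interpretation* $f:\mathsf E_k\Sigma\to\mathsf M^n1$ is given by finitely many components $i\in I$, each with a dimension $d_i\ge 0$ and a quantifier-free formula $\varphi_i$ with $d_i$ free variables, and, for all $i,j\in I$, a quantifier-free formula $\psi_{ij}$ with $d_i+d_j$ free variables. For every $A\in\mathsf E_k\Sigma$ the output $f(A)$ is the set of nodes $\coprod_{i}\{\bar a\in A^{d_i}: A\models\varphi_i(\bar a)\}$, with $(i,\bar a)$ the parent of $(j,\bar b)$ if and only if $A\models\psi_{ij}(\bar a\bar b)$; it is required that $f(A)\in\mathsf M^n1$ for every $A$. The size of an instance is $s+k+n$ plus the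 number of components, the sum of their dimensions and the number of symbols of all formulas. Two such interpretations (or functions from $\mathsf E_k\Sigma$ to trees) are *equivalent* if for every $A\in\mathsf E_k\Sigma$ their outputs are isomorphic as trees. A *pattern* over $\mathsf E_k\Sigma$ is a finite tree whose nodes $x$ are labelled by structures $\Phi(x)\in\mathsf E_k\Sigma$, such that the label of the root is empty and $\Phi(x)$ is an induced substructure of $\Phi(y)$ whenever $x$ is the parent of $y$. It defines the function that maps $A$ to the tree of all pairs $(x,\alpha)$ with $\alpha:\Phi(x)\hookrightarrow A$ an embedding, where $(y,\beta)$ is a child of $(x,\alpha)$ if and only if $y$ is a child of $x$ and $\beta$ extends $\alpha$. Its size is the number of its nodes plus the number of edges in all labels. Two patterns are *isomorphic* if there is an isomorphism of the underlying trees together with isomorphisms of the labels of corresponding nodes such that the isomorphism for each node extends the one for its parent. **Theorem.** 1. The following problem is decidable: given $s,k,n$ and two quantifier-free interpretations $f,g:\mathsf E_k\Sigma\to\mathsf M^n1$, are $f$ and $g$ equivalent? 2. There are an algorithm and a polynomial $p$ such that the algorithm converts every quantifier-free interpretation $f:\mathsf E_k\Sigma\to\mathsf M^n1$, given with $s,k,n$,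 to a pattern over $\mathsf E_k\Sigma$ that defines a function equivalent to $f$ and has size at most $2^{p(N)}$, where $N$ is the size of the instance. 3. Two patterns over $\mathsf E_k\Sigma$ define equivalent functions if and only if they are isomorphic. 4. Isomorphism of two patterns over $\mathsf E_k\Sigma$ is decidable. -/

import Mathlib

namespace TreeInterp

open FirstOrder

/-! ### Edge-labelled trees in edge representation -/

/-- The only function symbol: the parent function on edges. -/
inductive EdgeFunc : ℕ → Type
  | parent : EdgeFunc 1

/-- One unary relation symbol for each of the `s` edge labels. -/
inductive EdgeRel (s : ℕ) : ℕ → Type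
  | hasLabel (a : Fin s) : EdgeRel s 1

/-- The vocabulary of trees with edge labels from `Fin s`, in edge representation. -/
abbrev edgeLang (s : ℕ) : FirstOrder.Language.{0, 0} := ⟨EdgeFunc, EdgeRel s⟩

/-- The interpretation of the parent function in the structure `A`. -/
def parentFun (s : ℕ) (A : Type) [(edgeLang s).Structure A] (e : A) : A :=
  Language.Structure.funMap (L := edgeLang s) EdgeFunc.parent ![e]

/-- The element `e` of `A` carries the label `a`. -/
def HasLabel {s : ℕ} {A : Type} [(edgeLang s).Structure A] (a : Fin s) (e : A) : Prop :=
  Language.Structure.RelMap (L := edgeLang s) (EdgeRel.hasLabel a) ![e]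

/-- `A` is the edge representation of a finite tree of height at most `k` with edge labels in
`Fin s`. The elements of `A` are the edges of the tree, every edge has exactly one label, and
the parent function loops exactly at the edges that originate in the root. An edge from which
`j` parent steps lead to a loop is the last edge on a path of at most `j + 1` edges from the
root. The empty structure represents the tree that consists of the root only. -/
structure IsEdgeTree (s k : ℕ) (A : Type) [(edgeLang s).Structure A] : Prop where
  finite : Finite A
  existsUnique_label : ∀ e : A, ∃! a : Fin s, HasLabel a e
  height_le : ∀ e : A, ∃ j < k,
    parentFun s A ((parentFun s A)^[j] e) = (parentFun s A)^[j] e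

/-! ### Unlabelled trees -/

/-- The relation `P` (read `P x y` as "`x` is the parent of `y`") is the parent-child relation
of a rooted tree of height at most `n` with set of nodes `V`. -/
def IsTreeOfHeightLE (n : ℕ) {V : Type} (P : V → V → Prop) : Prop :=
  ∃ r : V, (∀ x, ¬ P x r) ∧ (∀ y, y ≠ r → ∃! x, P x y) ∧
    ∀ y, ∃ m ≤ n, ∃ path : ℕ → V, path 0 = r ∧ path m = y ∧
      ∀ i < m, P (path i) (path (i + 1))

/-! ### Descriptions of terms and formulas by natural numbers -/

/-- Gödel numbers of terms, given numbers for the variables. -/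
def termCode {s : ℕ} {α : Type} (v : α → ℕ) : (edgeLang s).Term α → ℕ
  | .var x => 2 * v x
  | .func EdgeFunc.parent ts => 2 * termCode v (ts 0) + 1

/-- The number of symbols of a term. -/
def termSize {s : ℕ} {α : Type} : (edgeLang s).Term α → ℕ
  | .var _ => 1
  | .func EdgeFunc.parent ts => termSize (ts 0) + 1

/-- Numbers of the variables of a formula: the free variables have the numbers `0, …, d - 1`,
and the bound variables the numbers from `d` on. -/
def varCode {d m : ℕ} : Fin d ⊕ Fin m → ℕ
  | .inl i => i
  | .inr j => d + j

/-- Gödel numbers of formulas with free variables in `Fin d`. -/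
def formulaCode {s d : ℕ} : {m : ℕ} → (edgeLang s).BoundedFormula (Fin d) m → ℕ
  | _, .falsum => 0
  | _, .equal t u => 4 * Nat.pair (termCode varCode t) (termCode varCode u) + 1
  | _, .rel (EdgeRel.hasLabel a) ts =>
      4 * Nat.pair a.val (termCode (s := s) varCode (ts 0)) + 2
  | _, .imp φ ψ => 4 * Nat.pair (formulaCode φ) (formulaCode ψ) + 3
  | _, .all φ => 4 * formulaCode φ + 4

/-- The number of symbols of a formula. -/
def formulaSize {s d : ℕ} : {m : ℕ} → (edgeLang s).BoundedFormula (Fin d) m → ℕ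
  | _, .falsum => 1
  | _, .equal t u => termSize t + termSize u + 1
  | _, .rel (EdgeRel.hasLabel _) ts => termSize (ts 0) + 1
  | _, .imp φ ψ => formulaSize φ + formulaSize ψ + 1
  | _, .all φ => formulaSize φ + 1

/-! ### Quantifier-free interpretations -/

/-- The raw data that describe an interpretation: the dimension and the universe formula of
every component, and the parent formula of every pair of components. -/
abbrev InterpData : Type := List (ℕ × ℕ) × List (List ℕ)

/-- A (description of a) quantifier-free interpretation from structures over `edgeLang s` to
structures with one binary relation, read as the parent-child relation. -/
structure QFInterp (s : ℕ) where
  /-- The number of components. -/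
  comps : ℕ
  /-- The dimension of a component. -/
  dim : Fin comps → ℕ
  /-- The universe formula of a component. -/
  univ : ∀ i, (edgeLang s).Formula (Fin (dim i))
  /-- The formula that defines the parent-child relation between two components. -/
  par : ∀ i j, (edgeLang s).Formula (Fin (dim i + dim j))
  univ_isQF : ∀ i, Language.BoundedFormula.IsQF (univ i)
  par_isQF : ∀ i j, Language.BoundedFormula.IsQF (par i j)

namespace QFInterp

variable {s : ℕ} (F : QFInterp s)

/-- The description of the interpretation as it is given to an algorithm. -/
def data : InterpData :=
  (List.ofFn fun i => (F.dim i, formulaCode (F.univ i)),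
    List.ofFn fun i => List.ofFn fun j => formulaCode (F.par i j))

/-- The size of the description. -/
def size : ℕ :=
  (∑ i, (1 + F.dim i + formulaSize (F.univ i))) + ∑ i, ∑ j, formulaSize (F.par i j)

/-- The universe of the output structure on input `A`. -/
def Node (A : Type) [(edgeLang s).Structure A] : Type :=
  {p : Σ i, (Fin (F.dim i) → A) // (F.univ p.1).Realize p.2}

/-- The relation of the output structure on input `A`: `F.Parent A x y` means that `x` is the
parent of `y`. -/
def Parent (A : Type) [(edgeLang s).Structure A] (x y : F.Node A) : Prop :=
  (F.par x.1.1 y.1.1).Realize (Fin.append x.1.2 y.1.2)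

/-- `F` is an interpretation from edge-labelled trees of height at most `k` to unlabelled trees
of height at most `n`. -/
def MapsTrees (k n : ℕ) : Prop :=
  ∀ (A : Type) [(edgeLang s).Structure A], IsEdgeTree s k A →
    IsTreeOfHeightLE n (F.Parent A)

/-- `F` and `G` produce isomorphic outputs for every input tree of height at most `k`. -/
def Equivalent (k : ℕ) (F G : QFInterp s) : Prop :=
  ∀ (A : Type) [(edgeLang s).Structure A], IsEdgeTree s k A →
    Nonempty (F.Parent A ≃r G.Parent A)

end QFInterp

/-! ### Patterns -/

/-- A tree of height at most `k` with edge labels in `Fin s`, with set of edges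
`{0, …, size - 1}`. -/
structure EdgeTree (s k : ℕ) where
  /-- The number of edges. -/
  size : ℕ
  /-- The parent function on edges. -/
  par : Fin size → Fin size
  /-- The label of an edge. -/
  lab : Fin size → Fin s
  height_le : ∀ e, ∃ j < k, par (par^[j] e) = par^[j] e

namespace EdgeTree

variable {s k : ℕ}

/-- The edges of the tree. -/
def Edge (t : EdgeTree s k) : Type := Fin t.size

/-- The edge representation of the tree. -/
instance (t : EdgeTree s k) : (edgeLang s).Structure t.Edge where
  funMap f xs := match f with
    | EdgeFunc.parent => t.par (xs 0)
  RelMap r xs := match r with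
    | EdgeRel.hasLabel a => t.lab (xs 0) = a

/-- The structures defined from `EdgeTree` are edge representations of trees. -/
theorem isEdgeTree (t : EdgeTree s k) : IsEdgeTree s k t.Edge where
  finite := inferInstanceAs (Finite (Fin t.size))
  existsUnique_label e := ⟨t.lab e, rfl, fun _ h => h.symm⟩
  height_le e := t.height_le e

/-- The list of the parents and labels of the edges. -/
def data (t : EdgeTree s k) : List (ℕ × ℕ) :=
  List.ofFn fun e => ((t.par e : ℕ), (t.lab e : ℕ))

end EdgeTree

/-- The raw data that describe a pattern: the labels of all nodes, and, for every node other
than the root, the parent and the inclusion of the label of the parent. -/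
abbrev PatternData : Type := List (List (ℕ × ℕ)) × List (ℕ × List ℕ)

/-- A pattern over edge-labelled trees of height at most `k`: a finite tree with nodes
`0, …, last`, where `0` is the root and parents come before their children; every node is
labelled by an edge-labelled tree, the label of the root is the empty structure, and the label
of a node other than the root comes with the label of its parent as an induced substructure,
that is, with an embedding of that label. The nodes other than the root are written `z.succ`
with `z : Fin last`. -/
structure Pattern (s k : ℕ) where
  /-- The number of nodes other than the root. -/
  last : ℕ
  /-- The parent of the node `z.succ`. -/
  par : Fin last → Fin (last + 1)
  par_lt : ∀ z, par z < z.succ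
  /-- The label of a node. -/
  label : Fin (last + 1) → EdgeTree s k
  label_root : (label 0).size = 0
  /-- The inclusion of the label of the parent of `z.succ` in the label of `z.succ`. -/
  incl : ∀ z, (label (par z)).Edge ↪[edgeLang s] (label z.succ).Edge

namespace Pattern

variable {s k : ℕ} (Φ : Pattern s k)

/-- The description of the pattern as it is given to an algorithm. -/
def data : PatternData :=
  (List.ofFn fun x => (Φ.label x).data,
    List.ofFn fun z => ((Φ.par z : ℕ),
      List.ofFn fun e : Fin (Φ.label (Φ.par z)).size =>
        Fin.val (n := (Φ.label z.succ).size) (Φ.incl z e)))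

/-- The size of the pattern: the number of its nodes plus the number of edges in all labels. -/
def size : ℕ := ∑ x, (1 + (Φ.label x).size)

/-- The nodes of the output tree of the pattern on input `A`: a node `x` of the pattern with an
embedding of its label in `A`. -/
def Node (A : Type) [(edgeLang s).Structure A] : Type :=
  Σ x, ((Φ.label x).Edge ↪[edgeLang s] A)

/-- The parent-child relation of the output tree: `(y, β)` is a child of `(x, α)` if `y` is a
child of `x` in the pattern and `β` extends `α`. -/
inductive Parent (A : Type) [(edgeLang s).Structure A] : Φ.Node A → Φ.Node A → Prop
  | intro (z : Fin Φ.last) (β : (Φ.label z.succ).Edge ↪[edgeLang s] A) :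
      Parent A ⟨Φ.par z, β.comp (Φ.incl z)⟩ ⟨z.succ, β⟩

/-- The parent-child relation of the underlying tree of the pattern. -/
inductive IsParent : Fin (Φ.last + 1) → Fin (Φ.last + 1) → Prop
  | intro (z : Fin Φ.last) : IsParent (Φ.par z) z.succ

/-- The graph of all inclusions of labels of nodes in the labels of their children. -/
inductive Incl : (Σ x, (Φ.label x).Edge) → (Σ x, (Φ.label x).Edge) → Prop
  | intro (z : Fin Φ.last) (e : (Φ.label (Φ.par z)).Edge) :
      Incl ⟨Φ.par z, e⟩ ⟨z.succ, Φ.incl z e⟩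

/-- Two patterns define equivalent functions: they produce isomorphic outputs for every input
tree of height at most `k`. -/
def Equivalent (Φ Ψ : Pattern s k) : Prop :=
  ∀ (A : Type) [(edgeLang s).Structure A], IsEdgeTree s k A →
    Nonempty (Φ.Parent A ≃r Ψ.Parent A)

/-- The pattern and the interpretation produce isomorphic outputs for every input tree of height
at most `k`. -/
def Defines (F : QFInterp s) : Prop :=
  ∀ (A : Type) [(edgeLang s).Structure A], IsEdgeTree s k A →
    Nonempty (Φ.Parent A ≃r F.Parent A)

/-- Isomorphism of patterns: an isomorphism `σ` of the underlying trees together with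
isomorphisms `τ x` of the labels of corresponding nodes that are consistent with the
inclusions. -/
def Isomorphic (Φ Ψ : Pattern s k) : Prop :=
  ∃ (σ : Fin (Φ.last + 1) ≃ Fin (Ψ.last + 1))
    (τ : ∀ x, (Φ.label x).Edge ≃[edgeLang s] (Ψ.label (σ x)).Edge),
    (∀ x y, Φ.IsParent x y ↔ Ψ.IsParent (σ x) (σ y)) ∧
    ∀ x y (e : (Φ.label x).Edge) (f : (Φ.label y).Edge),
      Φ.Incl ⟨x, e⟩ ⟨y, f⟩ → Ψ.Incl ⟨σ x, τ x e⟩ ⟨σ y, τ y f⟩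

end Pattern

end TreeInterp

namespace TreeInterp

open FirstOrder

/-! ### Structures over the vocabulary of edge-labelled trees -/

section Basic

variable {s : ℕ} {A B : Type} [(edgeLang s).Structure A] [(edgeLang s).Structure B]

/-! The core is that equivalent patterns are isomorphic; the converse only moves embeddings along
the isomorphisms of labels.

Both patterns are evaluated on test trees `TestTree s k v`. Their edges are words over `Fin s × Fin
m`, where `m` bounds the size of all labels, and every letter also carries a copy index below `m + v
w`, where `w` is the word without copy indices. Embedding a label `t` in a test tree means choosing
a map `g : t.Edge → Fin m` and copy indices that separate siblings with the same label and the same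
value of `g`. Once `g` is fixed, the number of ways to extend copy indices from the label of a node
to the label of a child is a polynomial in `v` with natural coefficients. Its only monomial of top
degree is the product of the variables of the words of the new edges (`exists_colouring_polynomial`,
`coeff_extPoly`).

The output tree thus becomes an iterated multiset with polynomial multiplicities. Outside the zeros
of one nonzero polynomial, distinct values stay distinct (`exists_generic`), so two nodes whose
values agree for all `v` have equal polynomials counting the children with any given value
(`childPoly_eq`). For injective `g` the top monomial determines the label of the child over the
label of the parent (`exists_equiv_of_sum_single_eq`). Hence the top coefficients, with the
isomorphism classes of children ordered by the number of new edges, form a triangular system, and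
every class occurs equally often below both nodes (`card_fiber_eq`, `good_of_value_eq`, by induction
on the height).

For the conversion of interpretations, an output node is a component and a tuple. The tuple
generates a tree with at most `k * totalDim` edges, and up to an embedding of that tree the node
depends only on the type of the tuple. One representative per type gives the nodes of a pattern
(`exists_family`). The parent of a representative is an output node on the same label, hence the
image of another representative under an embedding, which gives the pattern edges
(`exists_represents`). That all outputs share the root of the output on the empty structure follows
by gluing two copies of the input at the root (`exists_root`).

The algorithms are exhaustive searches through finite sets of raw data. A pattern found by search
need not be the constructed one, but both define the same function, so they are isomorphic and have
the same size (`toPattern_spec`). Equivalence of interpretations is then isomorphism of their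
patterns. -/

theorem funMap_parent (x : Fin 1 → A) :
    Language.Structure.funMap (L := edgeLang s) EdgeFunc.parent x = parentFun s A (x 0) := by
  unfold parentFun
  congr 1
  ext i
  fin_cases i
  rfl

theorem relMap_hasLabel (a : Fin s) (x : Fin 1 → A) :
    Language.Structure.RelMap (L := edgeLang s) (EdgeRel.hasLabel a) x ↔ HasLabel a (x 0) := by
  unfold HasLabel
  have : x = ![x 0] := by
    ext i
    fin_cases i
    rfl
  rw [← this]

theorem map_parentFun (f : A ↪[edgeLang s] B) (e : A) :
    f (parentFun s A e) = parentFun s B (f e) := by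
  have h := f.map_fun' (EdgeFunc.parent) ![e]
  unfold parentFun
  refine h.trans ?_
  congr 1
  ext i
  fin_cases i
  rfl

theorem map_hasLabel (f : A ↪[edgeLang s] B) (a : Fin s) (e : A) :
    HasLabel a (f e) ↔ HasLabel a e := by
  have h := f.map_rel' (EdgeRel.hasLabel a) ![e]
  unfold HasLabel
  rw [← h]
  have : ![f e] = (f.toFun ∘ ![e]) := by
    ext i
    fin_cases i
    rfl
  rw [this]

/-- An injective map that preserves parents and labels is an embedding. -/
def mkEmb (f : A → B) (hf : Function.Injective f)
    (hp : ∀ e, f (parentFun s A e) = parentFun s B (f e))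
    (hl : ∀ a e, HasLabel (s := s) a (f e) ↔ HasLabel a e) : A ↪[edgeLang s] B where
  toFun := f
  inj' := hf
  map_fun' := by
    intro n g x
    cases g
    rw [funMap_parent, funMap_parent]
    exact hp _
  map_rel' := by
    intro n r x
    cases r
    rw [relMap_hasLabel, relMap_hasLabel]
    exact hl _ _

/-- A surjective embedding is an isomorphism. -/
noncomputable def equivOfSurjective (f : A ↪[edgeLang s] B) (hf : Function.Surjective f) :
    A ≃[edgeLang s] B where
  toEquiv := Equiv.ofBijective f ⟨f.injective, hf⟩
  map_fun' := fun g x => f.map_fun' g x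
  map_rel' := fun r x => f.map_rel' r x

end Basic

namespace EdgeTree

variable {s k : ℕ} (t : EdgeTree s k) {J J' : Type}

instance : Fintype t.Edge := inferInstanceAs (Fintype (Fin t.size))
instance : DecidableEq t.Edge := inferInstanceAs (DecidableEq (Fin t.size))

theorem card_edge : Fintype.card t.Edge = t.size := Fintype.card_fin _

/-- The parent of an edge. -/
def up (e : t.Edge) : t.Edge := t.par e

/-- The label of an edge. -/
def lb (e : t.Edge) : Fin s := t.lab e

theorem parentFun_eq (e : t.Edge) : parentFun s t.Edge e = t.up e := rfl

theorem hasLabel_iff (a : Fin s) (e : t.Edge) : HasLabel a e ↔ t.lb e = a := Iff.rfl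

theorem exists_loop (e : t.Edge) : ∃ j < k, t.up (t.up^[j] e) = t.up^[j] e := t.height_le e

variable {t} in
/-- Induction along the path from the root to an edge. -/
theorem edge_induction {P : t.Edge → Prop} (h0 : ∀ e, t.up e = e → P e)
    (h1 : ∀ e, t.up e ≠ e → P (t.up e) → P e) (e : t.Edge) : P e := by
  obtain ⟨j, -, hj⟩ := t.exists_loop e
  induction j generalizing e with
  | zero => exact h0 e hj
  | succ j ih =>
    by_cases h : t.up e = e
    · exact h0 e h
    · exact h1 e h (ih _ hj)

theorem map_up {t t' : EdgeTree s k} (f : t.Edge ↪[edgeLang s] t'.Edge) (e : t.Edge) :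
    f (t.up e) = t'.up (f e) := map_parentFun f e

theorem map_lb {t t' : EdgeTree s k} (f : t.Edge ↪[edgeLang s] t'.Edge) (e : t.Edge) :
    t'.lb (f e) = t.lb e := (map_hasLabel f (t.lb e) e).2 rfl

theorem map_up_eq_iff {t t' : EdgeTree s k} (f : t.Edge ↪[edgeLang s] t'.Edge) (e : t.Edge) :
    t'.up (f e) = f e ↔ t.up e = e := by
  rw [← map_up, f.injective.eq_iff]

/-- The sequence of labels and values of `u` on the first `j` edges of the path from an edge to
the root. -/
def wordAux (u : t.Edge → J) : ℕ → t.Edge → List (Fin s × J)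
  | 0, _ => []
  | j + 1, e => (t.lb e, u e) :: if t.up e = e then [] else wordAux u j (t.up e)

/-- The sequence of labels and values of `u` on the path from an edge to the root. -/
def word (u : t.Edge → J) (e : t.Edge) : List (Fin s × J) := t.wordAux u k e

theorem length_wordAux_le (u : t.Edge → J) (j : ℕ) (e : t.Edge) :
    (t.wordAux u j e).length ≤ j := by
  induction j generalizing e with
  | zero => simp [wordAux]
  | succ j ih =>
    rw [wordAux]
    split_ifs
    · simp
    · simpa using ih _

theorem length_word_le (u : t.Edge → J) (e : t.Edge) : (t.word u e).length ≤ k :=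
  t.length_wordAux_le u k e

/-- The recursion stops at the first loop, so any bound on its depth beyond that point gives the
same word. -/
theorem wordAux_eq (u : t.Edge → J) {j l : ℕ} {e : t.Edge}
    (h : t.up (t.up^[j] e) = t.up^[j] e) (hl : j < l) :
    t.wordAux u l e = t.wordAux u (j + 1) e := by
  induction j generalizing e l with
  | zero =>
    obtain ⟨l, rfl⟩ := Nat.exists_eq_succ_of_ne_zero (Nat.ne_of_gt hl)
    have h' : t.up e = e := h
    simp [wordAux, h']
  | succ j ih =>
    obtain ⟨l, rfl⟩ := Nat.exists_eq_succ_of_ne_zero (Nat.ne_of_gt (Nat.zero_lt_of_lt hl))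
    rw [wordAux, wordAux, ih h (by omega)]

/-- The recursion without a depth bound: every edge reaches a loop in fewer than `k` steps, so the
bound `k` never truncates a word. -/
theorem word_eq (u : t.Edge → J) (e : t.Edge) :
    t.word u e = (t.lb e, u e) :: if t.up e = e then [] else t.word u (t.up e) := by
  obtain ⟨j, hjk, hj⟩ := t.exists_loop e
  obtain ⟨l, rfl⟩ := Nat.exists_eq_succ_of_ne_zero (Nat.ne_of_gt (Nat.zero_lt_of_lt hjk))
  by_cases h : t.up e = e
  · simp [word, wordAux, h]
  · cases j with
    | zero => exact absurd hj h
    | succ j =>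
      have hj' : t.up (t.up^[j] (t.up e)) = t.up^[j] (t.up e) := hj
      simp only [word]
      rw [wordAux, wordAux_eq t u (l := l) hj' (by omega),
        wordAux_eq t u (l := l + 1) hj' (by omega)]

theorem word_of_loop (u : t.Edge → J) {e : t.Edge} (h : t.up e = e) :
    t.word u e = [(t.lb e, u e)] := by
  rw [word_eq, if_pos h]

theorem word_of_not_loop (u : t.Edge → J) {e : t.Edge} (h : t.up e ≠ e) :
    t.word u e = (t.lb e, u e) :: t.word u (t.up e) := by
  rw [word_eq, if_neg h]

theorem word_ne_nil (u : t.Edge → J) (e : t.Edge) : t.word u e ≠ [] := by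
  rw [word_eq]
  simp

theorem word_map (g : J → J') (u : t.Edge → J) (e : t.Edge) :
    (t.word u e).map (Prod.map id g) = t.word (g ∘ u) e := by
  induction e using edge_induction with
  | h0 e h => simp [word_of_loop _ _ h]
  | h1 e h ih => simp [word_of_not_loop _ _ h, ih]

theorem word_comp {t t' : EdgeTree s k} (f : t.Edge ↪[edgeLang s] t'.Edge) (u : t'.Edge → J)
    (e : t.Edge) : t'.word u (f e) = t.word (u ∘ f) e := by
  induction e using edge_induction with
  | h0 e h =>
    rw [word_of_loop _ _ h, word_of_loop _ _ ((map_up_eq_iff f e).2 h), map_lb]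
    rfl
  | h1 e h ih =>
    rw [word_of_not_loop _ _ h, word_of_not_loop _ _ (mt (map_up_eq_iff f e).1 h), map_lb,
      ← map_up, ih]
    rfl

/-- Nonempty suffixes are the words of the ancestors. A condition imposed on all suffixes, as in
`WordTree`, therefore only has to be checked on words of edges. -/
theorem exists_eq_word_of_suffix (u : t.Edge → J) (e : t.Edge) {w : List (Fin s × J)}
    (hw : w ≠ []) (h : w <:+ t.word u e) : ∃ e', w = t.word u e' := by
  induction e using edge_induction with
  | h0 e he =>
    rw [word_of_loop _ _ he, List.suffix_cons_iff] at h
    rcases h with h | h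
    · exact ⟨e, by rw [word_of_loop _ _ he, h]⟩
    · exact absurd (List.suffix_nil.1 h) hw
  | h1 e he ih =>
    rw [word_of_not_loop _ _ he, List.suffix_cons_iff] at h
    rcases h with h | h
    · exact ⟨e, by rw [word_of_not_loop _ _ he, h]⟩
    · exact ih h

end EdgeTree

/-! ### Trees of words -/

/-- The parent operation on nonempty words. -/
def wordUp {α : Type} (w : List α) : List α := if w.tail = [] then w else w.tail

theorem EdgeTree.word_up {s k : ℕ} (t : EdgeTree s k) {J : Type} (u : t.Edge → J) (e : t.Edge) :
    t.word u (t.up e) = wordUp (t.word u e) := by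
  by_cases h : t.up e = e
  · rw [h, t.word_of_loop u h]
    simp [wordUp]
  · rw [t.word_of_not_loop u h]
    simp [wordUp, t.word_ne_nil]

/-- The tree of all words of length at most `k` over `Fin s × J` all of whose nonempty suffixes
satisfy `P`; the parent of a word is its tail. -/
def WordTree (s k : ℕ) {J : Type} (P : List (Fin s × J) → Prop) : Type :=
  {w : List (Fin s × J) // w ≠ [] ∧ w.length ≤ k ∧ ∀ u, u ≠ [] → u <:+ w → P u}

namespace WordTree

variable {s k : ℕ} {J : Type} {P : List (Fin s × J) → Prop}

/-- The parent operation of the tree of words. -/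
def up (w : WordTree s k P) : WordTree s k P :=
  ⟨wordUp w.1, by
    obtain ⟨w, h0, h1, h2⟩ := w
    unfold wordUp
    dsimp only
    split_ifs with h
    · exact ⟨h0, h1, h2⟩
    · refine ⟨h, ?_, fun u hu hs => h2 u hu (hs.trans (List.tail_suffix w))⟩
      rw [List.length_tail]
      omega⟩

/-- The last letter of a word. -/
def hd (w : WordTree s k P) : Fin s × J := w.1.head w.2.1

instance : (edgeLang s).Structure (WordTree s k P) where
  funMap f xs := match f with
    | EdgeFunc.parent => up (xs 0)
  RelMap r xs := match r with
    | EdgeRel.hasLabel a => (hd (xs 0)).1 = a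

theorem hasLabel_iff (a : Fin s) (w : WordTree s k P) : HasLabel a w ↔ (hd w).1 = a := Iff.rfl

theorem isEdgeTree [Finite (WordTree s k P)] : IsEdgeTree s k (WordTree s k P) where
  finite := inferInstance
  existsUnique_label w := ⟨(hd w).1, rfl, fun _ h => h.symm⟩
  height_le w := by
    change ∃ j < k, up (up^[j] w) = up^[j] w
    -- A step to the parent removes one letter until a single letter is left, which is a loop. Hence
    -- length `n + 1` needs at most `n` steps.
    have key : ∀ (n : ℕ) (w : WordTree s k P), w.1.length ≤ n + 1 → up (up^[n] w) = up^[n] w := by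
      intro n
      induction n with
      | zero =>
        intro w hw
        apply Subtype.ext
        have : w.1.tail = [] := by
          apply List.eq_nil_of_length_eq_zero
          rw [List.length_tail]
          omega
        simp [up, wordUp, this]
      | succ n ih =>
        intro w hw
        rw [Function.iterate_succ_apply]
        by_cases h : w.1.tail = []
        · have : up w = w := by
            apply Subtype.ext
            simp [up, wordUp, h]
          rw [this]
          apply ih
          have h2 : w.1.length - 1 = 0 := by rw [← List.length_tail, h]; rfl
          omega
        · apply ih
          have : (up w).1 = w.1.tail := by simp [up, wordUp, h]
          rw [this, List.length_tail]
          omega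
    have hl : 0 < w.1.length := List.length_pos_of_ne_nil w.2.1
    have hk := w.2.2.1
    exact ⟨k - 1, by omega, key _ _ (by omega)⟩

/-- The word of an edge as an element of the tree of words. -/
def ofEdge {t : EdgeTree s k} (u : t.Edge → J) (hP : ∀ e, P (t.word u e)) (e : t.Edge) :
    WordTree s k P :=
  ⟨t.word u e, t.word_ne_nil u e, t.length_word_le u e, fun w hw hs => by
    obtain ⟨e', rfl⟩ := t.exists_eq_word_of_suffix u e hw hs
    exact hP e'⟩

theorem hd_ofEdge {t : EdgeTree s k} (u : t.Edge → J) (hP : ∀ e, P (t.word u e)) (e : t.Edge) :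
    hd (ofEdge u hP e) = (t.lb e, u e) := by
  unfold hd ofEdge
  simp [t.word_eq u e]

/-- The embedding of an edge-labelled tree in a tree of words that is given by a map `u`. -/
def emb {t : EdgeTree s k} (u : t.Edge → J) (hP : ∀ e, P (t.word u e))
    (hu : Function.Injective (t.word u)) : t.Edge ↪[edgeLang s] WordTree s k P :=
  mkEmb (ofEdge u hP)
    (fun e e' h => hu (congrArg Subtype.val h))
    (fun e => Subtype.ext (t.word_up u e))
    (fun a e => by rw [hasLabel_iff, EdgeTree.hasLabel_iff, hd_ofEdge])

/-- The map that describes an embedding in a tree of words. -/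
def code {t : EdgeTree s k} (α : t.Edge ↪[edgeLang s] WordTree s k P) (e : t.Edge) : J :=
  (hd (α e)).2

/-- An embedding into a tree of words is determined by the last letters of its values, since parents
go to tails and loops to words of length one. With `code_emb` this turns embeddings into maps
`t.Edge → J`. -/
theorem word_code {t : EdgeTree s k} (α : t.Edge ↪[edgeLang s] WordTree s k P) (e : t.Edge) :
    t.word (code α) e = (α e).1 := by
  have hhd : ∀ e, (t.lb e, code α e) = hd (α e) := fun e => by
    have := (map_hasLabel α (t.lb e) e).2 rfl
    rw [hasLabel_iff] at this
    rw [← this]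
    rfl
  have hcons : ∀ w : WordTree s k P, w.1 = hd w :: w.1.tail := fun w =>
    (List.cons_head_tail w.2.1).symm
  have hup : ∀ e, (α (t.up e)).1 = wordUp (α e).1 := fun e =>
    congrArg Subtype.val (map_parentFun α e)
  induction e using EdgeTree.edge_induction with
  | h0 e h =>
    rw [t.word_of_loop _ h, hhd, hcons (α e)]
    have := hup e
    rw [h] at this
    unfold wordUp at this
    split_ifs at this with h'
    · rw [h']
    · exfalso
      have h2 := congrArg List.length this
      have h3 : 0 < (α e).1.length := List.length_pos_of_ne_nil (α e).2.1
      rw [List.length_tail] at h2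
      omega
  | h1 e h ih =>
    rw [t.word_of_not_loop _ h, hhd, ih, hcons (α e), hup]
    unfold wordUp
    split_ifs with h'
    · exfalso
      apply h
      apply α.injective
      apply Subtype.ext
      rw [hup, wordUp, if_pos h']
    · rfl

theorem code_emb {t : EdgeTree s k} (u : t.Edge → J) (hP hu) :
    code (emb (P := P) u hP hu) = u := by
  ext e
  exact congrArg Prod.snd (hd_ofEdge u hP e)

theorem code_comp {t t' : EdgeTree s k} (α : t'.Edge ↪[edgeLang s] WordTree s k P)
    (f : t.Edge ↪[edgeLang s] t'.Edge) : code (α.comp f) = code α ∘ f := rfl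

theorem word_code_injective {t : EdgeTree s k} (α : t.Edge ↪[edgeLang s] WordTree s k P) :
    Function.Injective (t.word (code α)) := fun e e' h => by
  rw [word_code, word_code] at h
  exact α.injective (Subtype.ext h)

theorem pred_word_code {t : EdgeTree s k} (α : t.Edge ↪[edgeLang s] WordTree s k P) (e : t.Edge) :
    P (t.word (code α) e) := by
  rw [word_code]
  exact (α e).2.2.2 _ (α e).2.1 (List.suffix_refl _)

theorem emb_code {t : EdgeTree s k} (α : t.Edge ↪[edgeLang s] WordTree s k P) :
    emb (code α) (pred_word_code α) (word_code_injective α) = α := by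
  ext e
  apply Subtype.ext
  exact word_code α e

end WordTree

/-! ### Injectivity of words as a condition on siblings -/

namespace EdgeTree

variable {s k : ℕ} (t : EdgeTree s k) {J : Type}

/-- Two edges are siblings if they originate in the same node. -/
def Sib (e e' : t.Edge) : Prop :=
  (t.up e = e ∧ t.up e' = e') ∨ (t.up e ≠ e ∧ t.up e' ≠ e' ∧ t.up e = t.up e')

/-- Equal words have equal tails, so by induction from the root the parents coincide and only
siblings can collide. This makes being an embedding a local colouring condition. -/
theorem word_injective_iff (u : t.Edge → J) : Function.Injective (t.word u) ↔
    ∀ e e', t.Sib e e' → t.lb e = t.lb e' → u e = u e' → e = e' := by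
  constructor
  · intro h e e' hs hl hu
    apply h
    rcases hs with ⟨h1, h2⟩ | ⟨h1, h2, h3⟩
    · rw [t.word_of_loop _ h1, t.word_of_loop _ h2, hl, hu]
    · rw [t.word_of_not_loop _ h1, t.word_of_not_loop _ h2, hl, hu, h3]
  · intro h e
    induction e using edge_induction with
    | h0 e he =>
      intro e' hw
      rw [t.word_of_loop _ he, t.word_eq u e'] at hw
      split_ifs at hw with h'
      · simp only [List.cons.injEq, Prod.mk.injEq, and_true] at hw
        exact h e e' (Or.inl ⟨he, h'⟩) hw.1 hw.2
      · simp only [List.cons.injEq, Prod.mk.injEq] at hw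
        exact absurd hw.2.symm (t.word_ne_nil _ _)
    | h1 e he ih =>
      intro e' hw
      rw [t.word_of_not_loop _ he, t.word_eq u e'] at hw
      split_ifs at hw with h'
      · simp only [List.cons.injEq, Prod.mk.injEq] at hw
        exact absurd hw.2 (t.word_ne_nil _ _)
      · simp only [List.cons.injEq, Prod.mk.injEq] at hw
        exact h e e' (Or.inr ⟨he, h', ih hw.2⟩) hw.1.1 hw.1.2

theorem word_injective_of_injective {u : t.Edge → J} (hu : Function.Injective u) :
    Function.Injective (t.word u) :=
  (t.word_injective_iff u).2 fun _ _ _ _ h => hu h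

end EdgeTree

end TreeInterp

namespace TreeInterp

open FirstOrder

/-! ### Counting colourings by polynomials -/

/-- Polynomials over `ℕ` are determined by their values. -/
theorem natPolynomial_funext {I : Type} {p q : MvPolynomial I ℕ}
    (h : ∀ v : I → ℕ, MvPolynomial.eval v p = MvPolynomial.eval v q) : p = q := by
  apply MvPolynomial.map_injective (Nat.castRingHom ℤ) Nat.cast_injective
  apply MvPolynomial.funext_set (fun _ => Set.range (Nat.cast : ℕ → ℤ))
  · intro i
    exact Set.infinite_range_of_injective Nat.cast_injective
  · intro x hx
    choose v hv using fun i => hx i (Set.mem_univ i)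
    have hx' : x = fun i => (Nat.castRingHom ℤ) (v i) := funext fun i => (hv i).symm
    rw [hx', MvPolynomial.eval_map, MvPolynomial.eval_map]
    have := congrArg (Nat.castRingHom ℤ) (h v)
    simp only [MvPolynomial.eval, MvPolynomial.coe_eval₂Hom] at this
    rw [MvPolynomial.eval₂_comp_left, MvPolynomial.eval₂_comp_left] at this
    simpa [Function.comp_def] using this

theorem exists_natEval_ne_zero {I : Type} {p : MvPolynomial I ℤ} (h : p ≠ 0) :
    ∃ v : I → ℕ, MvPolynomial.eval (fun i => (v i : ℤ)) p ≠ 0 := by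
  by_contra! hc
  apply h
  apply MvPolynomial.funext_set (fun _ => Set.range (Nat.cast : ℕ → ℤ))
  · intro i
    exact Set.infinite_range_of_injective Nat.cast_injective
  · intro x hx
    choose v hv using fun i => hx i (Set.mem_univ i)
    have hx' : x = fun i => ((v i : ℕ) : ℤ) := funext fun i => (hv i).symm
    rw [hx', hc, map_zero]

/-- The colours outside a finite set with `r` elements are enumerated. -/
theorem nonempty_equiv_fin_sub (n r : ℕ) (T : Finset ℕ) (hT : ∀ a ∈ T, a < n) (hr : T.card = r) :
    Nonempty ({a : ℕ // a < n ∧ a ∉ T} ≃ Fin (n - r)) := by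
  have hsub : T ⊆ Finset.range n := fun a ha => Finset.mem_range.2 (hT a ha)
  have hcard : (Finset.range n \ T).card = n - r := by
    rw [Finset.card_sdiff_of_subset hsub, Finset.card_range, hr]
  refine ⟨(Equiv.subtypeEquivRight fun a => ?_).trans (Finset.equivFinOfCardEq hcard)⟩
  simp

theorem degree_sum_single {C I : Type} (D : Finset C) (w : C → I) :
    (∑ c ∈ D, Finsupp.single (w c) 1).degree = D.card := by
  rw [map_sum]
  simp

/-- If `q` has degree `d` with the single top monomial `ν`, then only the summand `q * X i` reaches
degree `d + 1`, and there it has the single monomial `X i * ν`. -/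
theorem coeff_mul_X_add_C {I : Type} [DecidableEq I] {q : MvPolynomial I ℕ} {μ ν : I →₀ ℕ} {i : I} {a d : ℕ}
    (hν : ν.degree = d)
    (hq : ∀ μ : I →₀ ℕ, d ≤ μ.degree → q.coeff μ = if μ = ν then 1 else 0)
    (hμ : d + 1 ≤ μ.degree) :
    (q * (MvPolynomial.X i + MvPolynomial.C a)).coeff μ =
      if μ = Finsupp.single i 1 + ν then 1 else 0 := by
  rw [mul_add, MvPolynomial.coeff_add, MvPolynomial.coeff_mul_X', mul_comm q (MvPolynomial.C a),
    MvPolynomial.coeff_C_mul, hq μ (by omega), if_neg (c := μ = ν) (by rintro rfl; omega),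
    mul_zero, add_zero]
  by_cases hi : i ∈ μ.support
  · have hle : Finsupp.single i 1 ≤ μ := by
      rw [Finsupp.single_le_iff]
      exact Nat.one_le_iff_ne_zero.2 (Finsupp.mem_support_iff.1 hi)
    have hdeg : (μ - Finsupp.single i 1).degree + 1 = μ.degree := by
      have h := congrArg Finsupp.degree (tsub_add_cancel_of_le hle)
      rw [map_add] at h
      simpa using h
    rw [if_pos hi, hq _ (by omega)]
    congr 1
    apply propext
    rw [tsub_eq_iff_eq_add_of_le hle, add_comm]
  · rw [if_neg hi, if_neg]
    rintro rfl
    apply hi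
    simp

section Colouring

variable {C I : Type} [Fintype C] [DecidableEq C] [DecidableEq I]

/-- The colours of the elements of `D` are below their bounds, and related elements of `D` have
different colours. -/
def ProperOn (R : C → C → Prop) (w : C → I) (m : ℕ) (v : I → ℕ) (D : Finset C) (f : C → ℕ) :
    Prop :=
  (∀ c ∈ D, f c < m + v (w c)) ∧ ∀ c ∈ D, ∀ c' ∈ D, R c c' → f c = f c' → c = c'

/-- The elements of `D` are coloured one at a time. If `T` is the set of already coloured elements
related to `d`, transitivity makes their colours pairwise different, and they all lie below the
common bound `m + v (w d)`. So `d` has exactly `v (w d) + (m - T.card)` free colours, whatever the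
colours of `T` are. The summand `m` in the bounds keeps the subtraction from truncating, and the
product of these linear factors has the stated top monomial. -/
theorem exists_colouring_polynomial (R : C → C → Prop) (hsymm : ∀ c c', R c c' → R c' c)
    (htrans : ∀ a b c, R a b → R b c → R a c) (w : C → I)
    (hw : ∀ c c', R c c' → w c = w c') (m : ℕ) (hm : Fintype.card C ≤ m) (S D : Finset C)
    (hSD : Disjoint S D) :
    ∃ q : MvPolynomial I ℕ,
      (∀ (v : I → ℕ) (f₀ : C → ℕ), ProperOn R w m v S f₀ →
        Nonempty ({f : C → ℕ // (∀ c, c ∉ D → f c = f₀ c) ∧ ProperOn R w m v (S ∪ D) f} ≃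
          Fin (MvPolynomial.eval v q))) ∧
      ∀ μ : I →₀ ℕ, D.card ≤ μ.degree →
        q.coeff μ = if μ = ∑ c ∈ D, Finsupp.single (w c) 1 then 1 else 0 := by
  classical
  induction D using Finset.induction_on with
  | empty =>
    refine ⟨1, fun v f₀ h₀ => ?_, fun μ _ => ?_⟩
    · rw [map_one]
      refine ⟨@Equiv.ofUnique _ _ ⟨⟨⟨f₀, fun _ _ => rfl, by simpa using h₀⟩⟩, ?_⟩ _⟩
      rintro ⟨f, hf, -⟩
      apply Subtype.ext
      funext c
      exact hf c (by simp)
    · rw [MvPolynomial.coeff_one]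
      simp only [eq_comm (a := (0 : I →₀ ℕ)), Finset.sum_empty]
      congr
  | insert d D hd ih =>
    rw [Finset.disjoint_insert_right] at hSD
    obtain ⟨q, hq, hc⟩ := ih hSD.2
    set T : Finset C := (S ∪ D).filter fun c => R c d with hT
    have hdT : d ∉ S ∪ D := by simp [hSD.1, hd]
    have hTm : T.card ≤ m := (Finset.card_le_univ T).trans hm
    refine ⟨q * (MvPolynomial.X (w d) + MvPolynomial.C (m - T.card)), fun v f₀ h₀ => ?_, ?_⟩
    · obtain ⟨e⟩ := hq v f₀ h₀
      have key : ∀ f : {f : C → ℕ // (∀ c, c ∉ D → f c = f₀ c) ∧ ProperOn R w m v (S ∪ D) f},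
          Nonempty ({a : ℕ // a < m + v (w d) ∧ a ∉ T.image f.1} ≃
            Fin (v (w d) + (m - T.card))) := by
        intro f
        have hcard : (T.image f.1).card = T.card := by
          apply Finset.card_image_of_injOn
          intro c hc c' hc' h
          simp only [hT, Finset.coe_filter, Set.mem_ofPred_eq] at hc hc'
          exact f.2.2.2 c hc.1 c' hc'.1 (htrans _ _ _ hc.2 (hsymm _ _ hc'.2)) h
        have := nonempty_equiv_fin_sub (m + v (w d)) T.card (T.image f.1) (by
          intro a ha
          obtain ⟨c, hc, rfl⟩ := Finset.mem_image.1 ha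
          simp only [hT, Finset.mem_filter] at hc
          rw [← hw c d hc.2]
          exact f.2.2.1 c hc.1) hcard
        rwa [show m + v (w d) - T.card = v (w d) + (m - T.card) by omega] at this
      have e' := fun f => (key f).some
      -- A colouring splits into the colour of `d` and the rest. In the rest, `d` is reset to `f₀ d`
      -- because functions there have to agree with `f₀` outside `D`.
      have hmain : {f : C → ℕ // (∀ c, c ∉ insert d D → f c = f₀ c) ∧
            ProperOn R w m v (S ∪ insert d D) f} ≃
          (Σ f : {f : C → ℕ // (∀ c, c ∉ D → f c = f₀ c) ∧ ProperOn R w m v (S ∪ D) f},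
            {a : ℕ // a < m + v (w d) ∧ a ∉ T.image f.1}) := by
        have hne : ∀ c ∈ S ∪ D, c ≠ d := fun c hc h => hdT (h ▸ hc)
        have hmem : S ∪ insert d D = insert d (S ∪ D) := by
          rw [Finset.union_insert]
        refine
          { toFun := fun f => ⟨⟨Function.update f.1 d (f₀ d), ?_, ?_⟩, ⟨f.1 d, ?_, ?_⟩⟩
            invFun := fun x => ⟨Function.update x.1.1 d x.2.1, ?_, ?_⟩
            left_inv := ?_
            right_inv := ?_ }
        · intro c hc
          by_cases h : c = d
          · subst h
            simp
          · rw [Function.update_of_ne h]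
            exact f.2.1 c (by simp [h, hc])
        · obtain ⟨f, -, h1, h2⟩ := f
          rw [hmem] at h1 h2
          constructor
          · intro c hc
            rw [Function.update_of_ne (hne c hc)]
            exact h1 c (Finset.mem_insert_of_mem hc)
          · intro c hc c' hc'
            rw [Function.update_of_ne (hne c hc), Function.update_of_ne (hne c' hc')]
            exact h2 c (Finset.mem_insert_of_mem hc) c' (Finset.mem_insert_of_mem hc')
        · obtain ⟨f, -, h1, h2⟩ := f
          exact h1 d (by simp)
        · obtain ⟨f, -, h1, h2⟩ := f
          intro h
          obtain ⟨c, hc, hcf⟩ := Finset.mem_image.1 h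
          simp only [hT, Finset.mem_filter] at hc
          change Function.update f d (f₀ d) c = f d at hcf
          rw [Function.update_of_ne (hne c hc.1)] at hcf
          rw [hmem] at h2
          exact hne c hc.1 (h2 c (Finset.mem_insert_of_mem hc.1) d (by simp) hc.2 hcf)
        · intro c hc
          rw [Finset.mem_insert, not_or] at hc
          rw [Function.update_of_ne hc.1]
          exact x.1.2.1 c hc.2
        · obtain ⟨⟨f, h0, h1, h2⟩, a, ha1, ha2⟩ := x
          rw [hmem]
          have ha3 : ∀ c ∈ S ∪ D, R c d → f c ≠ a := fun c hc hr h =>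
            ha2 (Finset.mem_image.2 ⟨c, by simp only [hT, Finset.mem_filter]; exact ⟨hc, hr⟩, h⟩)
          constructor
          · intro c hc
            rcases Finset.mem_insert.1 hc with rfl | hc
            · simpa using ha1
            · rw [Function.update_of_ne (hne c hc)]
              exact h1 c hc
          · intro c hc c' hc' hr
            rcases Finset.mem_insert.1 hc with h3 | h3 <;>
              rcases Finset.mem_insert.1 hc' with h4 | h4
            · exact fun _ => h3.trans h4.symm
            · subst h3
              rw [Function.update_self, Function.update_of_ne (hne c' h4)]
              exact fun h => absurd h.symm (ha3 c' h4 (hsymm _ _ hr))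
            · subst h4
              rw [Function.update_self, Function.update_of_ne (hne c h3)]
              exact fun h => absurd h (ha3 c h3 hr)
            · rw [Function.update_of_ne (hne c h3), Function.update_of_ne (hne c' h4)]
              exact h2 c h3 c' h4 hr
        · intro f
          apply Subtype.ext
          simp
        · rintro ⟨⟨f, h0, h⟩, a, ha⟩
          have hfd : f d = f₀ d := h0 d hd
          have : Function.update (Function.update f d a) d (f₀ d) = f := by
            rw [Function.update_idem, ← hfd, Function.update_eq_self]
          simp only [Sigma.mk.injEq, Subtype.mk.injEq]
          refine ⟨this, ?_⟩
          congr 1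
          · funext b
            rw [this]
          · simp
          · exact proof_irrel_heq _ _
      refine ⟨hmain.trans ((Equiv.sigmaCongrRight fun f => e' f).trans
        ((Equiv.sigmaEquivProd _ _).trans ((Equiv.prodCongrLeft fun _ => e).trans
          (finProdFinEquiv.trans (finCongr ?_)))))⟩
      simp
    · intro μ hμ
      rw [Finset.card_insert_of_notMem hd] at hμ
      rw [Finset.sum_insert hd]
      exact coeff_mul_X_add_C (degree_sum_single D w) hc hμ

end Colouring
end TreeInterp

namespace TreeInterp

open FirstOrder

/-! ### Colourings of edge-labelled trees and their extensions -/

namespace EdgeTree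

variable {s k m : ℕ}

/-- Two edges have the same origin, label and value of `g`. -/
def SameClass (t : EdgeTree s k) (g : t.Edge → Fin m) (e e' : t.Edge) : Prop :=
  t.Sib e e' ∧ t.lb e = t.lb e' ∧ g e = g e'

theorem Sib.symm {t : EdgeTree s k} {e e' : t.Edge} (h : t.Sib e e') : t.Sib e' e := by
  rcases h with ⟨h1, h2⟩ | ⟨h1, h2, h3⟩
  · exact Or.inl ⟨h2, h1⟩
  · exact Or.inr ⟨h2, h1, h3.symm⟩

theorem Sib.trans {t : EdgeTree s k} {a b c : t.Edge} (h : t.Sib a b) (h' : t.Sib b c) :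
    t.Sib a c := by
  rcases h with ⟨h1, h2⟩ | ⟨h1, h2, h3⟩ <;> rcases h' with ⟨h4, h5⟩ | ⟨h4, h5, h6⟩
  · exact Or.inl ⟨h1, h5⟩
  · exact absurd h2 h4
  · exact absurd h4 h2
  · exact Or.inr ⟨h1, h5, h3.trans h6⟩

theorem sib_map {t t' : EdgeTree s k} (f : t.Edge ↪[edgeLang s] t'.Edge) (e e' : t.Edge) :
    t'.Sib (f e) (f e') ↔ t.Sib e e' := by
  unfold Sib
  simp only [ne_eq, ← map_up, f.injective.eq_iff]

theorem SameClass.word_eq {t : EdgeTree s k} {g : t.Edge → Fin m} {e e' : t.Edge}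
    (h : t.SameClass g e e') : t.word g e = t.word g e' := by
  obtain ⟨h0, hl, hg⟩ := h
  rcases h0 with ⟨h1, h2⟩ | ⟨h1, h2, h3⟩
  · rw [t.word_of_loop _ h1, t.word_of_loop _ h2, hl, hg]
  · rw [t.word_of_not_loop _ h1, t.word_of_not_loop _ h2, hl, hg, h3]

/-- `f` assigns numbers below the given bounds to the edges, and different numbers to different
edges with the same origin, label and value of `g`. -/
def Col (t : EdgeTree s k) (v : List (Fin s × Fin m) → ℕ) (g : t.Edge → Fin m)
    (f : t.Edge → ℕ) : Prop :=
  (∀ e, f e < m + v (t.word g e)) ∧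
    ∀ e e', t.Sib e e' → t.lb e = t.lb e' → g e = g e' → f e = f e' → e = e'

/-- The edges outside the range of an embedding. -/
def newEdges {B C : EdgeTree s k} (j : B.Edge ↪[edgeLang s] C.Edge) : Finset C.Edge :=
  (Finset.univ.image j)ᶜ

theorem mem_newEdges {B C : EdgeTree s k} (j : B.Edge ↪[edgeLang s] C.Edge) (e : C.Edge) :
    e ∈ newEdges j ↔ ∀ b, j b ≠ e := by
  simp [newEdges]

theorem card_newEdges {B C : EdgeTree s k} (j : B.Edge ↪[edgeLang s] C.Edge) :
    (newEdges j).card + B.size = C.size := by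
  have h := Finset.card_compl_add_card (Finset.univ.image j)
  rw [Finset.card_image_of_injective _ j.injective, Finset.card_univ, card_edge, card_edge] at h
  exact h

/-- The colouring polynomial for the relation `SameClass g`: the edges in the range of `j` are
precoloured, and the new edges are to be coloured. Edges of one class have the same word, hence the
same bound. -/
theorem exists_extPoly {B C : EdgeTree s k} (hm : C.size ≤ m) (j : B.Edge ↪[edgeLang s] C.Edge)
    (g : C.Edge → Fin m) :
    ∃ q : MvPolynomial (List (Fin s × Fin m)) ℕ,
      (∀ (v : List (Fin s × Fin m) → ℕ) (f₀ : B.Edge → ℕ), B.Col v (g ∘ j) f₀ →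
        Nonempty ({f : C.Edge → ℕ // f ∘ j = f₀ ∧ C.Col v g f} ≃ Fin (MvPolynomial.eval v q))) ∧
      ∀ μ : List (Fin s × Fin m) →₀ ℕ, (newEdges j).card ≤ μ.degree →
        q.coeff μ = if μ = ∑ e ∈ newEdges j, Finsupp.single (C.word g e) 1 then 1 else 0 := by
  obtain ⟨q, hq, hc⟩ := exists_colouring_polynomial (C.SameClass g)
    (fun e e' h => ⟨h.1.symm, h.2.1.symm, h.2.2.symm⟩)
    (fun a b c h h' => ⟨h.1.trans h'.1, h.2.1.trans h'.2.1, h.2.2.trans h'.2.2⟩)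
    (C.word g) (fun e e' h => h.word_eq) m (by rwa [card_edge])
    (Finset.univ.image j) (newEdges j) disjoint_compl_right
  refine ⟨q, fun v f₀ h₀ => ?_, hc⟩
  -- The default value 0 falls on new edges only, where the precolouring is not consulted.
  have hext : ∀ b, Function.extend j f₀ (fun _ => 0) (j b) = f₀ b :=
    fun b => j.injective.extend_apply _ _ _
  obtain ⟨E⟩ := hq v (Function.extend j f₀ fun _ => 0) (by
    constructor
    · intro c hc
      obtain ⟨b, -, rfl⟩ := Finset.mem_image.1 hc
      rw [hext, word_comp]
      exact h₀.1 b
    · intro c hc c' hc' hr hf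
      obtain ⟨b, -, rfl⟩ := Finset.mem_image.1 hc
      obtain ⟨b', -, rfl⟩ := Finset.mem_image.1 hc'
      rw [hext, hext] at hf
      obtain ⟨h1, h2, h3⟩ := hr
      rw [map_lb, map_lb] at h2
      rw [h₀.2 b b' ((sib_map j b b').1 h1) h2 h3 hf])
  refine ⟨(Equiv.subtypeEquivRight fun f => ?_).trans E⟩
  have hun : Finset.univ.image j ∪ newEdges j = Finset.univ := Finset.union_compl _
  rw [hun]
  apply and_congr
  · constructor
    · rintro rfl c hc
      have : ∃ b, j b = c := by
        by_contra hcon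
        exact hc ((mem_newEdges j c).2 fun b hb => hcon ⟨b, hb⟩)
      obtain ⟨b, rfl⟩ := this
      rw [hext]
      rfl
    · intro h
      funext b
      rw [← hext b]
      apply h
      intro hb
      exact (mem_newEdges j _).1 hb b rfl
  · unfold Col ProperOn SameClass
    simp only [Finset.mem_univ, true_implies, and_imp]

/-- The polynomial that counts the extensions of a colouring along an embedding. -/
noncomputable def extPoly {B C : EdgeTree s k} (hm : C.size ≤ m)
    (j : B.Edge ↪[edgeLang s] C.Edge) (g : C.Edge → Fin m) :
    MvPolynomial (List (Fin s × Fin m)) ℕ :=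
  (exists_extPoly hm j g).choose

theorem nonempty_equiv_extPoly {B C : EdgeTree s k} (hm : C.size ≤ m)
    (j : B.Edge ↪[edgeLang s] C.Edge) (g : C.Edge → Fin m) {v : List (Fin s × Fin m) → ℕ}
    {f₀ : B.Edge → ℕ} (h : B.Col v (g ∘ j) f₀) :
    Nonempty ({f : C.Edge → ℕ // f ∘ j = f₀ ∧ C.Col v g f} ≃
      Fin (MvPolynomial.eval v (extPoly hm j g))) :=
  (exists_extPoly hm j g).choose_spec.1 v f₀ h

theorem coeff_extPoly {B C : EdgeTree s k} (hm : C.size ≤ m)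
    (j : B.Edge ↪[edgeLang s] C.Edge) (g : C.Edge → Fin m) {μ : List (Fin s × Fin m) →₀ ℕ}
    (h : (newEdges j).card ≤ μ.degree) :
    (extPoly hm j g).coeff μ =
      if μ = ∑ e ∈ newEdges j, Finsupp.single (C.word g e) 1 then 1 else 0 :=
  (exists_extPoly hm j g).choose_spec.2 μ h

/-- Isomorphisms preserve colourings. -/
theorem col_comp_iff {C C' : EdgeTree s k} (ι : C.Edge ≃[edgeLang s] C'.Edge)
    (v : List (Fin s × Fin m) → ℕ) (g : C'.Edge → Fin m) (f : C'.Edge → ℕ) :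
    C.Col v (g ∘ ι) (f ∘ ι) ↔ C'.Col v g f := by
  unfold Col
  have hw : ∀ e, C.word (g ∘ ι) e = C'.word g (ι e) := fun e => (word_comp ι.toEmbedding g e).symm
  have hs : ∀ e e', C.Sib e e' ↔ C'.Sib (ι e) (ι e') := fun e e' => (sib_map ι.toEmbedding e e').symm
  have hl : ∀ e, C.lb e = C'.lb (ι e) := fun e => (map_lb ι.toEmbedding e).symm
  simp only [hw, hs, hl, Function.comp_apply]
  constructor
  · rintro ⟨h1, h2⟩
    refine ⟨fun e => ?_, fun e e' => ?_⟩
    · obtain ⟨e, rfl⟩ := ι.surjective e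
      exact h1 e
    · obtain ⟨e, rfl⟩ := ι.surjective e
      obtain ⟨e', rfl⟩ := ι.surjective e'
      exact fun a b c d => congrArg ι (h2 e e' a b c d)
  · rintro ⟨h1, h2⟩
    exact ⟨fun e => h1 _, fun e e' a b c d => ι.injective (h2 _ _ a b c d)⟩

/-- `extPoly` is obtained by choice, so invariance cannot be read off its definition. Instead both
polynomials count sets in bijection at every `v`, and values at natural numbers determine a
polynomial. -/
theorem extPoly_comp {B B' C C' : EdgeTree s k} (hm : C.size ≤ m) (hm' : C'.size ≤ m)
    (j : B.Edge ↪[edgeLang s] C.Edge) (j' : B'.Edge ↪[edgeLang s] C'.Edge)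
    (ι : C.Edge ≃[edgeLang s] C'.Edge) (θ : B.Edge ≃[edgeLang s] B'.Edge)
    (h : ∀ b, ι (j b) = j' (θ b)) (g : C'.Edge → Fin m) :
    extPoly hm j (g ∘ ι) = extPoly hm' j' g := by
  apply natPolynomial_funext
  intro v
  have hB' : B'.size ≤ m := by
    have := card_newEdges j'
    omega
  -- The counting property needs some colouring to extend. The numbers of the edges are distinct and
  -- below `m`, so they form one for every `v`.
  have h0 : B'.Col v (g ∘ j') (fun b => Fin.val (n := B'.size) b) := by
    refine ⟨fun e => ?_, fun e e' _ _ _ h => Fin.ext h⟩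
    have : Fin.val (n := B'.size) e < B'.size := Fin.isLt _
    dsimp only
    omega
  have hgj : (g ∘ ι) ∘ j = (g ∘ j') ∘ θ := funext fun b => congrArg g (h b)
  have h1 : B.Col v ((g ∘ ι) ∘ j) ((fun b => Fin.val (n := B'.size) b) ∘ θ) := by
    rw [hgj]
    exact (col_comp_iff θ v _ _).2 h0
  obtain ⟨E1⟩ := nonempty_equiv_extPoly hm j (g ∘ ι) h1
  obtain ⟨E2⟩ := nonempty_equiv_extPoly hm' j' g h0
  have E3 : {f : C'.Edge → ℕ // f ∘ j' = (fun b => Fin.val (n := B'.size) b) ∧ C'.Col v g f} ≃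
      {f : C.Edge → ℕ // f ∘ j = (fun b => Fin.val (n := B'.size) b) ∘ θ ∧
        C.Col v (g ∘ ι) f} := by
    refine (Equiv.arrowCongr ι.symm.toEquiv (Equiv.refl ℕ)).subtypeEquiv fun f => ?_
    have hf : Equiv.arrowCongr ι.symm.toEquiv (Equiv.refl ℕ) f = f ∘ ι := rfl
    rw [hf, col_comp_iff]
    apply and_congr_left
    intro _
    have : (f ∘ ι) ∘ j = (f ∘ j') ∘ θ := funext fun b => congrArg f (h b)
    rw [this]
    exact (θ.surjective.injective_comp_right.eq_iff).symm
  have := Fintype.card_congr (E1.symm.trans (E3.symm.trans E2))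
  simpa using this

end EdgeTree

/-! ### The test trees -/

section TestTree

variable (s k : ℕ) {m : ℕ}

/-- The index of the copy of the last letter of a word is below the bound given by `v`. -/
def IndexBound (v : List (Fin s × Fin m) → ℕ) (w : List (Fin s × (Fin m × ℕ))) : Prop :=
  ∀ x ∈ w.head?, x.2.2 < m + v (w.map (Prod.map id Prod.fst))

/-- The tree of all words over `Fin s × Fin m` with multiplicities given by `v`. -/
abbrev TestTree (v : List (Fin s × Fin m) → ℕ) : Type := WordTree s k (IndexBound s v)

instance (v : List (Fin s × Fin m) → ℕ) : Finite (TestTree s k v) := by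
  -- Only finitely many words without copy indices have length at most `k`, so one `M` bounds all
  -- copy indices. The bound reaches inner letters through the condition on suffixes.
  obtain ⟨M, hM⟩ := ((List.finite_length_le (Fin s × Fin m) k).image fun w => m + v w).bddAbove
  have hfin : Set.Finite ((List.map (Prod.map id (Prod.map id Fin.val)) :
      List (Fin s × (Fin m × Fin M)) → List (Fin s × (Fin m × ℕ))) '' {l | l.length ≤ k}) :=
    (List.finite_length_le (Fin s × (Fin m × Fin M)) k).image _
  apply Set.Finite.subset hfin
  rintro w ⟨-, hlen, hw⟩
  have hlt : ∀ x ∈ w, x.2.2 < M := by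
    intro x hx
    obtain ⟨a, b, rfl⟩ := List.append_of_mem hx
    have h1 := hw (x :: b) (by simp) (List.suffix_append a (x :: b)) x (by simp)
    refine h1.trans_le (hM ⟨_, ?_, rfl⟩)
    change (List.map _ _).length ≤ k
    rw [List.length_map]
    rw [List.length_append] at hlen
    omega
  refine ⟨w.pmap (fun x hx => (x.1, (x.2.1, ⟨x.2.2, hx⟩))) hlt, ?_, ?_⟩
  · change (List.pmap _ _ _).length ≤ k
    rwa [List.length_pmap]
  · rw [List.map_pmap]
    exact (List.pmap_eq_self.2 fun a h => rfl)

variable {s k}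

theorem indexBound_word (v : List (Fin s × Fin m) → ℕ) (t : EdgeTree s k)
    (u : t.Edge → Fin m × ℕ) (e : t.Edge) :
    IndexBound s v (t.word u e) ↔ (u e).2 < m + v (t.word (Prod.fst ∘ u) e) := by
  unfold IndexBound
  rw [t.word_map, t.word_eq u e]
  simp

/-- The bounds of a colouring are membership in the test tree, and its separation of siblings is
injectivity of words. An embedding is thus exactly a pair of `g` and a colouring. -/
theorem col_iff (v : List (Fin s × Fin m) → ℕ) (t : EdgeTree s k) (u : t.Edge → Fin m × ℕ) :
    t.Col v (Prod.fst ∘ u) (Prod.snd ∘ u) ↔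
      (∀ e, IndexBound s v (t.word u e)) ∧ Function.Injective (t.word u) := by
  rw [t.word_injective_iff]
  simp only [indexBound_word, EdgeTree.Col, Function.comp_apply, Prod.ext_iff, and_imp]

/-- Embeddings in the test tree are pairs of a map and a colouring. -/
noncomputable def embEquiv (v : List (Fin s × Fin m) → ℕ) (t : EdgeTree s k) :
    (t.Edge ↪[edgeLang s] TestTree s k v) ≃
      {u : t.Edge → Fin m × ℕ // t.Col v (Prod.fst ∘ u) (Prod.snd ∘ u)} where
  toFun α := ⟨WordTree.code α, (col_iff v t _).2
    ⟨WordTree.pred_word_code α, WordTree.word_code_injective α⟩⟩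
  invFun u := WordTree.emb u.1 ((col_iff v t _).1 u.2).1 ((col_iff v t _).1 u.2).2
  left_inv α := WordTree.emb_code α
  right_inv _ := Subtype.ext (WordTree.code_emb _ _ _)

end TestTree

end TreeInterp

namespace TreeInterp

open FirstOrder

/-! ### Forests of labels and their values on test trees -/

/-- Nodes labelled by edge-labelled trees, where the label of every node is embedded in the labels
of its children. -/
structure Forest (s k : ℕ) where
  /-- The nodes. -/
  X : Type
  /-- The label of a node. -/
  label : X → EdgeTree s k
  /-- The indices of the children of a node. -/
  ch : X → Type
  [fintype_ch : ∀ x, Fintype (ch x)]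
  /-- The children of a node. -/
  tgt : ∀ x, ch x → X
  /-- The inclusion of the label of a node in the label of a child. -/
  incl : ∀ x (c : ch x), (label x).Edge ↪[edgeLang s] (label (tgt x c)).Edge

attribute [instance] Forest.fintype_ch

/-- Iterated finite multisets, that is, unlabelled trees of bounded height up to isomorphism. -/
def IterMultiset : ℕ → Type
  | 0 => Unit
  | n + 1 => Multiset (IterMultiset n)

namespace Forest

variable {s k m : ℕ} (G : Forest s k) (hm : ∀ x, (G.label x).size ≤ m)

/-- The output tree of height `n` at a node with a given map to `Fin m`, as a function of the
multiplicities of the test tree. -/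
noncomputable def value : (n : ℕ) → (x : G.X) → ((G.label x).Edge → Fin m) →
    (List (Fin s × Fin m) → ℕ) → IterMultiset n
  | 0, _, _, _ => ()
  | n + 1, x, h, v => (∑ c : G.ch x,
      ∑ g : {g : (G.label (G.tgt x c)).Edge → Fin m // g ∘ G.incl x c = h},
        MvPolynomial.eval v (EdgeTree.extPoly (hm _) (G.incl x c) g.1) •
          {value n (G.tgt x c) g.1 v} : Multiset (IterMultiset n))

/-- The nodes together with a map of their labels to `Fin m`. -/
abbrev Pt (m : ℕ) : Type := Σ x : G.X, ((G.label x).Edge → Fin m)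

open Classical in
/-- The polynomial that counts the children with a given value. -/
noncomputable def childPoly (n : ℕ) (p : G.Pt m)
    (K : (List (Fin s × Fin m) → ℕ) → IterMultiset n) :
    MvPolynomial (List (Fin s × Fin m)) ℕ :=
  ∑ c : G.ch p.1, ∑ g : {g : (G.label (G.tgt p.1 c)).Edge → Fin m // g ∘ G.incl p.1 c = p.2},
    if G.value hm n (G.tgt p.1 c) g.1 = K then EdgeTree.extPoly (hm _) (G.incl p.1 c) g.1 else 0

open Classical in
/-- The values of all nodes. -/
noncomputable def values [Fintype G.X] (n : ℕ) :
    Finset ((List (Fin s × Fin m) → ℕ) → IterMultiset n) :=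
  Finset.univ.image fun p : G.Pt m => G.value hm n p.1 p.2

theorem value_mem_values [Fintype G.X] (n : ℕ) (x : G.X) (h : (G.label x).Edge → Fin m) :
    G.value hm n x h ∈ G.values hm n := by
  classical
  exact Finset.mem_image.2 ⟨⟨x, h⟩, Finset.mem_univ _, rfl⟩

/-- Children are grouped by their value as a function of all `v`, not by its evaluation at one `v`;
the multiplicities then are polynomials. -/
theorem value_succ [Fintype G.X] (n : ℕ) (p : G.Pt m) (v : List (Fin s × Fin m) → ℕ) :
    G.value hm (n + 1) p.1 p.2 v = (∑ K ∈ G.values hm n,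
      MvPolynomial.eval v (G.childPoly hm n p K) • {K v} : Multiset (IterMultiset n)) := by
  classical
  have h : ∀ K ∈ G.values hm n,
      (MvPolynomial.eval v (G.childPoly hm n p K) • {K v} : Multiset (IterMultiset n)) =
      ∑ c : G.ch p.1, ∑ g : {g : (G.label (G.tgt p.1 c)).Edge → Fin m // g ∘ G.incl p.1 c = p.2},
        if G.value hm n (G.tgt p.1 c) g.1 = K then
          MvPolynomial.eval v (EdgeTree.extPoly (hm _) (G.incl p.1 c) g.1) •
            {G.value hm n (G.tgt p.1 c) g.1 v} else (0 : Multiset (IterMultiset n)) := by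
    intro K _
    rw [childPoly, map_sum, Finset.sum_smul]
    refine Finset.sum_congr rfl fun c _ => ?_
    rw [map_sum, Finset.sum_smul]
    refine Finset.sum_congr rfl fun g _ => ?_
    split_ifs with h
    · rw [h]
    · rw [map_zero, zero_smul]
  rw [Finset.sum_congr rfl h, Finset.sum_comm]
  rw [value]
  change @Eq (Multiset (IterMultiset n)) _ _
  refine Finset.sum_congr rfl fun c _ => ?_
  rw [Finset.sum_comm]
  refine Finset.sum_congr rfl fun g _ => ?_
  rw [Finset.sum_ite_eq, if_pos (G.value_mem_values hm n _ _)]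

theorem eval_childPoly [Fintype G.X] [DecidableEq (IterMultiset n)] (p : G.Pt m)
    (v : List (Fin s × Fin m) → ℕ)
    (hinj : ∀ K ∈ G.values hm n, ∀ L ∈ G.values hm n, K v = L v → K = L)
    {K : (List (Fin s × Fin m) → ℕ) → IterMultiset n} (hK : K ∈ G.values hm n) :
    MvPolynomial.eval v (G.childPoly hm n p K) =
      Multiset.count (K v) (G.value hm (n + 1) p.1 p.2 v : Multiset (IterMultiset n)) := by
  rw [value_succ, Multiset.count_sum', Finset.sum_eq_single K]
  · simp
  · intro L hL hLK
    rw [Multiset.count_nsmul, Multiset.count_singleton, if_neg, mul_zero]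
    exact fun h => hLK (hinj K hK L hL h).symm
  · exact fun h => absurd hK h

/-- `D` is the product of the polynomial for the previous height and all nonzero differences of
child polynomials. Where `D` does not vanish, equal multisets have equal multiplicities by
`eval_childPoly`, so no difference of child polynomials can be nonzero, and the values agree as
functions. -/
theorem exists_generic [Fintype G.X] (n : ℕ) :
    ∃ D : MvPolynomial (List (Fin s × Fin m)) ℤ, D ≠ 0 ∧ ∀ v : List (Fin s × Fin m) → ℕ,
      MvPolynomial.eval (fun i => (v i : ℤ)) D ≠ 0 →
        ∀ K ∈ G.values hm n, ∀ L ∈ G.values hm n, K v = L v → K = L := by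
  classical
  induction n with
  | zero =>
    refine ⟨1, one_ne_zero, fun v _ K _ L _ _ => ?_⟩
    funext w
    rfl
  | succ n ih =>
    obtain ⟨D, hD, hinj⟩ := ih
    set d : G.Pt m → G.Pt m → ((List (Fin s × Fin m) → ℕ) → IterMultiset n) →
        MvPolynomial (List (Fin s × Fin m)) ℤ := fun p q K =>
      MvPolynomial.map (Nat.castRingHom ℤ) (G.childPoly hm n p K) -
        MvPolynomial.map (Nat.castRingHom ℤ) (G.childPoly hm n q K) with hd
    refine ⟨D * ∏ p : G.Pt m, ∏ q : G.Pt m, ∏ K ∈ G.values hm n,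
      if d p q K = 0 then 1 else d p q K, ?_, ?_⟩
    · refine mul_ne_zero hD (Finset.prod_ne_zero_iff.2 fun p _ => Finset.prod_ne_zero_iff.2
        fun q _ => Finset.prod_ne_zero_iff.2 fun K _ => ?_)
      split_ifs with h
      · exact one_ne_zero
      · exact h
    · intro v hv K' hK' L' hL' hKL
      rw [map_mul] at hv
      have hinj' := hinj v (left_ne_zero_of_mul hv)
      have hv2 := right_ne_zero_of_mul hv
      obtain ⟨p, -, rfl⟩ := Finset.mem_image.1 hK'
      obtain ⟨q, -, rfl⟩ := Finset.mem_image.1 hL'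
      have hpoly : ∀ K ∈ G.values hm n, G.childPoly hm n p K = G.childPoly hm n q K := by
        intro K hK
        simp only [map_prod, Finset.prod_ne_zero_iff] at hv2
        have h1 := hv2 p (Finset.mem_univ _) q (Finset.mem_univ _) K hK
        by_contra hne
        have hd0 : d p q K ≠ 0 := fun h0 =>
          hne (MvPolynomial.map_injective _ Nat.cast_injective (sub_eq_zero.1 h0))
        rw [if_neg hd0] at h1
        apply h1
        have e1 := G.eval_childPoly hm p v hinj' hK
        have e2 := G.eval_childPoly hm q v hinj' hK
        rw [hKL, ← e2] at e1
        have hcast : ∀ r : MvPolynomial (List (Fin s × Fin m)) ℕ,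
            MvPolynomial.eval (fun i => (v i : ℤ)) (MvPolynomial.map (Nat.castRingHom ℤ) r) =
              ((MvPolynomial.eval v r : ℕ) : ℤ) := fun r => by
          rw [MvPolynomial.eval_map]
          have := MvPolynomial.eval₂_comp_left (Nat.castRingHom ℤ) (RingHom.id ℕ) v r
          simp only [MvPolynomial.eval, MvPolynomial.coe_eval₂Hom]
          exact this.symm
        rw [hd]
        dsimp only
        rw [map_sub, hcast, hcast, e1, sub_self]
      funext w
      rw [value_succ, value_succ]
      change @Eq (Multiset (IterMultiset n)) _ _
      exact Finset.sum_congr rfl fun K hK => by rw [hpoly K hK]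

/-- Nodes with the same value have the same polynomials of children. -/
theorem childPoly_eq [Fintype G.X] (n : ℕ) (p q : G.Pt m)
    (h : G.value hm (n + 1) p.1 p.2 = G.value hm (n + 1) q.1 q.2)
    {K : (List (Fin s × Fin m) → ℕ) → IterMultiset n} (hK : K ∈ G.values hm n) :
    G.childPoly hm n p K = G.childPoly hm n q K := by
  classical
  obtain ⟨D, hD, hinj⟩ := G.exists_generic hm n
  by_contra hne
  have hd0 : MvPolynomial.map (Nat.castRingHom ℤ) (G.childPoly hm n p K) -
      MvPolynomial.map (Nat.castRingHom ℤ) (G.childPoly hm n q K) ≠ 0 := fun h0 =>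
    hne (MvPolynomial.map_injective _ Nat.cast_injective (sub_eq_zero.1 h0))
  -- This `v` is generic and also separates the two child polynomials, although both count the same
  -- children there.
  obtain ⟨v, hv⟩ := exists_natEval_ne_zero (mul_ne_zero hD hd0)
  rw [map_mul] at hv
  have hinj' := hinj v (left_ne_zero_of_mul hv)
  apply right_ne_zero_of_mul hv
  have hcast : ∀ r : MvPolynomial (List (Fin s × Fin m)) ℕ,
      MvPolynomial.eval (fun i => (v i : ℤ)) (MvPolynomial.map (Nat.castRingHom ℤ) r) =
        ((MvPolynomial.eval v r : ℕ) : ℤ) := fun r => by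
    rw [MvPolynomial.eval_map]
    have := MvPolynomial.eval₂_comp_left (Nat.castRingHom ℤ) (RingHom.id ℕ) v r
    simp only [MvPolynomial.eval, MvPolynomial.coe_eval₂Hom]
    exact this.symm
  rw [map_sub, hcast, hcast, G.eval_childPoly hm p v hinj' hK, G.eval_childPoly hm q v hinj' hK,
    h, sub_self]

/-! ### Isomorphisms of nodes -/

/-- The isomorphism `θ` of the labels of two nodes extends to an isomorphism of the parts of
height `n` below the nodes. -/
def Good : ℕ → ∀ x x' : G.X, ((G.label x).Edge ≃[edgeLang s] (G.label x').Edge) → Prop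
  | 0, _, _, _ => True
  | n + 1, x, x', θ => ∃ e : G.ch x ≃ G.ch x', ∀ c,
      ∃ ι : (G.label (G.tgt x c)).Edge ≃[edgeLang s] (G.label (G.tgt x' (e c))).Edge,
        (∀ b, ι (G.incl x c b) = G.incl x' (e c) (θ b)) ∧ Good n _ _ ι

theorem good_refl (n : ℕ) (x : G.X) : G.Good n x x (Language.Equiv.refl _ _) := by
  induction n generalizing x with
  | zero => trivial
  | succ n ih => exact ⟨Equiv.refl _, fun c => ⟨Language.Equiv.refl _ _, fun _ => rfl, ih _⟩⟩

variable {G}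

theorem Good.symm {n : ℕ} {x x' : G.X} {θ : (G.label x).Edge ≃[edgeLang s] (G.label x').Edge}
    (h : G.Good n x x' θ) : G.Good n x' x θ.symm := by
  induction n generalizing x x' with
  | zero => trivial
  | succ n ih =>
    obtain ⟨e, he⟩ := h
    refine ⟨e.symm, fun c => ?_⟩
    obtain ⟨c, rfl⟩ := e.surjective c
    obtain ⟨ι, hι, hg⟩ := he c
    rw [Equiv.symm_apply_apply]
    refine ⟨ι.symm, fun b => ?_, ih hg⟩
    obtain ⟨b, rfl⟩ := θ.surjective b
    rw [← hι, Language.Equiv.symm_apply_apply, Language.Equiv.symm_apply_apply]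

theorem Good.trans {n : ℕ} {x x' x'' : G.X}
    {θ : (G.label x).Edge ≃[edgeLang s] (G.label x').Edge}
    {θ' : (G.label x').Edge ≃[edgeLang s] (G.label x'').Edge}
    (h : G.Good n x x' θ) (h' : G.Good n x' x'' θ') : G.Good n x x'' (θ'.comp θ) := by
  induction n generalizing x x' x'' with
  | zero => trivial
  | succ n ih =>
    obtain ⟨e, he⟩ := h
    obtain ⟨e', he'⟩ := h'
    refine ⟨e.trans e', fun c => ?_⟩
    obtain ⟨ι, hι, hg⟩ := he c
    obtain ⟨ι', hι', hg'⟩ := he' (e c)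
    exact ⟨ι'.comp ι, fun b => (congrArg ι' (hι b)).trans (hι' (θ b)), ih hg hg'⟩

theorem Good.of_succ {n : ℕ} {x x' : G.X} {θ : (G.label x).Edge ≃[edgeLang s] (G.label x').Edge}
    (h : G.Good (n + 1) x x' θ) : G.Good n x x' θ := by
  induction n generalizing x x' with
  | zero => trivial
  | succ n ih =>
    obtain ⟨e, he⟩ := h
    refine ⟨e, fun c => ?_⟩
    obtain ⟨ι, hι, hg⟩ := he c
    exact ⟨ι, hι, ih hg⟩

theorem Good.of_le {n n' : ℕ} (hn : n ≤ n') {x x' : G.X}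
    {θ : (G.label x).Edge ≃[edgeLang s] (G.label x').Edge}
    (h : G.Good n' x x' θ) : G.Good n x x' θ := by
  induction hn with
  | refl => exact h
  | step _ ih => exact ih h.of_succ

/-- Composition with isomorphisms, on the maps with a given restriction. -/
def restrictEquiv {B B' C C' : EdgeTree s k}
    (j : B.Edge ↪[edgeLang s] C.Edge) (j' : B'.Edge ↪[edgeLang s] C'.Edge)
    (ι : C.Edge ≃[edgeLang s] C'.Edge) (θ : B.Edge ≃[edgeLang s] B'.Edge)
    (h : ∀ b, ι (j b) = j' (θ b)) (h₀ : B'.Edge → Fin m) :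
    {g : C'.Edge → Fin m // g ∘ j' = h₀} ≃ {g : C.Edge → Fin m // g ∘ j = h₀ ∘ θ} :=
  (Equiv.arrowCongr ι.symm.toEquiv (Equiv.refl (Fin m))).subtypeEquiv fun g => by
    have hg : Equiv.arrowCongr ι.symm.toEquiv (Equiv.refl (Fin m)) g = g ∘ ι := rfl
    have h2 : (g ∘ ι) ∘ j = (g ∘ j') ∘ θ := funext fun b => congrArg g (h b)
    rw [hg, h2]
    exact (θ.surjective.injective_comp_right.eq_iff).symm

theorem restrictEquiv_apply {B B' C C' : EdgeTree s k}
    (j : B.Edge ↪[edgeLang s] C.Edge) (j' : B'.Edge ↪[edgeLang s] C'.Edge)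
    (ι : C.Edge ≃[edgeLang s] C'.Edge) (θ : B.Edge ≃[edgeLang s] B'.Edge)
    (h : ∀ b, ι (j b) = j' (θ b)) (h₀ : B'.Edge → Fin m)
    (g : {g : C'.Edge → Fin m // g ∘ j' = h₀}) :
    (restrictEquiv j j' ι θ h h₀ g).1 = g.1 ∘ ι := rfl

/-- The sums over children and over maps to `Fin m` are reindexed along the isomorphism;
`extPoly_comp` matches the multiplicities. -/
theorem Good.value_eq {n : ℕ} {x x' : G.X}
    {θ : (G.label x).Edge ≃[edgeLang s] (G.label x').Edge}
    (hg : G.Good n x x' θ) (h : (G.label x').Edge → Fin m) :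
    G.value hm n x (h ∘ θ) = G.value hm n x' h := by
  induction n generalizing x x' with
  | zero => rfl
  | succ n ih =>
    obtain ⟨e, he⟩ := hg
    funext v
    rw [value, value]
    change @Eq (Multiset (IterMultiset n)) _ _
    refine Fintype.sum_equiv e _ _ fun c => ?_
    obtain ⟨ι, hι, hg⟩ := he c
    refine (Fintype.sum_equiv (restrictEquiv _ _ ι θ hι h) _ _ fun g => ?_).symm
    rw [restrictEquiv_apply, ih hg, EdgeTree.extPoly_comp (hm _) (hm _) _ _ ι θ hι]

end Forest

end TreeInterp

namespace TreeInterp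

open FirstOrder

/-! ### Recovering a label from its words -/

namespace EdgeTree

variable {s k m : ℕ}

theorem exists_injective_extension {B C : EdgeTree s k} (hm : C.size ≤ m)
    (j : B.Edge ↪[edgeLang s] C.Edge) {h₀ : B.Edge → Fin m} (h : Function.Injective h₀) :
    ∃ g : C.Edge → Fin m, Function.Injective g ∧ g ∘ j = h₀ := by
  classical
  have he : Function.Injective (Fin.castLE hm : C.Edge → Fin m) := Fin.castLE_injective hm
  set e : C.Edge → Fin m := Fin.castLE hm
  have hej : Function.Injective (e ∘ j) := he.comp j.injective
  let E : {x // x ∈ Set.range (e ∘ j)} ≃ {x // x ∈ Set.range h₀} :=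
    (Equiv.ofInjective _ hej).symm.trans (Equiv.ofInjective _ h)
  refine ⟨E.extendSubtype ∘ e, E.extendSubtype.injective.comp he, funext fun b => ?_⟩
  have := E.extendSubtype_apply_of_mem (e (j b)) ⟨b, rfl⟩
  change E.extendSubtype (e (j b)) = h₀ b
  rw [this]
  have h2 : (⟨e (j b), ⟨b, rfl⟩⟩ : {x // x ∈ Set.range (e ∘ j)}) = Equiv.ofInjective _ hej b := rfl
  change ((Equiv.ofInjective _ h) ((Equiv.ofInjective _ hej).symm _)).1 = _
  rw [h2, Equiv.symm_apply_apply]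
  rfl

/-- Since `g₀` is injective, words identify the edges of `C₀`. Choosing an edge of `C` with the same
word is therefore injective, and bijective by counting. Words then identify the edges of `C` too,
and they determine parents and labels. -/
theorem exists_equiv_of_word_eq {C₀ C : EdgeTree s k} {g₀ : C₀.Edge → Fin m}
    {g : C.Edge → Fin m} (hg₀ : Function.Injective g₀) (hcard : C₀.size = C.size)
    (h : ∀ e₀, ∃ e, C.word g e = C₀.word g₀ e₀) :
    ∃ ι : C₀.Edge ≃[edgeLang s] C.Edge, ∀ e₀, C.word g (ι e₀) = C₀.word g₀ e₀ := by
  choose φ hφ using h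
  have hw₀ := C₀.word_injective_of_injective hg₀
  have hφi : Function.Injective φ := fun a b hab => hw₀ (by rw [← hφ, ← hφ, hab])
  have hφs : Function.Surjective φ :=
    ((Fintype.bijective_iff_injective_and_card φ).2 ⟨hφi, by rw [card_edge, card_edge, hcard]⟩).2
  have hw : Function.Injective (C.word g) := by
    intro a b hab
    obtain ⟨a, rfl⟩ := hφs a
    obtain ⟨b, rfl⟩ := hφs b
    rw [hφ, hφ] at hab
    rw [hw₀ hab]
  refine ⟨equivOfSurjective (mkEmb φ hφi (fun e => ?_) fun a e => ?_) hφs, hφ⟩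
  · rw [parentFun_eq, parentFun_eq]
    apply hw
    rw [hφ, word_up, word_up, hφ]
  · rw [hasLabel_iff, hasLabel_iff]
    have := hφ e
    rw [C.word_eq g, C₀.word_eq g₀] at this
    simp only [List.cons.injEq, Prod.mk.injEq] at this
    rw [this.1.1]

theorem apply_eq_of_word_eq {C₀ C : EdgeTree s k} {g₀ : C₀.Edge → Fin m} {g : C.Edge → Fin m}
    {e₀ : C₀.Edge} {e : C.Edge} (h : C.word g e = C₀.word g₀ e₀) : g e = g₀ e₀ := by
  rw [C.word_eq g, C₀.word_eq g₀] at h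
  simp only [List.cons.injEq, Prod.mk.injEq] at h
  exact h.1.2

/-- The exponent vector records the multiset of words of the new edges, and its degree their number.
The words of the old edges agree because `g` and `g₀` restrict to the same map on `B`. So every word
of `C₀` occurs in `C`, and the sizes are equal. -/
theorem exists_equiv_of_sum_single_eq {B C₀ C : EdgeTree s k}
    (j₀ : B.Edge ↪[edgeLang s] C₀.Edge) (j : B.Edge ↪[edgeLang s] C.Edge)
    {g₀ : C₀.Edge → Fin m} {g : C.Edge → Fin m} (hg₀ : Function.Injective g₀)
    (hj : g ∘ j = g₀ ∘ j₀)
    (hsum : ∑ e ∈ newEdges j₀, Finsupp.single (C₀.word g₀ e) 1 =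
      ∑ e ∈ newEdges j, Finsupp.single (C.word g e) 1) :
    ∃ ι : C₀.Edge ≃[edgeLang s] C.Edge, (∀ b, ι (j₀ b) = j b) ∧ g ∘ ι = g₀ := by
  have hnew : (newEdges j₀).card = (newEdges j).card := by
    rw [← degree_sum_single (newEdges j₀) (C₀.word g₀), hsum, degree_sum_single]
  have hold : ∀ b, C.word g (j b) = C₀.word g₀ (j₀ b) := fun b => by
    rw [word_comp, word_comp, hj]
  obtain ⟨ι, hι⟩ := exists_equiv_of_word_eq hg₀ (C := C) (g := g)
    (by have := card_newEdges j₀; have := card_newEdges j; omega) (fun e₀ => by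
      by_cases he : e₀ ∈ newEdges j₀
      · have h1 : (∑ e ∈ newEdges j₀, Finsupp.single (C₀.word g₀ e) 1) (C₀.word g₀ e₀) ≠ 0 := by
          rw [Finsupp.finsetSum_apply]
          intro h0
          simpa using Finset.sum_eq_zero_iff.1 h0 e₀ he
        rw [hsum, Finsupp.finsetSum_apply] at h1
        obtain ⟨e, -, he⟩ := Finset.exists_ne_zero_of_sum_ne_zero h1
        rw [Finsupp.single_apply] at he
        exact ⟨e, by by_contra h; exact he (if_neg h)⟩
      · rw [mem_newEdges] at he
        push Not at he
        obtain ⟨b, rfl⟩ := he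
        exact ⟨j b, hold b⟩)
  refine ⟨ι, fun b => ?_, funext fun e => apply_eq_of_word_eq (e := ι e) (hι e)⟩
  obtain ⟨e₀, he₀⟩ := ι.surjective (j b)
  have h2 : C₀.word g₀ e₀ = C₀.word g₀ (j₀ b) := by rw [← hι, he₀, hold]
  rw [← C₀.word_injective_of_injective hg₀ h2, he₀]

end EdgeTree

/-! ### Isomorphism classes of children and the triangular system -/

namespace Forest

open EdgeTree

variable {s k m : ℕ} {G : Forest s k} (hm : ∀ x, (G.label x).size ≤ m) {x x' : G.X}
  (θ : (G.label x).Edge ≃[edgeLang s] (G.label x').Edge)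

/-- The children of two nodes. -/
def kidNode : G.ch x ⊕ G.ch x' → G.X := Sum.elim (G.tgt x) (G.tgt x')

/-- The embedding of the label of the first of two isomorphic nodes in the labels of the children
of both. -/
def kidIncl : (c : G.ch x ⊕ G.ch x') →
    (G.label x).Edge ↪[edgeLang s] (G.label (kidNode c)).Edge
  | .inl c => G.incl x c
  | .inr c => (G.incl x' c).comp θ.toEmbedding

/-- The children are isomorphic over the label of the parent. -/
def KidIso (n : ℕ) (c d : G.ch x ⊕ G.ch x') : Prop :=
  ∃ ι : (G.label (kidNode c)).Edge ≃[edgeLang s] (G.label (kidNode d)).Edge,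
    (∀ b, ι (kidIncl θ c b) = kidIncl θ d b) ∧ G.Good n _ _ ι

/-- Isomorphism over the label of the parent, as an equivalence relation. -/
def kidSetoid (n : ℕ) : Setoid (G.ch x ⊕ G.ch x') where
  r := KidIso θ n
  iseqv :=
    { refl := fun c => ⟨Language.Equiv.refl _ _, fun _ => rfl, G.good_refl n _⟩
      symm := by
        rintro c d ⟨ι, hι, hg⟩
        exact ⟨ι.symm, fun b => by rw [← hι, Language.Equiv.symm_apply_apply], hg.symm⟩
      trans := by
        rintro a b c ⟨ι, hι, hg⟩ ⟨ι', hι', hg'⟩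
        exact ⟨ι'.comp ι, fun b => (congrArg ι' (hι b)).trans (hι' b), hg.trans hg'⟩ }

open Classical in
/-- The coefficient of a monomial in the polynomial that counts the extensions with value `K` for
one child. -/
noncomputable def kidCoeff (n : ℕ) (h₀ : (G.label x).Edge → Fin m)
    (K : (List (Fin s × Fin m) → ℕ) → IterMultiset n) (μ : List (Fin s × Fin m) →₀ ℕ)
    (c : G.ch x ⊕ G.ch x') : ℕ :=
  ∑ g : {g : (G.label (kidNode c)).Edge → Fin m // g ∘ kidIncl θ c = h₀},
    if G.value hm n (kidNode c) g.1 = K then (extPoly (hm _) (kidIncl θ c) g.1).coeff μ else 0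

theorem kidCoeff_eq {n : ℕ} (h₀ : (G.label x).Edge → Fin m)
    (K : (List (Fin s × Fin m) → ℕ) → IterMultiset n) (μ : List (Fin s × Fin m) →₀ ℕ)
    {c d : G.ch x ⊕ G.ch x'} (h : KidIso θ n c d) :
    kidCoeff hm θ n h₀ K μ c = kidCoeff hm θ n h₀ K μ d := by
  obtain ⟨ι, hι, hg⟩ := h
  refine (Fintype.sum_equiv (restrictEquiv (kidIncl θ c) (kidIncl θ d) ι
    (Language.Equiv.refl _ _) hι h₀) _ _ fun g => ?_).symm
  have hr : (restrictEquiv (kidIncl θ c) (kidIncl θ d) ι (Language.Equiv.refl _ _) hι h₀ g).1 =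
    g.1 ∘ ι := rfl
  rw [hr, hg.value_eq, extPoly_comp (hm _) (hm _) (kidIncl θ c) (kidIncl θ d) ι
    (Language.Equiv.refl _ _) hι]

/-- `childPoly_eq` read off one coefficient at a time, with the labels below `x'` viewed over the
label of `x` through `θ`. -/
theorem sum_kidCoeff [Fintype G.X] {n : ℕ} (h : (G.label x').Edge → Fin m)
    (hv : G.value hm (n + 1) x (h ∘ θ) = G.value hm (n + 1) x' h)
    {K : (List (Fin s × Fin m) → ℕ) → IterMultiset n} (hK : K ∈ G.values hm n)
    (μ : List (Fin s × Fin m) →₀ ℕ) :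
    ∑ c : G.ch x, kidCoeff hm θ n (h ∘ θ) K μ (.inl c) =
      ∑ c : G.ch x', kidCoeff hm θ n (h ∘ θ) K μ (.inr c) := by
  classical
  have key := congrArg (MvPolynomial.coeff μ)
    (G.childPoly_eq hm n ⟨x, h ∘ θ⟩ ⟨x', h⟩ hv hK)
  simp only [childPoly, MvPolynomial.coeff_sum, apply_ite (MvPolynomial.coeff μ),
    MvPolynomial.coeff_zero] at key
  refine Eq.trans ?_ (key.trans ?_)
  · rfl
  · refine Finset.sum_congr rfl fun c _ => ?_
    refine Fintype.sum_equiv (restrictEquiv (kidIncl θ (.inr c)) (G.incl x' c)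
      (Language.Equiv.refl _ _) θ (fun _ => rfl) h) _ _ fun g => ?_
    have hr : (restrictEquiv (kidIncl θ (.inr c)) (G.incl x' c)
      (Language.Equiv.refl _ _) θ (fun _ => rfl) h g).1 = g.1 := rfl
    rw [hr]
    have := extPoly_comp (hm _) (hm _) (kidIncl θ (.inr c)) (G.incl x' c)
      (Language.Equiv.refl _ _) θ (fun _ => rfl) g.1
    rw [← this]
    rfl

/-- Two maps from finite types to a common type have fibres of the same sizes if they are not
distinguished by a family of weights that is triangular with respect to a rank. -/
theorem card_fiber_eq {α β Q : Type} [Fintype α] [Fintype β] [Fintype Q] [DecidableEq Q]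
    (f : α → Q) (g : β → Q) (rank : Q → ℕ) (V : Q → Q → ℕ)
    (h0 : ∀ q q', rank q' ≤ rank q → q' ≠ q → V q q' = 0) (h1 : ∀ q, V q q ≠ 0)
    (hsum : ∀ q, ∑ a, V q (f a) = ∑ b, V q (g b)) (q : Q) :
    (Finset.univ.filter fun a => f a = q).card = (Finset.univ.filter fun b => g b = q).card := by
  have hgroup : ∀ {γ : Type} [Fintype γ] (φ : γ → Q) (q : Q), ∑ a, V q (φ a) =
      ∑ q', (Finset.univ.filter fun a => φ a = q').card * V q q' := by
    intro γ _ φ q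
    rw [← Finset.sum_fiberwise (s := Finset.univ) (g := φ)]
    refine Finset.sum_congr rfl fun q' _ => ?_
    rw [Finset.sum_congr rfl (g := fun _ => V q q')
      (fun a ha => by rw [(Finset.mem_filter.1 ha).2]), Finset.sum_const, smul_eq_mul]
  obtain ⟨N, hN⟩ : ∃ N, ∀ q, rank q ≤ N := by
    obtain ⟨N, hN⟩ := (Set.finite_range rank).bddAbove
    exact ⟨N, fun q => hN ⟨q, rfl⟩⟩
  -- Descending induction on the rank: the equation for `q` involves only `q` and classes of larger
  -- rank, whose fibres have already been compared.
  induction hd : N - rank q using Nat.strong_induction_on generalizing q with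
  | _ d ih =>
    have h := hsum q
    rw [hgroup, hgroup, ← Finset.add_sum_erase _ _ (Finset.mem_univ q),
      ← Finset.add_sum_erase _ _ (Finset.mem_univ q)] at h
    have hrest : ∀ q' ∈ Finset.univ.erase q,
        (Finset.univ.filter fun a => f a = q').card * V q q' =
          (Finset.univ.filter fun b => g b = q').card * V q q' := by
      intro q' hq'
      by_cases hr : rank q' ≤ rank q
      · rw [h0 q q' hr (Finset.ne_of_mem_erase hq'), mul_zero, mul_zero]
      · rw [ih (N - rank q') (by have := hN q'; omega) q' rfl]
    rw [Finset.sum_congr rfl hrest] at h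
    exact Nat.eq_of_mul_eq_mul_right (Nat.pos_of_ne_zero (h1 q)) (Nat.add_right_cancel h)

/-- Nodes with the same values are isomorphic. -/
theorem good_of_value_eq [Fintype G.X] (n : ℕ) {x x' : G.X}
    (θ : (G.label x).Edge ≃[edgeLang s] (G.label x').Edge) {h : (G.label x').Edge → Fin m}
    (hh : Function.Injective h) (hv : G.value hm n x (h ∘ θ) = G.value hm n x' h) :
    G.Good n x x' θ := by
  classical
  induction n generalizing x x' with
  | zero => trivial
  | succ n ih =>
    have hinj : Function.Injective (h ∘ θ) := hh.comp θ.injective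
    -- Each child gets an injective map `g c` extending that of the parent; `K` and `μ` below are
    -- the value and the top monomial that it contributes.
    choose g hg hgj using fun c : G.ch x ⊕ G.ch x' =>
      exists_injective_extension (hm _) (kidIncl θ c) hinj
    let S := kidSetoid θ n
    let K : G.ch x ⊕ G.ch x' → (List (Fin s × Fin m) → ℕ) → IterMultiset n :=
      fun c => G.value hm n (kidNode c) (g c)
    let μ : G.ch x ⊕ G.ch x' → List (Fin s × Fin m) →₀ ℕ :=
      fun c => ∑ e ∈ newEdges (kidIncl θ c), Finsupp.single ((G.label (kidNode c)).word (g c) e) 1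
    have hμ : ∀ c, (μ c).degree = (newEdges (kidIncl θ c)).card := fun c => degree_sum_single _ _
    -- `V q q'` is the coefficient of the top monomial of the representative of `q` among the
    -- extensions for a child in `q'` with the value of that representative.
    let V : Quotient S → Quotient S → ℕ := fun q => Quotient.lift
      (kidCoeff hm θ n (h ∘ θ) (K q.out) (μ q.out)) fun c d hcd => kidCoeff_eq hm θ _ _ _ hcd
    let rank : Quotient S → ℕ := fun q => (newEdges (kidIncl θ q.out)).card
    have hrank : ∀ c, rank (Quotient.mk S c) = (newEdges (kidIncl θ c)).card := fun c => by
      obtain ⟨ι, -, -⟩ : KidIso θ n (Quotient.mk S c).out c := Quotient.mk_out c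
      have h1 := card_newEdges (kidIncl θ c)
      have h2 := card_newEdges (kidIncl θ (Quotient.mk S c).out)
      have h3 := Fintype.card_congr ι.toEquiv
      rw [card_edge, card_edge] at h3
      dsimp only [rank]
      omega
    have hmain := card_fiber_eq (fun c : G.ch x => Quotient.mk S (.inl c))
      (fun c : G.ch x' => Quotient.mk S (.inr c)) rank V (by
        intro q q' hr hne
        induction q' using Quotient.inductionOn with
        | _ c =>
          by_contra hV
          change kidCoeff hm θ n (h ∘ θ) (K q.out) (μ q.out) c ≠ 0 at hV
          -- If `q'` has no more new edges than `q`, then a nonzero coefficient at `μ q.out` can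
          -- only come from a top monomial, namely that of some `g'`. Equality of the monomials
          -- gives an isomorphism of labels over the parent, and equality of the values makes it
          -- good by induction, so `q' = q`.
          obtain ⟨g', -, hg'⟩ := Finset.exists_ne_zero_of_sum_ne_zero hV
          rw [ite_ne_right_iff] at hg'
          obtain ⟨hK, hc⟩ := hg'
          rw [hrank] at hr
          rw [coeff_extPoly _ _ _ (by rw [hμ]; exact hr), ite_ne_right_iff] at hc
          obtain ⟨ι, hι, hιg⟩ := exists_equiv_of_sum_single_eq (kidIncl θ q.out) (kidIncl θ c)
            (hg q.out) (g'.2.trans (hgj q.out).symm) hc.1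
          apply hne
          rw [← Quotient.out_eq q]
          apply Quotient.sound
          apply S.symm
          refine ⟨ι, hι, ih ι (h := g'.1) ?_ ?_⟩
          · intro a b hab
            obtain ⟨a, rfl⟩ := ι.surjective a
            obtain ⟨b, rfl⟩ := ι.surjective b
            have : (g'.1 ∘ ι) a = (g'.1 ∘ ι) b := hab
            rw [hιg] at this
            rw [hg q.out this]
          · rw [hιg, hK])
      (by
        intro q
        have hq : V q q = kidCoeff hm θ n (h ∘ θ) (K q.out) (μ q.out) q.out := by
          have h1 : V q (Quotient.mk S q.out) =
            kidCoeff hm θ n (h ∘ θ) (K q.out) (μ q.out) q.out := rfl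
          rwa [Quotient.out_eq] at h1
        rw [hq, kidCoeff]
        intro h0
        -- The chosen map `g q.out` itself contributes 1, and natural summands cannot cancel.
        have h1 := Finset.sum_eq_zero_iff.1 h0 ⟨g q.out, hgj q.out⟩ (Finset.mem_univ _)
        revert h1
        change _ ≠ _
        rw [if_pos rfl, coeff_extPoly _ _ _ (by rw [hμ]), if_pos rfl]
        exact one_ne_zero)
      (fun q => sum_kidCoeff hm θ h hv (G.value_mem_values hm n _ _) _)
    have hfib : ∀ q : Quotient S, Nonempty ({c : G.ch x // Quotient.mk S (.inl c) = q} ≃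
        {c : G.ch x' // Quotient.mk S (.inr c) = q}) := fun q => by
      apply Fintype.card_eq.1
      rw [Fintype.card_subtype, Fintype.card_subtype]
      exact hmain q
    -- Matching the fibres of the two maps to classes pairs every child of `x` with an isomorphic
    -- child of `x'`.
    have E := fun q => (hfib q).some
    refine ⟨Equiv.ofFiberEquiv E, fun c => ?_⟩
    have he := Equiv.ofFiberEquiv_map E c
    obtain ⟨ι, hι, hgood⟩ : KidIso θ n (.inl c) (.inr (Equiv.ofFiberEquiv E c)) :=
      Quotient.exact he.symm
    exact ⟨ι, hι, hgood⟩

end Forest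

end TreeInterp

namespace TreeInterp

open FirstOrder

/-! ### Values of nodes of finite trees -/

open Classical in
/-- The part of height `n` of the tree below a node, up to isomorphism. -/
noncomputable def relValue {V : Type} [Fintype V] (R : V → V → Prop) : (n : ℕ) → V → IterMultiset n
  | 0, _ => ()
  | n + 1, y => (∑ z : {z // R y z}, {relValue R n z.1} : Multiset (IterMultiset n))

theorem relValue_succ {V : Type} [Fintype V] (R : V → V → Prop) [∀ y, Fintype {z // R y z}]
    (n : ℕ) (y : V) : relValue R (n + 1) y =
      (∑ z : {z // R y z}, {relValue R n z.1} : Multiset (IterMultiset n)) := by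
  rw [relValue]
  change @Eq (Multiset (IterMultiset n)) _ _
  refine Finset.sum_congr ?_ fun _ _ => rfl
  ext z
  simp only [Finset.mem_univ]

theorem relValue_iso {V W : Type} [Fintype V] [Fintype W] {R : V → V → Prop} {S : W → W → Prop}
    (e : R ≃r S) (n : ℕ) (y : V) : relValue R n y = relValue S n (e y) := by
  classical
  induction n generalizing y with
  | zero => rfl
  | succ n ih =>
    rw [relValue, relValue]
    change @Eq (Multiset (IterMultiset n)) _ _
    refine Fintype.sum_equiv (e.toEquiv.subtypeEquiv fun z => e.map_rel_iff.symm) _ _ fun z => ?_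
    rw [ih]
    rfl

namespace Pattern

variable {s k : ℕ}

/-- The inclusion of the label of a node in the label of a child. -/
def inclOf (Φ : Pattern s k) {x : Fin (Φ.last + 1)} (z : Fin Φ.last) (h : Φ.par z = x) :
    (Φ.label x).Edge ↪[edgeLang s] (Φ.label z.succ).Edge := by
  subst h
  exact Φ.incl z

theorem incl_inclOf (Φ : Pattern s k) {x : Fin (Φ.last + 1)} (z : Fin Φ.last) (h : Φ.par z = x)
    (e : (Φ.label x).Edge) : Φ.Incl ⟨x, e⟩ ⟨z.succ, Φ.inclOf z h e⟩ := by
  subst h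
  exact Incl.intro z e

theorem parent_inclOf (Φ : Pattern s k) {A : Type} [(edgeLang s).Structure A]
    {x : Fin (Φ.last + 1)} (z : Fin Φ.last) (h : Φ.par z = x)
    (β : (Φ.label z.succ).Edge ↪[edgeLang s] A) :
    Φ.Parent A ⟨x, β.comp (Φ.inclOf z h)⟩ ⟨z.succ, β⟩ := by
  subst h
  exact Parent.intro z β

/-- Makes the embedding of the root label unique on every input, so that every output has exactly
one root. -/
instance (Φ : Pattern s k) : IsEmpty (Φ.label 0).Edge := by
  unfold EdgeTree.Edge
  rw [Φ.label_root]
  infer_instance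

instance (Φ : Pattern s k) (A : Type) [(edgeLang s).Structure A] [Finite A] :
    Finite (Φ.Node A) := by
  have : ∀ x, Finite ((Φ.label x).Edge ↪[edgeLang s] A) := fun x => DFunLike.finite _
  exact inferInstanceAs (Finite (Σ x, ((Φ.label x).Edge ↪[edgeLang s] A)))

/-- The root of the output tree. -/
def root (Φ : Pattern s k) (A : Type) [(edgeLang s).Structure A] : Φ.Node A :=
  ⟨0, mkEmb (fun e => isEmptyElim e) (fun e => isEmptyElim e) (fun e => isEmptyElim e)
    fun _ e => isEmptyElim e⟩

theorem embedding_ext_of_isEmpty {A B : Type} [(edgeLang s).Structure A]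
    [(edgeLang s).Structure B] [IsEmpty A] (α β : A ↪[edgeLang s] B) : α = β := by
  ext e
  exact isEmptyElim e

theorem eq_root_iff (Φ : Pattern s k) {A : Type} [(edgeLang s).Structure A] (y : Φ.Node A) :
    y = Φ.root A ↔ ∀ x, ¬ Φ.Parent A x y := by
  constructor
  · rintro rfl x h
    generalize hr : Φ.root A = r at h
    cases h with
    | intro z β => exact absurd (congrArg Sigma.fst hr) (Fin.succ_ne_zero z).symm
  · obtain ⟨x, α⟩ := y
    intro h
    induction x using Fin.cases with
    | zero => exact congrArg (Sigma.mk 0) (embedding_ext_of_isEmpty _ _)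
    | succ z => exact absurd (Parent.intro z α) (h _)

theorem parent_unique (Φ : Pattern s k) {A : Type} [(edgeLang s).Structure A]
    {x x' y : Φ.Node A} (h : Φ.Parent A x y) (h' : Φ.Parent A x' y) : x = x' := by
  cases h with
  | intro z β =>
    generalize hy : (⟨z.succ, β⟩ : Φ.Node A) = y at h'
    cases h' with
    | intro z' β' =>
      obtain ⟨h1, h2⟩ := Sigma.mk.inj_iff.1 hy
      obtain rfl := Fin.succ_injective _ h1
      obtain rfl := eq_of_heq h2
      rfl

/-- The forest of the nodes of two patterns. -/
@[reducible] def forest (P : Bool → Pattern s k) : Forest s k where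
  X := Σ b, Fin ((P b).last + 1)
  label x := (P x.1).label x.2
  ch x := {z : Fin (P x.1).last // (P x.1).par z = x.2}
  tgt x c := ⟨x.1, c.1.succ⟩
  incl x c := (P x.1).inclOf c.1 c.2

theorem exists_of_parent (Φ : Pattern s k) {A : Type} [(edgeLang s).Structure A]
    {x : Fin (Φ.last + 1)} {α : (Φ.label x).Edge ↪[edgeLang s] A} {y : Φ.Node A}
    (h : Φ.Parent A ⟨x, α⟩ y) :
    ∃ (z : Fin Φ.last) (hz : Φ.par z = x) (β : (Φ.label z.succ).Edge ↪[edgeLang s] A),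
      β.comp (Φ.inclOf z hz) = α ∧ y = ⟨z.succ, β⟩ := by
  generalize hx : (⟨x, α⟩ : Φ.Node A) = x' at h
  cases h with
  | intro z β =>
    obtain ⟨rfl, h2⟩ := Sigma.mk.inj_iff.1 hx
    obtain rfl := eq_of_heq h2
    exact ⟨z, rfl, β, rfl, rfl⟩

/-- The children of a node of the output tree. -/
noncomputable def childEquiv (Φ : Pattern s k) {A : Type} [(edgeLang s).Structure A]
    (y : Φ.Node A) :
    (Σ c : {z : Fin Φ.last // Φ.par z = y.1},
      {β : (Φ.label c.1.succ).Edge ↪[edgeLang s] A // β.comp (Φ.inclOf c.1 c.2) = y.2}) ≃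
      {y' // Φ.Parent A y y'} :=
  Equiv.ofBijective (fun p => ⟨⟨p.1.1.succ, p.2.1⟩, by
      have := Φ.parent_inclOf p.1.1 p.1.2 p.2.1
      rwa [p.2.2] at this⟩) (by
    constructor
    · rintro ⟨⟨z, hz⟩, β, hβ⟩ ⟨⟨z', hz'⟩, β', hβ'⟩ h
      have h0 := congrArg Subtype.val h
      obtain ⟨h1, h2⟩ := Sigma.mk.inj_iff.1 h0
      obtain rfl := Fin.succ_injective _ h1
      obtain rfl := eq_of_heq h2
      rfl
    · rintro ⟨y', hy⟩
      obtain ⟨z, hz, β, hβ, rfl⟩ := Φ.exists_of_parent hy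
      exact ⟨⟨⟨z, hz⟩, β, hβ⟩, rfl⟩)

end Pattern

/-! ### Outputs of patterns on test trees -/

theorem card_extension {s k m : ℕ} {B C : EdgeTree s k} (hm : C.size ≤ m)
    (j : B.Edge ↪[edgeLang s] C.Edge) (v : List (Fin s × Fin m) → ℕ)
    (α : B.Edge ↪[edgeLang s] TestTree s k v) (g : C.Edge → Fin m)
    (hg : g ∘ j = Prod.fst ∘ WordTree.code α) :
    Nat.card {β : C.Edge ↪[edgeLang s] TestTree s k v //
        β.comp j = α ∧ Prod.fst ∘ WordTree.code β = g} =
      MvPolynomial.eval v (EdgeTree.extPoly hm j g) := by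
  obtain ⟨E⟩ := EdgeTree.nonempty_equiv_extPoly hm j g (v := v)
    (f₀ := Prod.snd ∘ WordTree.code α) (by rw [hg]; exact (embEquiv v B α).2)
  rw [← Nat.card_fin (MvPolynomial.eval v _)]
  refine Nat.card_congr (Equiv.trans (Equiv.ofBijective (fun β =>
    ⟨Prod.snd ∘ WordTree.code β.1, congrArg (fun γ => Prod.snd ∘ WordTree.code γ) β.2.1,
      (congrArg (fun g => C.Col v g (Prod.snd ∘ WordTree.code β.1)) β.2.2).mp
        (embEquiv v C β.1).2⟩) ⟨?_, ?_⟩) E)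
  · rintro ⟨β, h1, h2⟩ ⟨β', h1', h2'⟩ h
    apply Subtype.ext
    apply (embEquiv v C).injective
    apply Subtype.ext
    have h3 : Prod.snd ∘ WordTree.code β = Prod.snd ∘ WordTree.code β' := congrArg Subtype.val h
    funext e
    exact Prod.ext (congrFun (h2.trans h2'.symm) e) (congrFun h3 e)
  · rintro ⟨f, hf, hcol⟩
    let β := (embEquiv v C).symm ⟨fun e => (g e, f e), hcol⟩
    have hβ : WordTree.code β = fun e => (g e, f e) :=
      congrArg Subtype.val ((embEquiv v C).apply_symm_apply ⟨fun e => (g e, f e), hcol⟩)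
    refine ⟨⟨β, ?_, ?_⟩, ?_⟩
    · apply (embEquiv v B).injective
      apply Subtype.ext
      change WordTree.code (β.comp j) = WordTree.code α
      rw [WordTree.code_comp, hβ]
      funext e
      exact Prod.ext (congrFun hg e) (congrFun hf e)
    · rw [hβ]
      rfl
    · apply Subtype.ext
      change Prod.snd ∘ WordTree.code β = f
      rw [hβ]
      rfl

/-- The children of a node are the extensions of its embedding. They are grouped by the child of the
pattern node and by their map to `Fin m`; by induction all children in a group have the same value,
and `card_extension` counts them. -/
theorem Pattern.relValue_eq {s k m : ℕ} (P : Bool → Pattern s k)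
    (hm : ∀ x, ((Pattern.forest P).label x).size ≤ m) (v : List (Fin s × Fin m) → ℕ) (b : Bool)
    [Fintype ((P b).Node (TestTree s k v))] (n : ℕ)
    (y : (P b).Node (TestTree s k v)) :
    relValue ((P b).Parent (TestTree s k v)) n y =
      (Pattern.forest P).value hm n ⟨b, y.1⟩ (Prod.fst ∘ WordTree.code y.2) v := by
  classical
  induction n generalizing y with
  | zero => rfl
  | succ n ih =>
    rw [relValue_succ, Forest.value]
    change @Eq (Multiset (IterMultiset n)) _ _
    have hfin : ∀ x, Finite (((P b).label x).Edge ↪[edgeLang s] TestTree s k v) :=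
      fun x => DFunLike.finite _
    have hfin' : ∀ x, Fintype (((P b).label x).Edge ↪[edgeLang s] TestTree s k v) :=
      fun x => Fintype.ofFinite _
    rw [← Fintype.sum_equiv ((P b).childEquiv y) _ _ (fun _ => rfl), Fintype.sum_sigma]
    refine Finset.sum_congr rfl fun c _ => ?_
    let π : {β : ((P b).label c.1.succ).Edge ↪[edgeLang s] TestTree s k v //
        β.comp ((P b).inclOf c.1 c.2) = y.2} →
        {g : ((P b).label c.1.succ).Edge → Fin m //
          g ∘ (P b).inclOf c.1 c.2 = Prod.fst ∘ WordTree.code y.2} :=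
      fun β => ⟨Prod.fst ∘ WordTree.code β.1,
        congrArg (fun γ => Prod.fst ∘ WordTree.code γ) β.2⟩
    rw [← Fintype.sum_fiberwise π]
    refine Finset.sum_congr rfl fun g _ => ?_
    rw [Finset.sum_congr rfl (g := fun _ => ({(Pattern.forest P).value hm n
      ⟨b, c.1.succ⟩ g.1 v} : Multiset (IterMultiset n)))]
    · rw [Finset.sum_const, Finset.card_univ]
      congr 1
      rw [← card_extension (hm ⟨b, c.1.succ⟩) ((P b).inclOf c.1 c.2) v y.2 g.1 g.2,
        ← Nat.card_eq_fintype_card]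
      apply Nat.card_congr
      exact (Equiv.subtypeEquivRight fun β => Subtype.ext_iff).trans
        (Equiv.subtypeSubtypeEquivSubtypeInter
          (fun β : ((P b).label c.1.succ).Edge ↪[edgeLang s] TestTree s k v =>
            β.comp ((P b).inclOf c.1 c.2) = y.2) fun β => Prod.fst ∘ WordTree.code β = g.1)
    · intro β _
      have h2 : Prod.fst ∘ WordTree.code β.1.1 = g.1 := congrArg Subtype.val β.2
      rw [← h2]
      exact congrArg (fun t => ({t} : Multiset (IterMultiset n))) (ih ⟨c.1.succ, β.1.1⟩)

end TreeInterp

namespace TreeInterp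

open FirstOrder

/-! ### Isomorphism and equivalence of patterns -/

namespace Pattern

variable {s k : ℕ}

/-- Recursion along the parents of the nodes of a pattern. -/
theorem exists_rec (Φ : Pattern s k) {M : Fin (Φ.last + 1) → Type} (base : M 0)
    (step : ∀ z, M (Φ.par z) → M z.succ) :
    ∃ f : ∀ x, M x, f 0 = base ∧ ∀ z, f z.succ = step z (f (Φ.par z)) := by
  let F : ∀ x : Fin (Φ.last + 1), (∀ y, y < x → M y) → M x := fun x =>
    Fin.cases (motive := fun x => (∀ y, y < x → M y) → M x) (fun _ => base)
      (fun z rec => step z (rec (Φ.par z) (Φ.par_lt z))) x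
  have wf : WellFounded (fun x y : Fin (Φ.last + 1) => x < y) := wellFounded_lt
  refine ⟨wf.fix F, ?_, fun z => ?_⟩
  · rw [wf.fix_eq]
    rfl
  · rw [wf.fix_eq]
    rfl

theorem isParent_succ_iff (Φ : Pattern s k) {x : Fin (Φ.last + 1)} {z : Fin Φ.last} :
    Φ.IsParent x z.succ ↔ Φ.par z = x := by
  constructor
  · intro h
    generalize hy : z.succ = y at h
    cases h with
    | intro w => rw [Fin.succ_injective _ hy]
  · rintro rfl
    exact IsParent.intro z

theorem not_isParent_zero (Φ : Pattern s k) {x : Fin (Φ.last + 1)} : ¬ Φ.IsParent x 0 := by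
  intro h
  generalize hy : (0 : Fin (Φ.last + 1)) = y at h
  cases h with
  | intro w => exact absurd hy (Fin.succ_ne_zero w).symm

/-- The isomorphism is built downwards from the root, each node carrying its image, an isomorphism
of labels and goodness for height `last + 1 - x`. Parents have smaller numbers than their children,
so this height is positive at every node and goodness suffices to continue. -/
theorem isomorphic_of_good (P : Bool → Pattern s k)
    (θ : ((P false).label 0).Edge ≃[edgeLang s] ((P true).label 0).Edge)
    (h : (Pattern.forest P).Good ((P false).last + 1) ⟨false, 0⟩ ⟨true, 0⟩ θ) :
    Isomorphic (P false) (P true) := by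
  classical
  let Φ := P false
  let Ψ := P true
  let M : Fin (Φ.last + 1) → Type := fun x =>
    {p : Σ x' : Fin (Ψ.last + 1), ((Φ.label x).Edge ≃[edgeLang s] (Ψ.label x').Edge) //
      (Pattern.forest P).Good (Φ.last + 1 - x) ⟨false, x⟩ ⟨true, p.1⟩ p.2}
  have hstep : ∀ (x : Fin (Φ.last + 1)) (p : M x),
      ∃ e : {z : Fin Φ.last // Φ.par z = x} ≃ {z : Fin Ψ.last // Ψ.par z = p.1.1},
        ∀ c, ∃ ι : (Φ.label c.1.succ).Edge ≃[edgeLang s] (Ψ.label (e c).1.succ).Edge,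
          (∀ b, ι (Φ.inclOf c.1 c.2 b) = Ψ.inclOf (e c).1 (e c).2 (p.1.2 b)) ∧
          (Pattern.forest P).Good (Φ.last - x) ⟨false, c.1.succ⟩ ⟨true, (e c).1.succ⟩ ι := by
    rintro x ⟨⟨x', θ⟩, hp⟩
    have hx : Φ.last + 1 - x = Φ.last - x + 1 := by
      have := x.isLt
      omega
    rw [hx] at hp
    obtain ⟨e, he⟩ := hp
    exact ⟨e, he⟩
  choose E ι hι hgood using hstep
  obtain ⟨f, hf0, hf⟩ := Φ.exists_rec (M := M) ⟨⟨0, θ⟩, h⟩ (fun z p =>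
    ⟨⟨(E _ p ⟨z, rfl⟩).1.succ, ι _ p ⟨z, rfl⟩⟩, (hgood _ p ⟨z, rfl⟩).of_le (by
      have := Φ.par_lt z
      rw [Fin.lt_def, Fin.val_succ] at this
      rw [Fin.val_succ]
      omega)⟩)
  let σ : Fin (Φ.last + 1) → Fin (Ψ.last + 1) := fun x => (f x).1.1
  have hσ0 : σ 0 = 0 := by
    dsimp only [σ]
    rw [hf0]
  have hσ : ∀ (x : Fin (Φ.last + 1)) (z : Fin Φ.last) (hz : Φ.par z = x),
      σ z.succ = (E x (f x) ⟨z, hz⟩).1.succ := by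
    rintro x z rfl
    dsimp only [σ]
    rw [hf]
  have hpar : ∀ (x : Fin (Φ.last + 1)) (z : Fin Φ.last) (hz : Φ.par z = x),
      Ψ.par (E x (f x) ⟨z, hz⟩).1 = σ x := fun x z hz => (E x (f x) ⟨z, hz⟩).2
  -- Only the root goes to the root. Two other nodes with the same image have parents with the same
  -- image, hence by induction the same parent, below which `E` is a bijection.
  have hinj : Function.Injective σ := by
    intro a
    induction a using WellFoundedLT.induction with
    | _ a ih =>
      intro b hab
      induction a using Fin.cases with
      | zero =>
        induction b using Fin.cases with
        | zero => rfl
        | succ w =>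
          rw [hσ0, hσ _ w rfl] at hab
          exact absurd hab.symm (Fin.succ_ne_zero _)
      | succ z =>
        induction b using Fin.cases with
        | zero =>
          rw [hσ0, hσ _ z rfl] at hab
          exact absurd hab (Fin.succ_ne_zero _)
        | succ w =>
          have h1 : Φ.par z = Φ.par w := by
            apply ih _ (Φ.par_lt z)
            rw [hσ _ z rfl, hσ _ w rfl, Fin.succ_inj] at hab
            rw [← hpar _ z rfl, ← hpar _ w rfl, hab]
          rw [hσ _ z h1, hσ _ w rfl, Fin.succ_inj] at hab
          have h2 := (E (Φ.par w) (f (Φ.par w))).injective (Subtype.ext hab)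
          rw [show z = w from congrArg Subtype.val h2]
  have hsurj : Function.Surjective σ := by
    intro y
    induction y using WellFoundedLT.induction with
    | _ y ih =>
      induction y using Fin.cases with
      | zero => exact ⟨0, hσ0⟩
      | succ z' =>
        obtain ⟨x, hx⟩ := ih _ (Ψ.par_lt z')
        refine ⟨((E x (f x)).symm ⟨z', hx.symm⟩).1.succ, ?_⟩
        rw [hσ x _ ((E x (f x)).symm ⟨z', hx.symm⟩).2]
        congr 1
        have : (⟨((E x (f x)).symm ⟨z', hx.symm⟩).1, ((E x (f x)).symm ⟨z', hx.symm⟩).2⟩ :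
          {z : Fin Φ.last // Φ.par z = x}) = (E x (f x)).symm ⟨z', hx.symm⟩ := rfl
        rw [this, Equiv.apply_symm_apply]
  refine ⟨Equiv.ofBijective σ ⟨hinj, hsurj⟩, fun x => (f x).1.2, fun x y => ⟨?_, ?_⟩, ?_⟩
  · rintro ⟨z⟩
    change Ψ.IsParent (σ (Φ.par z)) (σ z.succ)
    rw [hσ _ z rfl, ← hpar _ z rfl]
    exact IsParent.intro _
  · change Ψ.IsParent (σ x) (σ y) → _
    intro h
    induction y using Fin.cases with
    | zero =>
      rw [hσ0] at h
      exact absurd h Ψ.not_isParent_zero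
    | succ z =>
      rw [hσ _ z rfl, isParent_succ_iff, hpar] at h
      rw [← hinj h]
      exact IsParent.intro z
  · rintro x y e e' ⟨z, e⟩
    change Ψ.Incl ⟨(f (Φ.par z)).1.1, (f (Φ.par z)).1.2 e⟩ ⟨(f z.succ).1.1,
      (f z.succ).1.2 (Φ.incl z e)⟩
    rw [hf]
    have h1 := hι _ (f (Φ.par z)) ⟨z, rfl⟩ e
    have h2 : Φ.inclOf z rfl e = Φ.incl z e := rfl
    rw [h2] at h1
    dsimp only
    rw [h1]
    exact incl_inclOf _ _ _ _

theorem Incl.eq_incl {Φ : Pattern s k} {z : Fin Φ.last} {e : (Φ.label (Φ.par z)).Edge}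
    {f : (Φ.label z.succ).Edge} (h : Φ.Incl ⟨Φ.par z, e⟩ ⟨z.succ, f⟩) : f = Φ.incl z e := by
  generalize hp : (⟨Φ.par z, e⟩ : Σ x, (Φ.label x).Edge) = p at h
  generalize hq : (⟨z.succ, f⟩ : Σ x, (Φ.label x).Edge) = q at h
  cases h with
  | intro w e' =>
    obtain ⟨h1, h2⟩ := Sigma.mk.inj_iff.1 hq
    obtain rfl := Fin.succ_injective _ h1
    obtain ⟨-, h3⟩ := Sigma.mk.inj_iff.1 hp
    rw [eq_of_heq h2, eq_of_heq h3]

theorem parent_of_incl {Ψ : Pattern s k} {x y : Fin (Ψ.last + 1)} (h : Ψ.IsParent x y) {A : Type}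
    [(edgeLang s).Structure A] {B C : EdgeTree s k} (j : B.Edge ↪[edgeLang s] C.Edge)
    (τ₁ : B.Edge ≃[edgeLang s] (Ψ.label x).Edge) (τ₂ : C.Edge ≃[edgeLang s] (Ψ.label y).Edge)
    (h' : ∀ e, Ψ.Incl ⟨x, τ₁ e⟩ ⟨y, τ₂ (j e)⟩) (β : C.Edge ↪[edgeLang s] A) :
    Ψ.Parent A ⟨x, (β.comp j).comp τ₁.symm.toEmbedding⟩ ⟨y, β.comp τ₂.symm.toEmbedding⟩ := by
  cases h with
  | intro z =>
    have h1 : (β.comp j).comp τ₁.symm.toEmbedding =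
        (β.comp τ₂.symm.toEmbedding).comp (Ψ.incl z) := by
      ext e
      obtain ⟨e, rfl⟩ := τ₁.surjective e
      change β (j (τ₁.symm (τ₁ e))) = β (τ₂.symm (Ψ.incl z (τ₁ e)))
      rw [← (h' e).eq_incl, Language.Equiv.symm_apply_apply, Language.Equiv.symm_apply_apply]
    rw [h1]
    exact Parent.intro z _

/-- Embeddings are composed with the inverse isomorphisms of labels. The map preserves parents; it
also reflects them, since a child has only one parent in the output. -/
theorem Isomorphic.equivalent {Φ Ψ : Pattern s k} (h : Φ.Isomorphic Ψ) : Φ.Equivalent Ψ := by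
  obtain ⟨σ, τ, hσ, hτ⟩ := h
  intro A _ _
  let e : Φ.Node A ≃ Ψ.Node A := Equiv.sigmaCongr σ fun x =>
    { toFun := fun α => α.comp (τ x).symm.toEmbedding
      invFun := fun β => β.comp (τ x).toEmbedding
      left_inv := fun α => by
        ext a
        exact congrArg α ((τ x).symm_apply_apply a)
      right_inv := fun β => by
        ext a
        exact congrArg β ((τ x).apply_symm_apply a) }
  have he : ∀ x α, e ⟨x, α⟩ = ⟨σ x, α.comp (τ x).symm.toEmbedding⟩ := fun x α => rfl
  have hfst : ∀ y, (e y).1 = σ y.1 := fun y => rfl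
  have hfwd : ∀ {a b}, Φ.Parent A a b → Ψ.Parent A (e a) (e b) := by
    rintro a b ⟨z, β⟩
    rw [he, he]
    exact parent_of_incl ((hσ _ _).1 (IsParent.intro z)) (Φ.incl z) _ _
      (fun e => hτ _ _ e _ (Incl.intro z e)) β
  have hpar : ∀ {a b}, Φ.Parent A a b → Φ.IsParent a.1 b.1 := by
    rintro a b ⟨z, β⟩
    exact IsParent.intro z
  have hpar' : ∀ {a b}, Ψ.Parent A a b → Ψ.IsParent a.1 b.1 := by
    rintro a b ⟨z, β⟩
    exact IsParent.intro z
  refine ⟨⟨e, fun {a b} => ⟨fun h => ?_, hfwd⟩⟩⟩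
  have h1 : Φ.IsParent a.1 b.1 := (hσ _ _).2 (hpar' h)
  obtain ⟨y, β⟩ := b
  generalize hx : a.1 = x at h1
  dsimp only at h1
  cases h1 with
  | intro z =>
    have h2 := hfwd (Parent.intro z β)
    rw [e.injective (Ψ.parent_unique h h2)]
    exact Parent.intro z β

/-- Patterns that define equivalent functions are isomorphic. -/
theorem Equivalent.isomorphic {Φ Ψ : Pattern s k} (h : Φ.Equivalent Ψ) : Φ.Isomorphic Ψ := by
  classical
  -- Both patterns go into one forest, so that their nodes can be compared by a single generic
  -- evaluation.
  let P : Bool → Pattern s k := fun b => bif b then Ψ else Φ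
  obtain ⟨m, hm⟩ : ∃ m, ∀ x : (Pattern.forest P).X, ((Pattern.forest P).label x).size ≤ m := by
    obtain ⟨m, hm⟩ := (Set.finite_range fun x : (Pattern.forest P).X =>
      ((Pattern.forest P).label x).size).bddAbove
    exact ⟨m, fun x => hm ⟨x, rfl⟩⟩
  let θ : ((P false).label 0).Edge ≃[edgeLang s] ((P true).label 0).Edge :=
    equivOfSurjective (mkEmb (fun e => isEmptyElim e) (fun e => isEmptyElim e)
      (fun e => isEmptyElim e) fun _ e => isEmptyElim e) fun e => isEmptyElim e
  let h₀ : ((Pattern.forest P).label ⟨true, 0⟩).Edge → Fin m :=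
    fun e => isEmptyElim (α := ((P true).label 0).Edge) e
  have hh₀ : Function.Injective h₀ := fun e => isEmptyElim (α := ((P true).label 0).Edge) e
  refine isomorphic_of_good P θ (Forest.good_of_value_eq (G := Pattern.forest P)
    (x := ⟨false, 0⟩) (x' := ⟨true, 0⟩) hm _ θ hh₀ ?_)
  funext v
  -- The hypothesis is used on test trees only. An isomorphism of outputs preserves the root, hence
  -- the value of the root, for every `v`.
  obtain ⟨e⟩ := h (TestTree s k v) WordTree.isEdgeTree
  have hroot : e (Φ.root _) = Ψ.root _ := by
    rw [eq_root_iff]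
    intro x hx
    obtain ⟨x, rfl⟩ := e.surjective x
    exact (Φ.eq_root_iff _).1 rfl x (e.map_rel_iff.1 hx)
  have i1 : Fintype ((P false).Node (TestTree s k v)) := Fintype.ofFinite _
  have i2 : Fintype ((P true).Node (TestTree s k v)) := Fintype.ofFinite _
  change (P false).Parent (TestTree s k v) ≃r (P true).Parent (TestTree s k v) at e
  have h1 := relValue_iso e ((P false).last + 1) ((P false).root _)
  rw [show e ((P false).root _) = (P true).root _ from hroot] at h1
  have h2 := Pattern.relValue_eq P hm v false ((P false).last + 1) (Φ.root _)
  have h3 := Pattern.relValue_eq P hm v true ((P false).last + 1) (Ψ.root _)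
  refine Eq.trans ?_ (h2.symm.trans (h1.trans (h3.trans ?_)))
  · congr 1
    funext e
    exact isEmptyElim (α := ((P false).label 0).Edge) e
  · congr 1
    funext e
    exact isEmptyElim (α := ((P true).label 0).Edge) e

end Pattern
end TreeInterp

namespace TreeInterp

open FirstOrder

/-! ### Substructures and sums of edge-labelled trees -/

section Structures

variable {s k : ℕ} {A B : Type} [(edgeLang s).Structure A] [(edgeLang s).Structure B]

theorem map_iterate_parentFun (f : A ↪[edgeLang s] B) (j : ℕ) (e : A) :
    f ((parentFun s A)^[j] e) = (parentFun s B)^[j] (f e) := by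
  induction j generalizing e with
  | zero => rfl
  | succ j ih => rw [Function.iterate_succ_apply, Function.iterate_succ_apply, ih, map_parentFun]

/-- Every set of edges that is closed under parents is the range of an embedding. -/
theorem IsEdgeTree.exists_edgeTree_range (hA : IsEdgeTree s k A) (S : Set A)
    (hS : ∀ e ∈ S, parentFun s A e ∈ S) :
    ∃ (t : EdgeTree s k) (f : t.Edge ↪[edgeLang s] A), Set.range f = S := by
  have := hA.finite
  obtain ⟨n, ⟨E⟩⟩ := Finite.exists_equiv_fin S
  choose lab hlab using fun e => (hA.existsUnique_label e)
  let par : Fin n → Fin n := fun i => E ⟨parentFun s A (E.symm i).1, hS _ (E.symm i).2⟩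
  have hpar : ∀ i, (E.symm (par i)).1 = parentFun s A (E.symm i).1 := fun i => by
    simp [par]
  have hiter : ∀ j i, (E.symm (par^[j] i)).1 = (parentFun s A)^[j] (E.symm i).1 := by
    intro j
    induction j with
    | zero => exact fun i => rfl
    | succ j ih =>
      intro i
      rw [Function.iterate_succ_apply, Function.iterate_succ_apply, ih, hpar]
  let t : EdgeTree s k := ⟨n, par, fun i => lab (E.symm i).1, fun i => by
    obtain ⟨j, hj, h⟩ := hA.height_le (E.symm i).1
    refine ⟨j, hj, E.symm.injective (Subtype.ext ?_)⟩
    rw [hpar, hiter, h]⟩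
  let f : t.Edge ↪[edgeLang s] A := mkEmb (fun i => (E.symm i).1)
    (fun i j h => E.symm.injective (Subtype.ext h)) hpar (fun a i =>
      ⟨fun h => ((hlab (E.symm i).1).2 a h).symm, fun h => by
        have h' : lab (E.symm i).1 = a := h
        rw [← h']
        exact (hlab _).1⟩)
  refine ⟨t, f, Set.ext fun e => ⟨?_, fun he => ⟨E ⟨e, he⟩, ?_⟩⟩⟩
  · rintro ⟨i, rfl⟩
    exact (E.symm i).2
  · change (E.symm (E ⟨e, he⟩)).1 = e
    rw [Equiv.symm_apply_apply]

/-- The elements of the tuple generate the structure. -/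
def Generates {d : ℕ} (a : Fin d → A) : Prop := ∀ e, ∃ j l, e = (parentFun s A)^[j] (a l)

theorem IsEdgeTree.exists_generated (hA : IsEdgeTree s k A) {d : ℕ} (a : Fin d → A) :
    ∃ (t : EdgeTree s k) (f : t.Edge ↪[edgeLang s] A) (b : Fin d → t.Edge),
      f ∘ b = a ∧ Generates (s := s) b := by
  obtain ⟨t, f, hf⟩ := hA.exists_edgeTree_range {e | ∃ j l, e = (parentFun s A)^[j] (a l)} (by
    rintro e ⟨j, l, rfl⟩
    exact ⟨j + 1, l, by rw [Function.iterate_succ_apply']⟩)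
  choose b hb using fun l => (hf.symm ▸ ⟨0, l, rfl⟩ : a l ∈ Set.range f)
  refine ⟨t, f, b, funext hb, fun e => ?_⟩
  obtain ⟨j, l, h⟩ : f e ∈ {e | ∃ j l, e = (parentFun s A)^[j] (a l)} := hf ▸ ⟨e, rfl⟩
  refine ⟨j, l, f.injective ?_⟩
  rw [h, map_iterate_parentFun, hb]

/-- Iterates of the parent function are stationary from some index below `k` on. Hence each of `d`
generators yields at most `k` edges, which is the bound in `size_le_of_generates`. -/
theorem EdgeTree.exists_lt_iterate_eq (t : EdgeTree s k) (j : ℕ) (e : t.Edge) :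
    ∃ i < k, t.up^[i] e = t.up^[j] e := by
  obtain ⟨i, hi, hloop⟩ := t.exists_loop e
  have hstable : ∀ n, t.up^[n + i] e = t.up^[i] e := by
    intro n
    induction n with
    | zero => rw [Nat.zero_add]
    | succ n ih => rw [Nat.succ_add, Function.iterate_succ_apply', ih, hloop]
  by_cases hj : j < k
  · exact ⟨j, hj, rfl⟩
  · exact ⟨i, hi, by rw [← hstable (j - i), show j - i + i = j by omega]⟩

theorem EdgeTree.size_le_of_generates {t : EdgeTree s k} {d : ℕ} {a : Fin d → t.Edge}
    (h : Generates (s := s) a) : t.size ≤ k * d := by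
  have hsurj : Function.Surjective fun p : Fin k × Fin d => t.up^[p.1] (a p.2) := by
    intro e
    obtain ⟨j, l, rfl⟩ := h e
    obtain ⟨i, hi, h⟩ := t.exists_lt_iterate_eq j (a l)
    exact ⟨(⟨i, hi⟩, l), h⟩
  have := Fintype.card_le_of_surjective _ hsurj
  simpa [EdgeTree.card_edge] using this

/-- The sum of two trees, with the roots identified. -/
instance : (edgeLang s).Structure (A ⊕ B) where
  funMap f xs := match f with
    | EdgeFunc.parent => Sum.map (parentFun s A) (parentFun s B) (xs 0)
  RelMap r xs := match r with
    | EdgeRel.hasLabel a => Sum.elim (HasLabel a) (HasLabel a) (xs 0)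

variable (s A B) in
/-- The embedding of the first summand. -/
def inlEmb : A ↪[edgeLang s] (A ⊕ B) :=
  mkEmb Sum.inl Sum.inl_injective (fun _ => rfl) fun _ _ => Iff.rfl

variable (s A B) in
/-- The embedding of the second summand. -/
def inrEmb : B ↪[edgeLang s] (A ⊕ B) :=
  mkEmb Sum.inr Sum.inr_injective (fun _ => rfl) fun _ _ => Iff.rfl

theorem IsEdgeTree.sum (hA : IsEdgeTree s k A) (hB : IsEdgeTree s k B) :
    IsEdgeTree s k (A ⊕ B) where
  finite := by
    have := hA.finite
    have := hB.finite
    infer_instance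
  existsUnique_label e := by
    cases e with
    | inl e => exact hA.existsUnique_label e
    | inr e => exact hB.existsUnique_label e
  height_le e := by
    cases e with
    | inl e =>
      obtain ⟨j, hj, h⟩ := hA.height_le e
      refine ⟨j, hj, ?_⟩
      have h1 := map_iterate_parentFun (inlEmb s A B) j e
      change _ = (parentFun s (A ⊕ B))^[j] (Sum.inl e) at h1
      rw [← h1, ← map_parentFun, h]
    | inr e =>
      obtain ⟨j, hj, h⟩ := hB.height_le e
      refine ⟨j, hj, ?_⟩
      have h1 := map_iterate_parentFun (inrEmb s A B) j e
      change _ = (parentFun s (A ⊕ B))^[j] (Sum.inr e) at h1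
      rw [← h1, ← map_parentFun, h]

variable (s k) in
/-- The tree that consists of the root only. -/
def emptyTree : EdgeTree s k := ⟨0, Fin.elim0, Fin.elim0, fun e => e.elim0⟩

instance : IsEmpty (emptyTree s k).Edge := inferInstanceAs (IsEmpty (Fin 0))

variable (s k A) in
/-- The embedding of the empty structure. -/
def emptyEmb : (emptyTree s k).Edge ↪[edgeLang s] A :=
  mkEmb (fun e => isEmptyElim e) (fun e => isEmptyElim e) (fun e => isEmptyElim e)
    fun _ e => isEmptyElim e

end Structures

/-! ### Depth in trees -/

/-- There is a path of length `m` from a node without parent to the given node. -/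
inductive HasDepth {V : Type} (R : V → V → Prop) : ℕ → V → Prop
  | root {y : V} : (∀ x, ¬ R x y) → HasDepth R 0 y
  | succ {m : ℕ} {x y : V} : HasDepth R m x → R x y → HasDepth R (m + 1) y

theorem IsTreeOfHeightLE.parent_unique {n : ℕ} {V : Type} {R : V → V → Prop}
    (h : IsTreeOfHeightLE n R) {x x' y : V} (hx : R x y) (hx' : R x' y) : x = x' := by
  obtain ⟨r, h1, h2, -⟩ := h
  exact (h2 y (by rintro rfl; exact h1 x hx)).unique hx hx'

theorem IsTreeOfHeightLE.root_unique {n : ℕ} {V : Type} {R : V → V → Prop}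
    (h : IsTreeOfHeightLE n R) {x y : V} (hx : ∀ z, ¬ R z x) (hy : ∀ z, ¬ R z y) : x = y := by
  obtain ⟨r, -, h2, -⟩ := h
  have key : ∀ x, (∀ z, ¬ R z x) → x = r := fun x hx => by
    by_contra hne
    obtain ⟨z, hz, -⟩ := h2 x hne
    exact hx z hz
  rw [key x hx, key y hy]

theorem IsTreeOfHeightLE.exists_depth {n : ℕ} {V : Type} {R : V → V → Prop}
    (h : IsTreeOfHeightLE n R) (y : V) : ∃ m, HasDepth R m y := by
  obtain ⟨r, h1, -, h3⟩ := h
  obtain ⟨m, -, path, h0, rfl, hp⟩ := h3 y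
  refine ⟨m, ?_⟩
  have : ∀ i ≤ m, HasDepth R i (path i) := by
    intro i
    induction i with
    | zero => exact fun _ => HasDepth.root (by rw [h0]; exact h1)
    | succ i ih => exact fun hi => HasDepth.succ (ih (by omega)) (hp i hi)
  exact this m le_rfl

theorem HasDepth.not_rel {V : Type} {R : V → V → Prop} {y : V} (h : HasDepth R 0 y) (x : V) :
    ¬ R x y := by
  cases h with
  | root h => exact h x

theorem HasDepth.unique {V : Type} {R : V → V → Prop}
    (hR : ∀ x x' y, R x y → R x' y → x = x') {m m' : ℕ} {y : V} (h : HasDepth R m y)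
    (h' : HasDepth R m' y) : m = m' := by
  induction h generalizing m' with
  | root h =>
    cases h' with
    | root _ => rfl
    | succ _ h1 => exact absurd h1 (h _)
  | succ _ h1 ih =>
    cases h' with
    | root h => exact absurd h1 (h _)
    | succ h2 h3 =>
      rw [hR _ _ _ h1 h3] at ih
      rw [ih h2]

/-! ### Interpretations as functors -/

namespace QFInterp

variable {s k n : ℕ} (F : QFInterp s) {A B C : Type} [(edgeLang s).Structure A]
  [(edgeLang s).Structure B] [(edgeLang s).Structure C]

theorem realize_comp (f : A ↪[edgeLang s] B) {d : ℕ} {φ : (edgeLang s).Formula (Fin d)}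
    (h : Language.BoundedFormula.IsQF φ) (a : Fin d → A) : φ.Realize (f ∘ a) ↔ φ.Realize a := by
  unfold Language.Formula.Realize
  rw [← h.realize_embedding f (v := a)]
  rw [Subsingleton.elim (default : Fin 0 → B) (f ∘ default)]

/-- The map of output nodes that is induced by an embedding. -/
def map (f : A ↪[edgeLang s] B) (p : F.Node A) : F.Node B :=
  ⟨⟨p.1.1, f ∘ p.1.2⟩, (realize_comp f (F.univ_isQF _) _).2 p.2⟩

theorem map_comp (f : A ↪[edgeLang s] B) (g : B ↪[edgeLang s] C) (p : F.Node A) :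
    F.map (g.comp f) p = F.map g (F.map f p) := rfl

theorem parent_map (f : A ↪[edgeLang s] B) (p q : F.Node A) :
    F.Parent B (F.map f p) (F.map f q) ↔ F.Parent A p q := by
  unfold Parent
  rw [← realize_comp f (F.par_isQF _ _)]
  have : f ∘ Fin.append p.1.2 q.1.2 = Fin.append (F.map f p).1.2 (F.map f q).1.2 := by
    funext l
    induction l using Fin.addCases with
    | left l =>
      rw [Function.comp_apply, Fin.append_left]
      exact (Fin.append_left (f ∘ p.1.2) (f ∘ q.1.2) l).symm
    | right l =>
      rw [Function.comp_apply, Fin.append_right]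
      exact (Fin.append_right (f ∘ p.1.2) (f ∘ q.1.2) l).symm
  rw [← this]
  rfl

variable {F}

/-- The root of the output on the empty structure is the root of all outputs. -/
theorem MapsTrees.exists_root (h : F.MapsTrees k n) :
    ∃ r : F.Node (emptyTree s k).Edge, ∀ (A : Type) [(edgeLang s).Structure A],
      IsEdgeTree s k A → ∀ x, ¬ F.Parent A x (F.map (emptyEmb s k A) r) := by
  obtain ⟨r, hr, -⟩ := h _ (emptyTree s k).isEdgeTree
  refine ⟨r, fun A _ hA p hp => ?_⟩
  -- If `p` were a parent of the root on `A`, then both copies of `p` on `A ⊕ A` would be parents of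
  -- the same node, since the root comes from the empty structure. So the copies coincide, which
  -- forces dimension 0. Then `p` already exists on the empty structure, where `r` has no parent.
  have h1 := (F.parent_map (inlEmb s A A) _ _).2 hp
  have h2 := (F.parent_map (inrEmb s A A) _ _).2 hp
  rw [← map_comp, Pattern.embedding_ext_of_isEmpty ((inlEmb s A A).comp (emptyEmb s k A))
    (emptyEmb s k (A ⊕ A))] at h1
  rw [← map_comp, Pattern.embedding_ext_of_isEmpty ((inrEmb s A A).comp (emptyEmb s k A))
    (emptyEmb s k (A ⊕ A))] at h2
  have h3 := (h _ (hA.sum hA)).parent_unique h1 h2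
  obtain ⟨⟨i, a⟩, ha⟩ := p
  have h4 := eq_of_heq (Sigma.mk.inj_iff.1 (congrArg Subtype.val h3)).2
  have h5 : IsEmpty (Fin (F.dim i)) := ⟨fun l => by
    have h6 : (Sum.inl (a l) : A ⊕ A) = Sum.inr (a l) := congrFun h4 l
    exact absurd h6 (by simp)⟩
  have h6 : emptyEmb s k A ∘ (fun l => h5.elim l) = a := funext fun l => h5.elim l
  have h7 : (F.univ i).Realize fun l => (h5.elim l : (emptyTree s k).Edge) := by
    rw [← realize_comp (emptyEmb s k A) (F.univ_isQF i), h6]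
    exact ha
  let p : F.Node (emptyTree s k).Edge := ⟨⟨i, fun l => h5.elim l⟩, h7⟩
  have h8 : F.map (emptyEmb s k A) p = ⟨⟨i, a⟩, ha⟩ := Subtype.ext (congrArg (Sigma.mk i) h6)
  refine hr p ((F.parent_map (emptyEmb s k A) p r).1 ?_)
  rw [h8]
  exact hp

end QFInterp

end TreeInterp

namespace TreeInterp

open FirstOrder

/-! ### Types of tuples -/

section SameType

variable {s k : ℕ} {A B C : Type} [(edgeLang s).Structure A] [(edgeLang s).Structure B]
  [(edgeLang s).Structure C]

variable (s) in
/-- The two tuples satisfy the same atomic formulas. -/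
def SameType {d : ℕ} (a : Fin d → A) (b : Fin d → B) : Prop :=
  (∀ j l j' l', (parentFun s A)^[j] (a l) = (parentFun s A)^[j'] (a l') ↔
    (parentFun s B)^[j] (b l) = (parentFun s B)^[j'] (b l')) ∧
  ∀ (c : Fin s) j l, HasLabel c ((parentFun s A)^[j] (a l)) ↔
    HasLabel c ((parentFun s B)^[j] (b l))

theorem SameType.symm {d : ℕ} {a : Fin d → A} {b : Fin d → B} (h : SameType s a b) :
    SameType s b a :=
  ⟨fun j l j' l' => (h.1 j l j' l').symm, fun c j l => (h.2 c j l).symm⟩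

theorem SameType.trans {d : ℕ} {a : Fin d → A} {b : Fin d → B} {c : Fin d → C}
    (h : SameType s a b) (h' : SameType s b c) : SameType s a c :=
  ⟨fun j l j' l' => (h.1 j l j' l').trans (h'.1 j l j' l'),
    fun c j l => (h.2 c j l).trans (h'.2 c j l)⟩

theorem sameType_comp {d : ℕ} (f : A ↪[edgeLang s] B) (a : Fin d → A) :
    SameType s a (f ∘ a) := by
  constructor
  · intro j l j' l'
    simp only [Function.comp_apply, ← map_iterate_parentFun, f.injective.eq_iff]
  · intro c j l
    simp only [Function.comp_apply, ← map_iterate_parentFun, map_hasLabel]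

/-- The map takes an iterated parent of `a l` to the same iterated parent of `b l`; equality of
types says that this is well defined, injective and compatible with labels. -/
theorem SameType.exists_embedding {d : ℕ} {a : Fin d → A} {b : Fin d → B} (h : SameType s a b)
    (ha : Generates (s := s) a) : ∃ f : A ↪[edgeLang s] B, f ∘ a = b := by
  choose j l hjl using ha
  have key : ∀ e j' l', e = (parentFun s A)^[j'] (a l') →
      (parentFun s B)^[j e] (b (l e)) = (parentFun s B)^[j'] (b l') := fun e j' l' he =>
    (h.1 _ _ _ _).1 ((hjl e).symm.trans he)
  refine ⟨mkEmb (fun e => (parentFun s B)^[j e] (b (l e))) (fun e e' he => ?_) (fun e => ?_)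
    (fun c e => ?_), funext fun i => key (a i) 0 i rfl⟩
  · rw [hjl e, hjl e']
    exact (h.1 _ _ _ _).2 he
  · rw [key (parentFun s A e) (j e + 1) (l e), Function.iterate_succ_apply']
    rw [Function.iterate_succ_apply', ← hjl e]
  · rw [← h.2, ← hjl e]

theorem Generates.embedding_ext {d : ℕ} {a : Fin d → A} (ha : Generates (s := s) a)
    {f g : A ↪[edgeLang s] B} (h : f ∘ a = g ∘ a) : f = g := by
  ext e
  obtain ⟨j, l, rfl⟩ := ha e
  rw [map_iterate_parentFun, map_iterate_parentFun]
  exact congrArg _ (congrFun h l)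

end SameType

/-- Words of length at most `k` are padded with `none` to functions on `Fin k`. -/
theorem WordTree.card_le {s k : ℕ} {J : Type} [Fintype J] (P : List (Fin s × J) → Prop) :
    Finite (WordTree s k P) ∧
      Nat.card (WordTree s k P) ≤ (s * Fintype.card J + 1) ^ k := by
  let f : WordTree s k P → Fin k → Option (Fin s × J) := fun w i => w.1[i.1]?
  have hf : Function.Injective f := by
    intro w w' h
    apply Subtype.ext
    apply List.ext_getElem?
    intro i
    by_cases hi : i < k
    · exact congrFun h ⟨i, hi⟩
    · rw [List.getElem?_eq_none (by have := w.2.2.1; omega),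
        List.getElem?_eq_none (by have := w'.2.2.1; omega)]
  refine ⟨Finite.of_injective f hf, (Nat.card_le_card_of_injective f hf).trans ?_⟩
  simp

/-! ### From interpretations to patterns -/

namespace QFInterp

variable {s k n : ℕ} (F : QFInterp s)

section Sim

variable {A B C : Type} [(edgeLang s).Structure A] [(edgeLang s).Structure B]
  [(edgeLang s).Structure C]

/-- The two nodes belong to the same component, and their tuples have the same type. -/
def Sim (p : F.Node A) (q : F.Node B) : Prop :=
  ∃ h : p.1.1 = q.1.1, SameType s p.1.2 (q.1.2 ∘ Fin.cast (congrArg F.dim h))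

variable {F}

theorem Sim.symm {p : F.Node A} {q : F.Node B} (h : F.Sim p q) : F.Sim q p := by
  obtain ⟨⟨i, a⟩, ha⟩ := p
  obtain ⟨⟨j, b⟩, hb⟩ := q
  obtain ⟨h1, h2⟩ := h
  dsimp only at h1
  subst h1
  exact ⟨rfl, SameType.symm h2⟩

theorem Sim.trans {p : F.Node A} {q : F.Node B} {r : F.Node C} (h : F.Sim p q)
    (h' : F.Sim q r) : F.Sim p r := by
  obtain ⟨⟨i, a⟩, ha⟩ := p
  obtain ⟨⟨j, b⟩, hb⟩ := q
  obtain ⟨⟨l, c⟩, hc⟩ := r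
  obtain ⟨h1, h2⟩ := h
  obtain ⟨h3, h4⟩ := h'
  dsimp only at h1 h3
  subst h1
  subst h3
  exact ⟨rfl, SameType.trans h2 h4⟩

theorem sim_map (f : A ↪[edgeLang s] B) (p : F.Node A) : F.Sim p (F.map f p) :=
  ⟨rfl, sameType_comp f p.1.2⟩

theorem Sim.exists_embedding {p : F.Node A} {q : F.Node B} (h : F.Sim p q)
    (hp : Generates (s := s) p.1.2) : ∃ f : A ↪[edgeLang s] B, F.map f p = q := by
  obtain ⟨⟨i, a⟩, ha⟩ := p
  obtain ⟨⟨j, b⟩, hb⟩ := q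
  obtain ⟨h1, h2⟩ := h
  dsimp only at h1
  subst h1
  obtain ⟨f, hf⟩ := SameType.exists_embedding h2 hp
  exact ⟨f, Subtype.ext (congrArg (Sigma.mk i) hf)⟩

theorem embedding_ext {p : F.Node A} (hp : Generates (s := s) p.1.2) {f g : A ↪[edgeLang s] B}
    (h : F.map f p = F.map g p) : f = g :=
  hp.embedding_ext (eq_of_heq (Sigma.mk.inj_iff.1 (congrArg Subtype.val h)).2)

theorem exists_generated_node (hA : IsEdgeTree s k A) (y : F.Node A) :
    ∃ (t : EdgeTree s k) (f : t.Edge ↪[edgeLang s] A) (p : F.Node t.Edge),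
      F.map f p = y ∧ Generates (s := s) p.1.2 := by
  obtain ⟨⟨i, a⟩, ha⟩ := y
  obtain ⟨t, f, b, rfl, hb⟩ := hA.exists_generated a
  exact ⟨t, f, ⟨⟨i, b⟩, (realize_comp f (F.univ_isQF i) b).1 ha⟩, rfl, hb⟩

end Sim

/-- The sum of the dimensions. -/
def totalDim : ℕ := ∑ i, F.dim i

theorem dim_le (i : Fin F.comps) : F.dim i ≤ F.totalDim :=
  Finset.single_le_sum (f := F.dim) (fun _ _ => Nat.zero_le _) (Finset.mem_univ i)

/-- A bound for the size of the pattern of an interpretation. -/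
def sizeBound (s k c d : ℕ) : ℕ := c * ((s * (k * d) + 1) ^ k + 1) ^ d * (1 + k * d)

theorem card_node_le {A : Type} [(edgeLang s).Structure A] [Finite A] :
    Finite (F.Node A) ∧ Nat.card (F.Node A) ≤ F.comps * (Nat.card A + 1) ^ F.totalDim := by
  have hfin : Finite (F.Node A) := inferInstanceAs (Finite {p : Σ i, (Fin (F.dim i) → A) // _})
  refine ⟨hfin, ?_⟩
  have h1 : Nat.card (F.Node A) ≤ Nat.card (Σ i, (Fin (F.dim i) → A)) :=
    Nat.card_le_card_of_injective (fun p : F.Node A => p.1) Subtype.val_injective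
  refine h1.trans ?_
  rw [Nat.card_sigma]
  have h2 : ∀ i ∈ Finset.univ, Nat.card (Fin (F.dim i) → A) ≤ (Nat.card A + 1) ^ F.totalDim := by
    intro i _
    rw [Nat.card_fun, Nat.card_fin]
    exact (Nat.pow_le_pow_left (Nat.le_succ _) _).trans
      (Nat.pow_le_pow_right (Nat.succ_pos _) (F.dim_le i))
  refine (Finset.sum_le_card_nsmul _ _ _ h2).trans ?_
  simp

/-- A finite family of nodes of outputs that represents all types of nodes. -/
theorem exists_family : ∃ (Q : Type) (_ : Fintype Q) (t : Q → EdgeTree s k)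
    (p : ∀ q, F.Node (t q).Edge),
    Fintype.card Q * (1 + k * F.totalDim) ≤ sizeBound s k F.comps F.totalDim ∧
    (∀ q, (t q).size ≤ k * F.totalDim) ∧
    (∀ q, Generates (s := s) (p q).1.2) ∧
    (∀ (A : Type) [(edgeLang s).Structure A], IsEdgeTree s k A → ∀ y : F.Node A,
      ∃ q, ∃ α : (t q).Edge ↪[edgeLang s] A, F.map α (p q) = y) ∧
    ∀ (A : Type) [(edgeLang s).Structure A] (q q') (α : (t q).Edge ↪[edgeLang s] A)
      (α' : (t q').Edge ↪[edgeLang s] A), F.map α (p q) = F.map α' (p q') →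
      (⟨q, α⟩ : Σ q, ((t q).Edge ↪[edgeLang s] A)) = ⟨q', α'⟩ := by
  classical
  set m := k * F.totalDim with hm
  -- `W` is universal for trees with at most `m` edges, because any injective numbering of the edges
  -- by `Fin m` gives an embedding. So every type of output node already occurs on `W`.
  let W := WordTree s k (J := Fin m) fun _ => True
  obtain ⟨hW, hWc⟩ := WordTree.card_le (s := s) (k := k) (J := Fin m) fun _ => True
  have hWt : IsEdgeTree s k W := WordTree.isEdgeTree
  obtain ⟨hN, hNc⟩ := F.card_node_le (A := W)
  let S : Setoid (F.Node W) := ⟨F.Sim, ⟨fun p => ⟨rfl, ⟨fun _ _ _ _ => Iff.rfl, fun _ _ _ =>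
    Iff.rfl⟩⟩, Sim.symm, Sim.trans⟩⟩
  have : Fintype (Quotient S) := Fintype.ofFinite _
  have hsize : ∀ (t : EdgeTree s k) (p : F.Node t.Edge), Generates (s := s) p.1.2 →
      t.size ≤ m := fun t p hp =>
    (EdgeTree.size_le_of_generates hp).trans (Nat.mul_le_mul_left k (F.dim_le _))
  choose t f p hf hp using fun q : Quotient S => exists_generated_node hWt q.out
  refine ⟨Quotient S, inferInstance, t, p, ?_, fun q => hsize _ _ (hp q), hp, ?_, ?_⟩
  · unfold sizeBound
    rw [← hm]
    refine Nat.mul_le_mul_right _ ?_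
    rw [← Nat.card_eq_fintype_card]
    refine (Nat.card_le_card_of_surjective _ (Quotient.mk_surjective (s := S))).trans
      (hNc.trans ?_)
    refine Nat.mul_le_mul_left _ (Nat.pow_le_pow_left (Nat.succ_le_succ ?_) _)
    simpa using hWc
  · intro A _ hA y
    obtain ⟨t', g, p', rfl, hp'⟩ := exists_generated_node hA y
    let u : t'.Edge → Fin m := Fin.castLE (hsize t' p' hp')
    have hu : Function.Injective u := Fin.castLE_injective _
    let h : t'.Edge ↪[edgeLang s] W :=
      WordTree.emb u (fun _ => trivial) (t'.word_injective_of_injective hu)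
    let w : F.Node W := F.map h p'
    let q : Quotient S := Quotient.mk S w
    have h1 : F.Sim q.out w := Quotient.exact (Quotient.out_eq q)
    have h2 : F.Sim (p q) q.out := by
      rw [← hf q]
      exact sim_map _ _
    -- Types do not depend on the surrounding structure, so the type can be carried from `W` through
    -- `t'` to `A`.
    have h3 : F.Sim (p q) (F.map g p') :=
      (h2.trans h1).trans ((sim_map h p').symm.trans (sim_map g p'))
    exact ⟨q, h3.exists_embedding (hp q)⟩
  · intro A _ q q' α α' h
    have h1 : F.Sim (p q) (p q') := (sim_map α (p q)).trans (h ▸ (sim_map α' (p q')).symm)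
    have h2 : F.Sim q.out q'.out := by
      rw [← hf q, ← hf q']
      exact (sim_map _ _).symm.trans (h1.trans (sim_map _ _))
    obtain rfl : q = q' := by
      rw [← Quotient.out_eq q, ← Quotient.out_eq q']
      exact Quotient.sound h2
    rw [embedding_ext (hp q) h]

variable {F}

/-- Roots go to roots because every root comes from the empty structure, and quantifier-free
formulas preserve the parent relation. Depth will order the nodes of the pattern. -/
theorem MapsTrees.hasDepth_map (h : F.MapsTrees k n) {A B : Type} [(edgeLang s).Structure A]
    [(edgeLang s).Structure B] (hA : IsEdgeTree s k A) (hB : IsEdgeTree s k B)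
    (f : A ↪[edgeLang s] B) {m : ℕ} {y : F.Node A} (hy : HasDepth (F.Parent A) m y) :
    HasDepth (F.Parent B) m (F.map f y) := by
  induction hy with
  | root hy =>
    obtain ⟨r, hr⟩ := h.exists_root
    rw [(h A hA).root_unique hy (hr A hA), ← map_comp,
      Pattern.embedding_ext_of_isEmpty (f.comp (emptyEmb s k A)) (emptyEmb s k B)]
    exact HasDepth.root (hr B hB)
  | succ _ h1 ih => exact ih.succ ((F.parent_map f _ _).2 h1)

/-- The nodes `p x` represent the output nodes on all inputs: every output node is the image of
exactly one of them under exactly one embedding. -/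
structure Represents (F : QFInterp s) (Φ : Pattern s k) (p : ∀ x, F.Node (Φ.label x).Edge) :
    Prop where
  generates : ∀ x, Generates (s := s) (p x).1.2
  parent : ∀ z, F.Parent _ (F.map (Φ.incl z) (p (Φ.par z))) (p z.succ)
  surj : ∀ t : EdgeTree s k, t.size ≤ k * F.totalDim → ∀ y : F.Node t.Edge,
    ∃ x, ∃ α : (Φ.label x).Edge ↪[edgeLang s] t.Edge, F.map α (p x) = y
  inj : ∀ x x', ∀ β : (Φ.label x).Edge ↪[edgeLang s] (Φ.label x').Edge,
    F.map β (p x) = p x' → x = x'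
  root : ∀ y, ¬ F.Parent _ y (p 0)

/-- The nodes are the types, labelled by the generated trees. The parent of `p q` is an output node
on the label of `q`, so it is the image of some representative `p q'` under an embedding; that
embedding is the inclusion of labels. -/
theorem MapsTrees.exists_represents (h : F.MapsTrees k n) :
    ∃ (Φ : Pattern s k) (p : ∀ x, F.Node (Φ.label x).Edge), F.Represents Φ p ∧
      Φ.size ≤ sizeBound s k F.comps F.totalDim := by
  classical
  obtain ⟨Q, _, t, p, hcard, hsize, hgen, hsurj, hinj⟩ := F.exists_family (k := k)
  obtain ⟨r, hr⟩ := h.exists_root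
  have hT : ∀ q, IsTreeOfHeightLE n (F.Parent (t q).Edge) := fun q => h _ (t q).isEdgeTree
  obtain ⟨q0, α0, hα0⟩ := hsurj _ (emptyTree s k).isEdgeTree r
  have hroot : ∀ (A : Type) [(edgeLang s).Structure A], IsEdgeTree s k A →
      ∀ (α : (t q0).Edge ↪[edgeLang s] A) x, ¬ F.Parent A x (F.map α (p q0)) := by
    intro A _ hA α x
    have : F.map α (p q0) = F.map (emptyEmb s k A) r := by
      rw [← hα0, ← map_comp]
      have : IsEmpty (t q0).Edge := Function.isEmpty α0
      rw [Pattern.embedding_ext_of_isEmpty α]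
    rw [this]
    exact hr A hA x
  have hnoparent : ∀ q, (∀ x, ¬ F.Parent _ x (p q)) → q = q0 := by
    intro q hq
    have h1 := (hT q).root_unique hq (hr _ (t q).isEdgeTree)
    rw [← hα0, ← map_comp] at h1
    exact congrArg Sigma.fst (hinj _ q q0 (Language.Embedding.refl (edgeLang s) _) _ h1)
  have huniq : ∀ q m m', HasDepth (F.Parent (t q).Edge) m (p q) →
      HasDepth (F.Parent (t q).Edge) m' (p q) → m = m' := fun q m m' h1 h2 =>
    HasDepth.unique (R := F.Parent _) (fun _ _ _ => (hT q).parent_unique) h1 h2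
  choose D hD using fun q => (hT q).exists_depth (p q)
  have hD0 : ∀ q, D q = 0 ↔ q = q0 := by
    intro q
    constructor
    · intro h0
      have := hD q
      rw [h0] at this
      exact hnoparent q this.not_rel
    · rintro rfl
      exact huniq q _ _ (hD q)
        (HasDepth.root (hroot _ (t q).isEdgeTree (Language.Embedding.refl (edgeLang s) _)))
  have hparent : ∀ q, q ≠ q0 → ∃ q', D q' < D q ∧
      ∃ ι : (t q').Edge ↪[edgeLang s] (t q).Edge, F.Parent _ (F.map ι (p q')) (p q) := by
    intro q hq
    obtain ⟨x, hx⟩ : ∃ x, F.Parent _ x (p q) := by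
      by_contra! hcon
      exact hq (hnoparent q hcon)
    -- Embeddings preserve depth, so `q'` has depth one less than `q`.
    obtain ⟨q', ι, rfl⟩ := hsurj _ (t q).isEdgeTree x
    refine ⟨q', ?_, ι, hx⟩
    have := huniq q _ _ (hD q)
      ((h.hasDepth_map (t q').isEdgeTree (t q).isEdgeTree ι (hD q')).succ hx)
    omega
  obtain ⟨l, hl⟩ : ∃ l, Fintype.card Q = l + 1 :=
    Nat.exists_eq_succ_of_ne_zero (Fintype.card_pos_iff.2 ⟨q0⟩).ne'
  let E : Fin (l + 1) ≃ Q := (Fintype.equivFinOfCardEq hl).symm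
  -- Sorting by depth puts parents before children, and it puts `q0`, the only type of depth 0, in
  -- position 0.
  let e : Fin (l + 1) ≃ Q := (Tuple.sort (D ∘ E)).trans E
  have hmono : Monotone (D ∘ e) := Tuple.monotone_sort (D ∘ E)
  have he0 : e 0 = q0 := by
    rw [← hD0]
    have h1 := hmono (Fin.zero_le (e.symm q0))
    have h2 : (D ∘ e) (e.symm q0) = 0 := by
      rw [Function.comp_apply, Equiv.apply_symm_apply, hD0]
    rw [h2] at h1
    exact Nat.le_zero.1 h1
  have hpar : ∀ z : Fin l, ∃ x, x < z.succ ∧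
      ∃ ι : (t (e x)).Edge ↪[edgeLang s] (t (e z.succ)).Edge,
        F.Parent _ (F.map ι (p (e x))) (p (e z.succ)) := by
    intro z
    obtain ⟨q', h1, h2⟩ := hparent (e z.succ) (by
      rw [← he0, e.injective.ne_iff]
      exact Fin.succ_ne_zero z)
    obtain ⟨x, rfl⟩ := e.surjective q'
    exact ⟨x, hmono.reflect_lt h1, h2⟩
  choose par hlt ι hι using hpar
  let Φ : Pattern s k := ⟨l, par, hlt, fun x => t (e x), by
    have : IsEmpty (t (e 0)).Edge := by
      rw [he0]
      exact Function.isEmpty α0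
    rw [← EdgeTree.card_edge, Fintype.card_eq_zero], ι⟩
  refine ⟨Φ, fun x => p (e x), ⟨fun x => hgen (e x), hι, fun t' _ y => ?_, ?_, ?_⟩, ?_⟩
  · obtain ⟨q, α, hα⟩ := hsurj _ t'.isEdgeTree y
    obtain ⟨x, rfl⟩ := e.surjective q
    exact ⟨x, α, hα⟩
  · intro x x' β hβ
    exact e.injective (congrArg Sigma.fst
      (hinj _ (e x) (e x') β (Language.Embedding.refl (edgeLang s) _) hβ))
  · have : ∀ q, q = q0 → ∀ y, ¬ F.Parent (t q).Edge y (p q) := by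
      rintro q rfl
      exact hroot _ (t q).isEdgeTree (Language.Embedding.refl (edgeLang s) _)
    exact this _ he0
  · refine le_trans ?_ hcard
    refine (Finset.sum_le_card_nsmul _ _ (1 + k * F.totalDim) fun x _ =>
      Nat.add_le_add_left (hsize (e x)) 1).trans ?_
    rw [hl]
    change _ ≤ (l + 1) * _
    simp [Φ]

/-- Surjectivity on small trees suffices, since every output node comes from the tree that its tuple
generates. If two representatives have a common image, they have the same type, which gives an
embedding between their labels, so `inj` applies. Parents correspond because each output node has at
most one. -/
theorem Represents.defines {Φ : Pattern s k} {p : ∀ x, F.Node (Φ.label x).Edge}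
    (hp : F.Represents Φ p) (h : F.MapsTrees k n) : Φ.Defines F := by
  intro A _ hA
  let g : Φ.Node A → F.Node A := fun x => F.map x.2 (p x.1)
  have hg : Function.Bijective g := by
    constructor
    · rintro ⟨x, α⟩ ⟨y, β⟩ hxy
      change F.map α (p x) = F.map β (p y) at hxy
      have h1 : F.Sim (p x) (p y) := (sim_map α (p x)).trans (hxy ▸ (sim_map β (p y)).symm)
      obtain ⟨f, hf⟩ := h1.exists_embedding (hp.generates x)
      obtain rfl := hp.inj x y f hf
      rw [embedding_ext (hp.generates x) hxy]
    · intro y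
      obtain ⟨t, f, y, rfl, hy⟩ := exists_generated_node hA y
      obtain ⟨x, α, rfl⟩ := hp.surj t ((EdgeTree.size_le_of_generates hy).trans
        (Nat.mul_le_mul_left k (F.dim_le _))) y
      exact ⟨⟨x, f.comp α⟩, rfl⟩
  refine ⟨⟨Equiv.ofBijective g hg, ?_⟩⟩
  have hfwd : ∀ (z : Fin Φ.last) (β : (Φ.label z.succ).Edge ↪[edgeLang s] A),
      F.Parent A (g ⟨Φ.par z, β.comp (Φ.incl z)⟩) (g ⟨z.succ, β⟩) := fun z β =>
    (F.parent_map β _ _).2 (hp.parent z)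
  rintro a ⟨y, β⟩
  constructor
  · intro hab
    change F.Parent A (g a) (g ⟨y, β⟩) at hab
    induction y using Fin.cases with
    | zero =>
      exfalso
      obtain ⟨r, hr⟩ := h.exists_root
      have h1 := (h _ (Φ.label 0).isEdgeTree).root_unique hp.root (hr _ (Φ.label 0).isEdgeTree)
      change F.Parent A (g a) (F.map β (p 0)) at hab
      rw [h1, ← map_comp, Pattern.embedding_ext_of_isEmpty (β.comp _) (emptyEmb s k A)] at hab
      exact hr A hA _ hab
    | succ z =>
      rw [hg.1 ((h A hA).parent_unique hab (hfwd z β))]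
      exact Pattern.Parent.intro (Φ := Φ) z β
  · intro hab
    cases hab with
    | intro z β => exact hfwd z β

end QFInterp

/-! ### Transfer between patterns and interpretations -/

theorem Pattern.Isomorphic.size_eq {s k : ℕ} {Φ Ψ : Pattern s k} (h : Φ.Isomorphic Ψ) :
    Φ.size = Ψ.size := by
  obtain ⟨σ, τ, -⟩ := h
  unfold Pattern.size
  rw [← σ.sum_comp]
  refine Finset.sum_congr rfl fun x _ => ?_
  rw [← EdgeTree.card_edge, ← EdgeTree.card_edge, Fintype.card_congr (τ x).toEquiv]

theorem Pattern.Defines.equivalent {s k : ℕ} {Φ Ψ : Pattern s k} {F G : QFInterp s}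
    (hΦ : Φ.Defines F) (hΨ : Ψ.Defines G) (h : F.Equivalent k G) : Φ.Equivalent Ψ := by
  intro A _ hA
  obtain ⟨e⟩ := hΦ A hA
  obtain ⟨e'⟩ := hΨ A hA
  obtain ⟨f⟩ := h A hA
  exact ⟨(e.trans f).trans e'.symm⟩

theorem Pattern.Equivalent.interp_equivalent {s k : ℕ} {Φ Ψ : Pattern s k} {F G : QFInterp s}
    (h : Φ.Equivalent Ψ) (hΦ : Φ.Defines F) (hΨ : Ψ.Defines G) : F.Equivalent k G := by
  intro A _ hA
  obtain ⟨e⟩ := hΦ A hA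
  obtain ⟨e'⟩ := hΨ A hA
  obtain ⟨f⟩ := h A hA
  exact ⟨(e.symm.trans f).trans e'⟩

/-! ### The size of the pattern of an interpretation -/

namespace QFInterp

theorem comps_add_totalDim_le {s : ℕ} (F : QFInterp s) : F.comps + F.totalDim ≤ F.size := by
  have h : F.comps + F.totalDim = ∑ i, (1 + F.dim i) := by
    rw [Finset.sum_add_distrib]
    simp [totalDim]
  rw [h]
  exact (Finset.sum_le_sum fun i _ => Nat.le_add_right _ _).trans (Nat.le_add_right _ _)

/-- Each of the three factors of `sizeBound` is bounded separately with `y ≤ 2 ^ y`; the exponents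
add up to the witness. -/
theorem exists_polynomial_sizeBound : ∃ p : Polynomial ℕ, ∀ s k c d x : ℕ, s ≤ x → k ≤ x →
    c ≤ x → d ≤ x → sizeBound s k c d ≤ 2 ^ p.eval x := by
  refine ⟨Polynomial.X + ((Polynomial.X ^ 3 + 1) * Polynomial.X + 1) * Polynomial.X +
    (1 + Polynomial.X ^ 2), fun s k c d x hs hk hc hd => ?_⟩
  have hle : ∀ y : ℕ, y ≤ 2 ^ y := fun y => Nat.lt_two_pow_self.le
  have h1 : s * (k * d) + 1 ≤ 2 ^ (x ^ 3 + 1) := by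
    refine le_trans ?_ (hle _)
    have : s * (k * d) ≤ x * (x * x) := Nat.mul_le_mul hs (Nat.mul_le_mul hk hd)
    calc s * (k * d) + 1 ≤ x * (x * x) + 1 := by omega
      _ = x ^ 3 + 1 := by ring
  have h2 : (s * (k * d) + 1) ^ k + 1 ≤ 2 ^ ((x ^ 3 + 1) * x + 1) := by
    have : (s * (k * d) + 1) ^ k ≤ 2 ^ ((x ^ 3 + 1) * x) := by
      rw [pow_mul]
      exact (Nat.pow_le_pow_left h1 k).trans (Nat.pow_le_pow_right (by positivity) hk)
    have hpos : 0 < 2 ^ ((x ^ 3 + 1) * x) := by positivity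
    rw [pow_succ]
    omega
  have h3 : ((s * (k * d) + 1) ^ k + 1) ^ d ≤ 2 ^ (((x ^ 3 + 1) * x + 1) * x) := by
    rw [pow_mul]
    exact (Nat.pow_le_pow_left h2 d).trans (Nat.pow_le_pow_right (by positivity) hd)
  have h4 : 1 + k * d ≤ 2 ^ (1 + x ^ 2) := by
    refine le_trans ?_ (hle _)
    rw [pow_two]
    exact Nat.add_le_add_left (Nat.mul_le_mul hk hd) 1
  simp only [Polynomial.eval_add, Polynomial.eval_mul, Polynomial.eval_pow, Polynomial.eval_X,
    Polynomial.eval_one]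
  rw [pow_add, pow_add]
  exact Nat.mul_le_mul (Nat.mul_le_mul (hc.trans (hle x)) h3) h4

end QFInterp

end TreeInterp

namespace TreeInterp

/-! ### Primitive recursive functions -/

attribute [fun_prop] Primrec

section Primrec

variable {α β γ δ : Type} [Primcodable α] [Primcodable β] [Primcodable γ] [Primcodable δ]

@[fun_prop] theorem primrec_id : Primrec fun x : α => x := Primrec.id

@[fun_prop] theorem primrec_const (c : β) : Primrec fun _ : α => c := Primrec.const c

@[fun_prop] theorem primrec_comp {f : β → γ} {g : α → β} (hf : Primrec f) (hg : Primrec g) :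
    Primrec fun x => f (g x) := hf.comp hg

@[fun_prop] theorem primrec_pair {f : α → β} {g : α → γ} (hf : Primrec f) (hg : Primrec g) :
    Primrec fun x => (f x, g x) := hf.pair hg

@[fun_prop] theorem primrec_fst {f : α → β × γ} (hf : Primrec f) : Primrec fun x => (f x).1 :=
  Primrec.fst.comp hf

@[fun_prop] theorem primrec_snd {f : α → β × γ} (hf : Primrec f) : Primrec fun x => (f x).2 :=
  Primrec.snd.comp hf

@[fun_prop] theorem primrec_and {f g : α → Bool} (hf : Primrec f) (hg : Primrec g) :
    Primrec fun x => f x && g x := Primrec.and.comp hf hg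

@[fun_prop] theorem primrec_or {f g : α → Bool} (hf : Primrec f) (hg : Primrec g) :
    Primrec fun x => f x || g x := Primrec.or.comp hf hg

@[fun_prop] theorem primrec_not {f : α → Bool} (hf : Primrec f) : Primrec fun x => !f x :=
  Primrec.not.comp hf

@[fun_prop] theorem primrec_eq [DecidableEq β] {f g : α → β} (hf : Primrec f) (hg : Primrec g) :
    Primrec fun x => decide (f x = g x) :=
  (PrimrecRel.comp Primrec.eq hf hg).decide

@[fun_prop] theorem primrec_lt {f g : α → ℕ} (hf : Primrec f) (hg : Primrec g) :
    Primrec fun x => decide (f x < g x) :=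
  (PrimrecRel.comp Primrec.nat_lt hf hg).decide

@[fun_prop] theorem primrec_le {f g : α → ℕ} (hf : Primrec f) (hg : Primrec g) :
    Primrec fun x => decide (f x ≤ g x) :=
  (PrimrecRel.comp Primrec.nat_le hf hg).decide

@[fun_prop] theorem primrec_ite {c : α → Bool} {f g : α → β} (hc : Primrec c) (hf : Primrec f)
    (hg : Primrec g) : Primrec fun x => if c x then f x else g x :=
  Primrec.ite (PrimrecRel.comp Primrec.eq hc (Primrec.const true)) hf hg

@[fun_prop] theorem primrec_add {f g : α → ℕ} (hf : Primrec f) (hg : Primrec g) :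
    Primrec fun x => f x + g x := Primrec.nat_add.comp hf hg

@[fun_prop] theorem primrec_sub {f g : α → ℕ} (hf : Primrec f) (hg : Primrec g) :
    Primrec fun x => f x - g x := Primrec.nat_sub.comp hf hg

@[fun_prop] theorem primrec_mul {f g : α → ℕ} (hf : Primrec f) (hg : Primrec g) :
    Primrec fun x => f x * g x := Primrec.nat_mul.comp hf hg

@[fun_prop] theorem primrec_div {f g : α → ℕ} (hf : Primrec f) (hg : Primrec g) :
    Primrec fun x => f x / g x := Primrec.nat_div.comp hf hg

@[fun_prop] theorem primrec_mod {f g : α → ℕ} (hf : Primrec f) (hg : Primrec g) :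
    Primrec fun x => f x % g x := Primrec.nat_mod.comp hf hg

@[fun_prop] theorem primrec_pow {f g : α → ℕ} (hf : Primrec f) (hg : Primrec g) :
    Primrec fun x => f x ^ g x :=
  (Primrec₂.unpaired'.1 Nat.Primrec.pow : Primrec₂ fun a b : ℕ => a ^ b).comp hf hg

@[fun_prop] theorem primrec_unpair {f : α → ℕ} (hf : Primrec f) :
    Primrec fun x => Nat.unpair (f x) := Primrec.unpair.comp hf

@[fun_prop] theorem primrec_iterate {f : α → β → β} {n : α → ℕ} {g : α → β}
    (hf : Primrec fun x : α × β => f x.1 x.2) (hn : Primrec n) (hg : Primrec g) :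
    Primrec fun x => (f x)^[n x] (g x) := Primrec.nat_iterate hn hg hf

@[fun_prop] theorem primrec_range {f : α → ℕ} (hf : Primrec f) :
    Primrec fun x => List.range (f x) := Primrec.list_range.comp hf

@[fun_prop] theorem primrec_length {f : α → List β} (hf : Primrec f) :
    Primrec fun x => (f x).length := Primrec.list_length.comp hf

@[fun_prop] theorem primrec_cons {f : α → β} {g : α → List β} (hf : Primrec f)
    (hg : Primrec g) : Primrec fun x => f x :: g x := Primrec.list_cons.comp hf hg

@[fun_prop] theorem primrec_append {f g : α → List β} (hf : Primrec f) (hg : Primrec g) :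
    Primrec fun x => f x ++ g x := Primrec.list_append.comp hf hg

@[fun_prop] theorem primrec_getD {f : α → List β} {g : α → ℕ} {h : α → β} (hf : Primrec f)
    (hg : Primrec g) (hh : Primrec h) : Primrec fun x => (f x).getD (g x) (h x) := by
  simp only [List.getD_eq_getElem?_getD]
  exact Primrec.option_getD.comp (Primrec.list_getElem?.comp hf hg) hh

@[fun_prop] theorem primrec_map {f : α → List β} {g : α → β → γ} (hf : Primrec f)
    (hg : Primrec fun x : α × β => g x.1 x.2) : Primrec fun x => (f x).map (g x) :=
  Primrec.list_map hf hg

@[fun_prop] theorem primrec_flatMap {f : α → List β} {g : α → β → List γ} (hf : Primrec f)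
    (hg : Primrec fun x : α × β => g x.1 x.2) : Primrec fun x => (f x).flatMap (g x) :=
  Primrec.list_flatMap hf hg

@[fun_prop] theorem primrec_filter {f : α → List β} {g : α → β → Bool} (hf : Primrec f)
    (hg : Primrec fun x : α × β => g x.1 x.2) : Primrec fun x => (f x).filter (g x) := by
  have : Primrec fun x => (f x).filterMap fun y => if g x y then some y else none := by
    refine Primrec.listFilterMap hf ?_
    have h : Primrec fun x : α × β => if g x.1 x.2 then some x.2 else none :=
      primrec_ite hg (Primrec.option_some.comp Primrec.snd) (Primrec.const none)
    exact h
  refine this.of_eq fun x => ?_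
  rw [← List.filterMap_eq_filter]
  congr 1

@[fun_prop] theorem primrec_foldr {f : α → List β} {g : α → γ} {h : α → β → γ → γ}
    (hf : Primrec f) (hg : Primrec g) (hh : Primrec fun x : α × β × γ => h x.1 x.2.1 x.2.2) :
    Primrec fun x => (f x).foldr (h x) (g x) :=
  Primrec.list_foldr (h := fun x y => h x y.1 y.2) hf hg hh

@[fun_prop] theorem primrec_all {f : α → List β} {g : α → β → Bool} (hf : Primrec f)
    (hg : Primrec fun x : α × β => g x.1 x.2) : Primrec fun x => (f x).all (g x) := by
  have : Primrec fun x => (f x).foldr (fun y b => g x y && b) true := by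
    refine primrec_foldr hf (Primrec.const true) (Primrec.and.comp ?_ ?_)
    · exact hg.comp (Primrec.fst.pair (Primrec.fst.comp Primrec.snd))
    · exact Primrec.snd.comp Primrec.snd
  refine this.of_eq fun x => ?_
  induction f x with
  | nil => rfl
  | cons y l ih => rw [List.foldr_cons, ih, List.all_cons]

@[fun_prop] theorem primrec_any {f : α → List β} {g : α → β → Bool} (hf : Primrec f)
    (hg : Primrec fun x : α × β => g x.1 x.2) : Primrec fun x => (f x).any (g x) := by
  have : Primrec fun x => !(f x).all fun y => !g x y := by fun_prop
  refine this.of_eq fun x => ?_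
  rw [List.not_all_eq_any_not]
  simp

@[fun_prop] theorem primrec_headI [Inhabited β] {f : α → List β} (hf : Primrec f) :
    Primrec fun x => (f x).headI := Primrec.list_headI.comp hf

/-- All lists of length `n` with elements from `L`. -/
def seqs (L : List α) (n : ℕ) : List (List α) :=
  (fun M : List (List α) => M.flatMap fun w => L.map fun a => a :: w)^[n] [[]]

theorem mem_seqs {α : Type} {L : List α} {n : ℕ} {w : List α} :
    w ∈ seqs L n ↔ w.length = n ∧ ∀ a ∈ w, a ∈ L := by
  unfold seqs
  induction n generalizing w with
  | zero =>
    simp only [Function.iterate_zero, id_eq, List.mem_singleton, List.length_eq_zero_iff]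
    constructor
    · rintro rfl
      simp
    · exact fun h => h.1
  | succ n ih =>
    rw [Function.iterate_succ_apply']
    simp only [List.mem_flatMap, List.mem_map, ih]
    constructor
    · rintro ⟨u, ⟨rfl, h⟩, a, ha, rfl⟩
      exact ⟨rfl, by simpa using ⟨ha, h⟩⟩
    · rintro ⟨hl, h⟩
      obtain ⟨a, u, rfl⟩ := List.exists_cons_of_length_eq_add_one hl
      exact ⟨u, ⟨by simpa using hl, fun b hb => h b (List.mem_cons_of_mem _ hb)⟩, a,
        h a List.mem_cons_self, rfl⟩

@[fun_prop] theorem primrec_seqs {f : α → List β} {n : α → ℕ} (hf : Primrec f)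
    (hn : Primrec n) : Primrec fun x => seqs (f x) (n x) := by
  unfold seqs
  fun_prop

/-- All lists of length at most `n` with elements from `L`. -/
def seqsLE (L : List α) (n : ℕ) : List (List α) := (List.range (n + 1)).flatMap (seqs L)

theorem mem_seqsLE {α : Type} {L : List α} {n : ℕ} {w : List α} :
    w ∈ seqsLE L n ↔ w.length ≤ n ∧ ∀ a ∈ w, a ∈ L := by
  unfold seqsLE
  simp only [List.mem_flatMap, List.mem_range, mem_seqs]
  constructor
  · rintro ⟨m, hm, rfl, h⟩
    exact ⟨by omega, h⟩
  · exact fun h => ⟨_, by omega, rfl, h.2⟩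

@[fun_prop] theorem primrec_seqsLE {f : α → List β} {n : α → ℕ} (hf : Primrec f)
    (hn : Primrec n) : Primrec fun x => seqsLE (f x) (n x) := by
  unfold seqsLE
  fun_prop

/-- All pairs with components from the two lists. -/
def pairs (L : List α) (M : List β) : List (α × β) := L.flatMap fun a => M.map fun b => (a, b)

theorem mem_pairs {α β : Type} {L : List α} {M : List β} {x : α × β} :
    x ∈ pairs L M ↔ x.1 ∈ L ∧ x.2 ∈ M := by
  obtain ⟨a, b⟩ := x
  unfold pairs
  simp only [List.mem_flatMap, List.mem_map, Prod.mk.injEq]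
  constructor
  · rintro ⟨a, ha, b, hb, rfl, rfl⟩
    exact ⟨ha, hb⟩
  · exact fun h => ⟨a, h.1, b, h.2, rfl, rfl⟩

@[fun_prop] theorem primrec_pairs {f : α → List β} {g : α → List γ} (hf : Primrec f)
    (hg : Primrec g) : Primrec fun x => pairs (f x) (g x) := by
  unfold pairs
  fun_prop

end Primrec

end TreeInterp

namespace TreeInterp

open FirstOrder

/-! ### Operations on the raw data -/

namespace Raw

section Defs

/-- The parent of an edge. -/
def up (T : List (ℕ × ℕ)) (e : ℕ) : ℕ := (T.getD e (0, 0)).1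

/-- The label of an edge. -/
def lb (T : List (ℕ × ℕ)) (e : ℕ) : ℕ := (T.getD e (0, 0)).2

/-- The data describe an edge-labelled tree. -/
def isTree (s k : ℕ) (T : List (ℕ × ℕ)) : Bool :=
  (List.range T.length).all fun e => decide (up T e < T.length) && decide (lb T e < s) &&
    (List.range k).any fun j => decide (up T ((up T)^[j] e) = (up T)^[j] e)

/-- The list of values describes an embedding. -/
def isEmb (T T' : List (ℕ × ℕ)) (l : List ℕ) : Bool :=
  decide (l.length = T.length) && (List.range T.length).all fun e =>
    decide (l.getD e 0 < T'.length) && decide (l.getD (up T e) 0 = up T' (l.getD e 0)) &&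
      decide (lb T' (l.getD e 0) = lb T e) &&
      (List.range T.length).all fun e' => !decide (l.getD e 0 = l.getD e' 0) || decide (e = e')

/-- The label of a node of a pattern. -/
def label (p : PatternData) (x : ℕ) : List (ℕ × ℕ) := p.1.getD x []

/-- The parent of the node `z + 1` of a pattern. -/
def par (p : PatternData) (z : ℕ) : ℕ := (p.2.getD z (0, [])).1

/-- The inclusion of the label of the parent of the node `z + 1` of a pattern. -/
def incl (p : PatternData) (z : ℕ) : List ℕ := (p.2.getD z (0, [])).2

/-- The data describe a pattern. -/
def isPattern (s k : ℕ) (p : PatternData) : Bool :=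
  decide (p.1.length = p.2.length + 1) &&
    ((List.range p.1.length).all fun x => isTree s k (label p x)) &&
    decide ((label p 0).length = 0) &&
    (List.range p.2.length).all fun z => decide (par p z ≤ z) &&
      isEmb (label p (par p z)) (label p (z + 1)) (incl p z)

/-- The value of a term. -/
def term (T : List (ℕ × ℕ)) (v : List ℕ) (c : ℕ) : ℕ :=
  if c % 2 = 0 then v.getD (c / 2) 0 else up T (term T v (c / 2))
termination_by c
decreasing_by omega

/-- The truth value of a quantifier-free formula. -/
def formula (T : List (ℕ × ℕ)) (v : List ℕ) (c : ℕ) : Bool :=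
  if c = 0 then false
  else if (c - 1) % 4 = 0 then
    decide (term T v (Nat.unpair ((c - 1) / 4)).1 = term T v (Nat.unpair ((c - 1) / 4)).2)
  else if (c - 1) % 4 = 1 then
    decide (lb T (term T v (Nat.unpair ((c - 1) / 4)).2) = (Nat.unpair ((c - 1) / 4)).1)
  else if (c - 1) % 4 = 2 then
    !formula T v (Nat.unpair ((c - 1) / 4)).1 || formula T v (Nat.unpair ((c - 1) / 4)).2
  -- Only codes of universal quantifiers reach this case, and they do not occur in quantifier-free
  -- formulas.
  else false
termination_by c
decreasing_by
  · have := Nat.unpair_left_le ((c - 1) / 4)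
    omega
  · have := Nat.unpair_right_le ((c - 1) / 4)
    omega

/-- The dimension of a component of an interpretation. -/
def dim (d : InterpData) (i : ℕ) : ℕ := (d.1.getD i (0, 0)).1

/-- The data describe an output node on input `T`. -/
def isNode (d : InterpData) (T : List (ℕ × ℕ)) (q : ℕ × List ℕ) : Bool :=
  decide (q.1 < d.1.length) && decide (q.2.length = dim d q.1) &&
    (q.2.all fun e => decide (e < T.length)) && formula T q.2 (d.1.getD q.1 (0, 0)).2

/-- The list of the output nodes on input `T`. -/
def nodes (d : InterpData) (T : List (ℕ × ℕ)) : List (ℕ × List ℕ) :=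
  (List.range d.1.length).flatMap fun i =>
    ((seqs (List.range T.length) (dim d i)).map fun a => (i, a)).filter fun q => isNode d T q

/-- The parent-child relation of the output on input `T`. -/
def isParent (d : InterpData) (T : List (ℕ × ℕ)) (q q' : ℕ × List ℕ) : Bool :=
  formula T (q.2 ++ q'.2) ((d.2.getD q.1 []).getD q'.1 0)

/-- The image of an output node under an embedding. -/
def mapNode (l : List ℕ) (q : ℕ × List ℕ) : ℕ × List ℕ := (q.1, q.2.map fun e => l.getD e 0)

/-- The sum of the dimensions. -/
def totalDim (d : InterpData) : ℕ := d.1.foldr (fun x m => x.1 + m) 0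

/-- A node of a pattern with an output node on its label. -/
def nodeAt (c : List (ℕ × List ℕ)) (x : ℕ) : ℕ × List ℕ := c.getD x (0, [])

/-- The tuple generates the tree. -/
def generates (k : ℕ) (T : List (ℕ × ℕ)) (a : List ℕ) : Bool :=
  (List.range T.length).all fun e => (List.range k).any fun j => a.any fun b =>
    decide (e = (up T)^[j] b)

/-- All trees of size at most `m`. -/
def trees (s k m : ℕ) : List (List (ℕ × ℕ)) :=
  (seqsLE (pairs (List.range m) (List.range s)) m).filter fun T => isTree s k T

/-- All embeddings. -/
def embs (T T' : List (ℕ × ℕ)) : List (List ℕ) :=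
  (seqs (List.range T'.length) T.length).filter fun l => isEmb T T' l

/-- The output nodes `c` represent the output nodes of the interpretation on the trees of size at
most `m`. -/
def surj (s k m : ℕ) (d : InterpData) (p : PatternData) (c : List (ℕ × List ℕ)) : Bool :=
  (trees s k m).all fun T => (nodes d T).all fun y => (List.range p.1.length).any fun x =>
    (embs (label p x) T).any fun l => decide (mapNode l (nodeAt c x) = y)

/-- The output nodes `c` represent every output node at most once. -/
def inj (p : PatternData) (c : List (ℕ × List ℕ)) : Bool :=
  (List.range p.1.length).all fun x => (List.range p.1.length).all fun x' =>
    (embs (label p x) (label p x')).all fun l =>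
      !decide (mapNode l (nodeAt c x) = nodeAt c x') || decide (x = x')

/-- The output nodes `c` represent the output nodes of the interpretation on all inputs. -/
def represents (s k : ℕ) (d : InterpData) (p : PatternData) (c : List (ℕ × List ℕ)) : Bool :=
  decide (c.length = p.1.length) &&
    ((List.range p.1.length).all fun x => isNode d (label p x) (nodeAt c x) &&
      generates k (label p x) (nodeAt c x).2) &&
    ((List.range p.2.length).all fun z => isParent d (label p (z + 1))
      (mapNode (incl p z) (nodeAt c (par p z))) (nodeAt c (z + 1))) &&
    surj s k (k * totalDim d) d p c && inj p c &&
    (nodes d (label p 0)).all fun y => !isParent d (label p 0) y (nodeAt c 0)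

/-- A finite set of data that contains the pattern of the interpretation. -/
def candidates (m : ℕ) : List (PatternData × List (ℕ × List ℕ)) :=
  pairs
    (pairs (seqsLE (seqsLE (pairs (List.range m) (List.range m)) m) m)
      (seqsLE (pairs (List.range m) (seqsLE (List.range m) m)) m))
    (seqsLE (pairs (List.range m) (seqsLE (List.range m) m)) m)

/-- The pattern of an interpretation. -/
def toPattern (x : ℕ × ℕ × ℕ × InterpData) : PatternData :=
  -- The search bound exceeds every number in the data of the constructed pattern and its
  -- representatives. The default of `headI` is irrelevant for genuine interpretations, where the
  -- search succeeds.
  (((candidates (x.1 + x.2.2.2.1.length + totalDim x.2.2.2 +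
    QFInterp.sizeBound x.1 x.2.1 x.2.2.2.1.length (totalDim x.2.2.2) + 1)).filter fun c =>
      isPattern x.1 x.2.1 c.1 && represents x.1 x.2.1 x.2.2.2 c.1 c.2).map fun c => c.1).headI

/-- The data describe an isomorphism of patterns. -/
def isIso (p q : PatternData) (σ : List ℕ) (τ : List (List ℕ)) : Bool :=
  decide (σ.getD 0 0 = 0) &&
    ((List.range p.1.length).all fun x => ((List.range p.1.length).all fun x' =>
        !decide (σ.getD x 0 = σ.getD x' 0) || decide (x = x')) &&
      decide ((label p x).length = (label q (σ.getD x 0)).length) &&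
      isEmb (label p x) (label q (σ.getD x 0)) (τ.getD x [])) &&
    (List.range p.2.length).all fun z =>
      -- Data of a node other than the root are stored one index lower. As `σ` is injective and
      -- fixes 0, the subtraction does not truncate.
      decide (par q (σ.getD (z + 1) 0 - 1) = σ.getD (par p z) 0) &&
      (List.range (label p (par p z)).length).all fun e =>
        decide ((incl q (σ.getD (z + 1) 0 - 1)).getD ((τ.getD (par p z) []).getD e 0) 0 =
          (τ.getD (z + 1) []).getD ((incl p z).getD e 0) 0)

/-- An upper bound for the number of edges of every label. -/
def maxSize (p : PatternData) : ℕ := p.1.foldr (fun T m => T.length + m) 0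

/-- The decision procedure for isomorphism of patterns. -/
def decideIso (x : ℕ × ℕ × PatternData × PatternData) : Bool :=
  decide (x.2.2.1.1.length = x.2.2.2.1.length) &&
    (seqs (List.range x.2.2.1.1.length) x.2.2.1.1.length).any fun σ =>
      (seqs (seqsLE (List.range (maxSize x.2.2.1)) (maxSize x.2.2.1))
        x.2.2.1.1.length).any fun τ => isIso x.2.2.1 x.2.2.2 σ τ

end Defs

/-! ### Primitive recursiveness of the operations -/

section Primrec

variable {α : Type} [Primcodable α] {s k m e : α → ℕ} {T T' : α → List (ℕ × ℕ)}
  {l v : α → List ℕ} {p p' : α → PatternData} {d : α → InterpData} {q q' : α → ℕ × List ℕ}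
  {c : α → List (ℕ × List ℕ)}

@[fun_prop] theorem primrec_up (hT : Primrec T) (he : Primrec e) :
    Primrec fun x => up (T x) (e x) := by
  unfold up
  fun_prop

@[fun_prop] theorem primrec_lb (hT : Primrec T) (he : Primrec e) :
    Primrec fun x => lb (T x) (e x) := by
  unfold lb
  fun_prop

@[fun_prop] theorem primrec_isTree (hs : Primrec s) (hk : Primrec k) (hT : Primrec T) :
    Primrec fun x => isTree (s x) (k x) (T x) := by
  unfold isTree
  fun_prop

@[fun_prop] theorem primrec_isEmb (hT : Primrec T) (hT' : Primrec T') (hl : Primrec l) :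
    Primrec fun x => isEmb (T x) (T' x) (l x) := by
  unfold isEmb
  fun_prop

@[fun_prop] theorem primrec_label (hp : Primrec p) (he : Primrec e) :
    Primrec fun x => label (p x) (e x) := by
  unfold label
  fun_prop

@[fun_prop] theorem primrec_par (hp : Primrec p) (he : Primrec e) :
    Primrec fun x => par (p x) (e x) := by
  unfold par
  fun_prop

@[fun_prop] theorem primrec_incl (hp : Primrec p) (he : Primrec e) :
    Primrec fun x => incl (p x) (e x) := by
  unfold incl
  fun_prop

@[fun_prop] theorem primrec_isPattern (hs : Primrec s) (hk : Primrec k) (hp : Primrec p) :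
    Primrec fun x => isPattern (s x) (k x) (p x) := by
  unfold isPattern
  fun_prop

@[fun_prop] theorem primrec_term (hT : Primrec T) (hv : Primrec v) (he : Primrec e) :
    Primrec fun x => term (T x) (v x) (e x) := by
  have h : Primrec₂ fun (x : List (ℕ × ℕ) × List ℕ) c => term x.1 x.2 c := by
    -- Course-of-values recursion: `L` lists the values at smaller codes, so `L.length` is the
    -- current code.
    refine Primrec.nat_strong_rec _
      (g := fun x L => some (if decide (L.length % 2 = 0) then x.2.getD (L.length / 2) 0
        else up x.1 (L.getD (L.length / 2) 0))) ?_ fun x c => ?_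
    · refine Primrec.option_some.comp ?_
      fun_prop
    · rw [term]
      simp only [List.length_map, List.length_range, decide_eq_true_eq]
      split_ifs with h
      · rfl
      · have : c / 2 < c := by omega
        simp [List.getD_eq_getElem?_getD, this]
  exact h.comp (hT.pair hv) he

@[fun_prop] theorem primrec_formula (hT : Primrec T) (hv : Primrec v) (he : Primrec e) :
    Primrec fun x => formula (T x) (v x) (e x) := by
  have h : Primrec₂ fun (x : List (ℕ × ℕ) × List ℕ) c => formula x.1 x.2 c := by
    refine Primrec.nat_strong_rec _
      (g := fun x L => some (if decide (L.length = 0) then false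
        else if decide ((L.length - 1) % 4 = 0) then
          decide (term x.1 x.2 (Nat.unpair ((L.length - 1) / 4)).1 =
            term x.1 x.2 (Nat.unpair ((L.length - 1) / 4)).2)
        else if decide ((L.length - 1) % 4 = 1) then
          decide (lb x.1 (term x.1 x.2 (Nat.unpair ((L.length - 1) / 4)).2) =
            (Nat.unpair ((L.length - 1) / 4)).1)
        else if decide ((L.length - 1) % 4 = 2) then
          !L.getD (Nat.unpair ((L.length - 1) / 4)).1 false ||
            L.getD (Nat.unpair ((L.length - 1) / 4)).2 false
        else false)) ?_ fun x c => ?_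
    · refine Primrec.option_some.comp ?_
      fun_prop
    · rw [formula]
      simp only [List.length_map, List.length_range, decide_eq_true_eq]
      split_ifs with h h1 h2 h3
      · rfl
      · rfl
      · rfl
      · have h4 := Nat.unpair_left_le ((c - 1) / 4)
        have h5 := Nat.unpair_right_le ((c - 1) / 4)
        have h6 : (Nat.unpair ((c - 1) / 4)).1 < c := by omega
        have h7 : (Nat.unpair ((c - 1) / 4)).2 < c := by omega
        simp [List.getD_eq_getElem?_getD, h6, h7]
      · rfl
  exact h.comp (hT.pair hv) he

@[fun_prop] theorem primrec_dim (hd : Primrec d) (he : Primrec e) :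
    Primrec fun x => dim (d x) (e x) := by
  unfold dim
  fun_prop

@[fun_prop] theorem primrec_isNode (hd : Primrec d) (hT : Primrec T) (hq : Primrec q) :
    Primrec fun x => isNode (d x) (T x) (q x) := by
  unfold isNode
  fun_prop

@[fun_prop] theorem primrec_nodes (hd : Primrec d) (hT : Primrec T) :
    Primrec fun x => nodes (d x) (T x) := by
  unfold nodes
  fun_prop

@[fun_prop] theorem primrec_isParent (hd : Primrec d) (hT : Primrec T) (hq : Primrec q)
    (hq' : Primrec q') : Primrec fun x => isParent (d x) (T x) (q x) (q' x) := by
  unfold isParent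
  fun_prop

@[fun_prop] theorem primrec_mapNode (hl : Primrec l) (hq : Primrec q) :
    Primrec fun x => mapNode (l x) (q x) := by
  unfold mapNode
  fun_prop

@[fun_prop] theorem primrec_totalDim (hd : Primrec d) : Primrec fun x => totalDim (d x) := by
  unfold totalDim
  fun_prop

@[fun_prop] theorem primrec_nodeAt (hc : Primrec c) (he : Primrec e) :
    Primrec fun x => nodeAt (c x) (e x) := by
  unfold nodeAt
  fun_prop

@[fun_prop] theorem primrec_generates (hk : Primrec k) (hT : Primrec T) (hl : Primrec l) :
    Primrec fun x => generates (k x) (T x) (l x) := by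
  unfold generates
  fun_prop

@[fun_prop] theorem primrec_trees (hs : Primrec s) (hk : Primrec k) (hm : Primrec m) :
    Primrec fun x => trees (s x) (k x) (m x) := by
  unfold trees
  fun_prop

@[fun_prop] theorem primrec_embs (hT : Primrec T) (hT' : Primrec T') :
    Primrec fun x => embs (T x) (T' x) := by
  unfold embs
  fun_prop

@[fun_prop] theorem primrec_surj (hs : Primrec s) (hk : Primrec k) (hm : Primrec m)
    (hd : Primrec d) (hp : Primrec p) (hc : Primrec c) :
    Primrec fun x => surj (s x) (k x) (m x) (d x) (p x) (c x) := by
  unfold surj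
  fun_prop

@[fun_prop] theorem primrec_inj (hp : Primrec p) (hc : Primrec c) :
    Primrec fun x => inj (p x) (c x) := by
  unfold inj
  fun_prop

@[fun_prop] theorem primrec_represents (hs : Primrec s) (hk : Primrec k) (hd : Primrec d)
    (hp : Primrec p) (hc : Primrec c) :
    Primrec fun x => represents (s x) (k x) (d x) (p x) (c x) := by
  unfold represents
  fun_prop

@[fun_prop] theorem primrec_candidates (hm : Primrec m) :
    Primrec fun x => candidates (m x) := by
  unfold candidates
  fun_prop

@[fun_prop] theorem primrec_toPattern : Primrec toPattern := by
  unfold toPattern QFInterp.sizeBound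
  fun_prop

@[fun_prop] theorem primrec_isIso {σ : α → List ℕ} {τ : α → List (List ℕ)} (hp : Primrec p)
    (hp' : Primrec p') (hσ : Primrec σ) (hτ : Primrec τ) :
    Primrec fun x => isIso (p x) (p' x) (σ x) (τ x) := by
  unfold isIso
  fun_prop

@[fun_prop] theorem primrec_maxSize (hp : Primrec p) : Primrec fun x => maxSize (p x) := by
  unfold maxSize
  fun_prop

@[fun_prop] theorem primrec_decideIso : Primrec decideIso := by
  unfold decideIso
  fun_prop

end Primrec

end Raw

end TreeInterp

namespace TreeInterp

open FirstOrder

theorem getD_ofFn {α : Type} {n : ℕ} (f : Fin n → α) (i : Fin n) (d : α) :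
    (List.ofFn f).getD i d = f i := by
  simp [List.getD_eq_getElem?_getD]

theorem eq_ofFn {α : Type} {n : ℕ} {l : List α} (d : α) (hl : l.length = n) (f : Fin n → α)
    (h : ∀ i : Fin n, l.getD i d = f i) : l = List.ofFn f := by
  subst hl
  refine List.ext_getElem (by simp) fun i h1 h2 => ?_
  have := h ⟨i, h1⟩
  simpa [List.getD_eq_getElem?_getD, h1] using this

/-! ### Raw data of trees -/

namespace EdgeTree

variable {s k : ℕ} {t t' : EdgeTree s k}

/-- The number of an edge. -/
def Edge.idx (e : t.Edge) : ℕ := Fin.val (n := t.size) e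

theorem idx_lt (e : t.Edge) : e.idx < t.size := Fin.isLt (n := t.size) e

theorem idx_injective : Function.Injective (Edge.idx : t.Edge → ℕ) := Fin.val_injective (n := t.size)

theorem exists_idx {i : ℕ} (h : i < t.size) : ∃ e : t.Edge, e.idx = i :=
  ⟨(⟨i, h⟩ : Fin t.size), rfl⟩

theorem length_data : t.data.length = t.size := by
  unfold data
  simp

/-- The list of the values of an embedding. -/
def embData (f : t.Edge ↪[edgeLang s] t'.Edge) : List ℕ :=
  List.ofFn fun e : Fin t.size => (f e).idx

theorem length_embData (f : t.Edge ↪[edgeLang s] t'.Edge) : (embData f).length = t.size := by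
  unfold embData
  simp

theorem getD_embData (f : t.Edge ↪[edgeLang s] t'.Edge) (e : t.Edge) :
    (embData f).getD e.idx 0 = (f e).idx :=
  getD_ofFn (fun e : Fin t.size => (f e).idx) e 0

end EdgeTree

namespace Raw

open EdgeTree

section Trees

variable {s k : ℕ} {t t' : EdgeTree s k}

theorem up_data (e : t.Edge) : up t.data e.idx = (t.up e).idx := by
  exact congrArg Prod.fst (getD_ofFn (n := t.size) (fun e => ((t.par e : ℕ), (t.lab e : ℕ))) e _)

theorem lb_data (e : t.Edge) : lb t.data e.idx = t.lb e := by
  exact congrArg Prod.snd (getD_ofFn (n := t.size) (fun e => ((t.par e : ℕ), (t.lab e : ℕ))) e _)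

theorem iterate_up_data (j : ℕ) (e : t.Edge) : (up t.data)^[j] e.idx = (t.up^[j] e).idx := by
  induction j generalizing e with
  | zero => rfl
  | succ j ih => rw [Function.iterate_succ_apply, Function.iterate_succ_apply, up_data, ih]

theorem isTree_iff {T : List (ℕ × ℕ)} :
    isTree s k T = true ↔ ∃ t : EdgeTree s k, t.data = T := by
  constructor
  · intro h
    simp only [isTree, List.all_eq_true, List.mem_range, Bool.and_eq_true, decide_eq_true_eq,
      List.any_eq_true] at h
    let par : Fin T.length → Fin T.length := fun e => ⟨up T e, (h e e.2).1.1⟩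
    have hiter : ∀ j (e : Fin T.length), ((par^[j] e : Fin _) : ℕ) = (up T)^[j] e := by
      intro j
      induction j with
      | zero => exact fun _ => rfl
      | succ j ih =>
        intro e
        rw [Function.iterate_succ_apply, Function.iterate_succ_apply, ih]
    refine ⟨⟨T.length, par, fun e => ⟨lb T e, (h e e.2).1.2⟩, fun e => ?_⟩, ?_⟩
    · obtain ⟨j, hj, h1⟩ := (h e e.2).2
      refine ⟨j, hj, Fin.ext ?_⟩
      change up T ((par^[j] e : Fin _) : ℕ) = ((par^[j] e : Fin _) : ℕ)
      rw [hiter]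
      exact h1
    · exact (eq_ofFn (0, 0) rfl _ fun i => rfl).symm
  · rintro ⟨t, rfl⟩
    simp only [isTree, List.all_eq_true, List.mem_range, Bool.and_eq_true, decide_eq_true_eq,
      List.any_eq_true]
    intro i hi
    rw [length_data] at hi ⊢
    obtain ⟨e, rfl⟩ := exists_idx hi
    rw [up_data, lb_data]
    obtain ⟨j, hj, h⟩ := t.exists_loop e
    refine ⟨⟨idx_lt _, Fin.isLt _⟩, j, hj, ?_⟩
    rw [iterate_up_data, up_data, h]

theorem isEmb_iff {l : List ℕ} : isEmb t.data t'.data l = true ↔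
    ∃ f : t.Edge ↪[edgeLang s] t'.Edge, embData f = l := by
  simp only [isEmb, List.all_eq_true, List.mem_range, Bool.and_eq_true, decide_eq_true_eq,
    Bool.or_eq_true, Bool.not_eq_true', decide_eq_false_iff_not, length_data]
  constructor
  · rintro ⟨hl, h⟩
    choose f hf using fun e : t.Edge => exists_idx (h _ (idx_lt e)).1.1.1
    refine ⟨mkEmb f (fun e e' he => ?_) (fun e => ?_) (fun a e => ?_), ?_⟩
    · have h1 := (h _ (idx_lt e)).2 _ (idx_lt e')
      rw [← hf, ← hf, he] at h1
      exact idx_injective (h1.resolve_left (by simp))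
    · have h1 := (h _ (idx_lt e)).1.1.2
      rw [up_data, ← hf, ← hf, up_data] at h1
      exact idx_injective h1
    · have h1 := (h _ (idx_lt e)).1.2
      rw [← hf, lb_data, lb_data] at h1
      rw [hasLabel_iff, hasLabel_iff, Fin.ext h1]
    · exact (eq_ofFn 0 hl _ fun e => (hf e).symm).symm
  · rintro ⟨f, rfl⟩
    refine ⟨length_embData f, fun i hi => ?_⟩
    obtain ⟨e, rfl⟩ := exists_idx hi
    rw [up_data, getD_embData, getD_embData, up_data, lb_data, lb_data, map_up, map_lb]
    refine ⟨⟨⟨idx_lt _, rfl⟩, rfl⟩, fun i hi => ?_⟩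
    obtain ⟨e', rfl⟩ := exists_idx hi
    rw [getD_embData]
    by_cases h : e = e'
    · exact Or.inr (by rw [h])
    · exact Or.inl fun h1 => h (f.injective (idx_injective h1))

theorem mem_embs {l : List ℕ} : l ∈ embs t.data t'.data ↔
    ∃ f : t.Edge ↪[edgeLang s] t'.Edge, embData f = l := by
  unfold embs
  rw [List.mem_filter, isEmb_iff]
  refine ⟨fun h => h.2, ?_⟩
  rintro ⟨f, rfl⟩
  refine ⟨mem_seqs.2 ⟨by rw [length_embData, length_data], fun a ha => ?_⟩, f, rfl⟩
  obtain ⟨e, rfl⟩ := List.mem_ofFn.1 ha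
  rw [List.mem_range, length_data]
  exact idx_lt _

theorem mem_trees {m : ℕ} {T : List (ℕ × ℕ)} : T ∈ trees s k m ↔
    ∃ t : EdgeTree s k, t.size ≤ m ∧ t.data = T := by
  unfold trees
  rw [List.mem_filter, isTree_iff]
  constructor
  · rintro ⟨h1, t, rfl⟩
    rw [mem_seqsLE, length_data] at h1
    exact ⟨t, h1.1, rfl⟩
  · rintro ⟨t, h, rfl⟩
    refine ⟨mem_seqsLE.2 ⟨by rwa [length_data], fun x hx => ?_⟩, t, rfl⟩
    obtain ⟨e, rfl⟩ := List.mem_ofFn.1 hx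
    rw [mem_pairs, List.mem_range, List.mem_range]
    exact ⟨(t.par e).2.trans_le h, (t.lab e).2⟩

end Trees

/-! ### Raw data of patterns -/

section Patterns

variable {s k : ℕ} (Φ : Pattern s k)

theorem length_data_fst : Φ.data.1.length = Φ.last + 1 := by
  simp [Pattern.data]

theorem length_data_snd : Φ.data.2.length = Φ.last := by
  simp [Pattern.data]

theorem label_data (x : Fin (Φ.last + 1)) : label Φ.data x = (Φ.label x).data :=
  getD_ofFn (fun x => (Φ.label x).data) x []

theorem label_data_zero : label Φ.data 0 = (Φ.label 0).data := label_data Φ 0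

theorem label_data_succ (z : Fin Φ.last) : label Φ.data (z + 1) = (Φ.label z.succ).data :=
  label_data Φ z.succ

theorem par_data (z : Fin Φ.last) : par Φ.data z = Φ.par z := by
  unfold par Pattern.data
  rw [getD_ofFn]

theorem incl_data (z : Fin Φ.last) : incl Φ.data z = embData (Φ.incl z) := by
  unfold incl Pattern.data
  rw [getD_ofFn]
  rfl

theorem isPattern_iff {p : PatternData} :
    isPattern s k p = true ↔ ∃ Φ : Pattern s k, Φ.data = p := by
  simp only [isPattern, List.all_eq_true, List.mem_range, Bool.and_eq_true, decide_eq_true_eq,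
    isTree_iff]
  constructor
  · rintro ⟨⟨⟨h1, h2⟩, h3⟩, h4⟩
    rw [h1] at h2
    choose t ht using fun x : Fin (p.2.length + 1) => h2 x x.2
    have hpar : ∀ z : Fin p.2.length, par p z < p.2.length + 1 := fun z => by
      have := (h4 z z.2).1
      omega
    have hemb : ∀ z : Fin p.2.length, ∃ f : (t ⟨par p z, hpar z⟩).Edge ↪[edgeLang s]
        (t z.succ).Edge, embData f = incl p z := by
      intro z
      rw [← isEmb_iff, ht, ht]
      exact (h4 z z.2).2
    choose f hf using hemb
    refine ⟨⟨p.2.length, fun z => ⟨par p z, hpar z⟩, fun z => ?_, t, ?_, f⟩, ?_⟩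
    · exact Nat.lt_succ_of_le (h4 z z.2).1
    · rw [← length_data, ht]
      exact h3
    · refine Prod.ext ?_ ?_
      · exact (eq_ofFn [] h1 _ fun x => (ht x).symm).symm
      · exact (eq_ofFn (0, []) rfl (fun z => (par p z, embData (f z))) fun z =>
          Prod.ext rfl (hf z).symm).symm
  · rintro ⟨Φ, rfl⟩
    rw [length_data_fst, length_data_snd, label_data_zero, length_data]
    refine ⟨⟨⟨rfl, fun x hx => ⟨_, (label_data Φ ⟨x, hx⟩).symm⟩⟩, Φ.label_root⟩, fun i hi => ?_⟩
    obtain ⟨z, rfl⟩ : ∃ z : Fin Φ.last, z.1 = i := ⟨⟨i, hi⟩, rfl⟩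
    rw [par_data, label_data, label_data_succ, incl_data, isEmb_iff]
    exact ⟨Nat.le_of_lt_succ (Φ.par_lt z), _, rfl⟩

end Patterns

/-! ### Raw data of interpretations -/

section Interp

variable {s k : ℕ} (F : QFInterp s) {t t' : EdgeTree s k}

theorem term_termCode {d : ℕ} (a : Fin d → t.Edge) (u : (edgeLang s).Term (Fin d ⊕ Fin 0)) :
    term t.data (List.ofFn fun l => (a l).idx) (termCode varCode u) =
      (u.realize (Sum.elim a (default : Fin 0 → t.Edge))).idx := by
  induction u with
  | var x =>
    rcases x with x | x
    · rw [term, if_pos (by simp [termCode])]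
      have : termCode (s := s) varCode (Language.Term.var (Sum.inl x : Fin d ⊕ Fin 0)) / 2 = x := by
        simp [termCode, varCode]
      rw [this, getD_ofFn]
      rfl
    · exact x.elim0
  | func f ts ih =>
    cases f
    have h1 : termCode (s := s) (α := Fin d ⊕ Fin 0) varCode
        (Language.Term.func EdgeFunc.parent ts) = 2 * termCode varCode (ts 0) + 1 := rfl
    rw [h1, term, if_neg (by omega),
      show (2 * termCode varCode (ts 0) + 1) / 2 = termCode varCode (ts 0) by omega, ih, up_data,
      Language.Term.realize_func, funMap_parent]
    rfl

theorem formula_formulaCode {d : ℕ} (a : Fin d → t.Edge) {φ : (edgeLang s).Formula (Fin d)}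
    (h : Language.BoundedFormula.IsQF φ) :
    formula t.data (List.ofFn fun l => (a l).idx) (formulaCode φ) = true ↔ φ.Realize a := by
  unfold Language.Formula.Realize
  have key : ∀ m r : ℕ, r < 4 → (4 * m + (r + 1) ≠ 0 ∧ (4 * m + (r + 1) - 1) % 4 = r ∧
      (4 * m + (r + 1) - 1) / 4 = m) := fun m r hr => by omega
  induction h with
  | falsum =>
    change formula _ _ 0 = true ↔ False
    rw [formula]
    simp
  | of_isAtomic h =>
    cases h with
    | equal t₁ t₂ =>
      change formula _ _ (4 * Nat.pair (termCode varCode t₁) (termCode varCode t₂) + (0 + 1)) = true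
        ↔ _
      obtain ⟨h1, h2, h3⟩ := key (Nat.pair (termCode varCode t₁) (termCode varCode t₂)) 0 (by omega)
      rw [formula, h2, h3, if_neg h1, if_pos rfl, Nat.unpair_pair, term_termCode, term_termCode,
        decide_eq_true_eq, idx_injective.eq_iff, Language.BoundedFormula.realize_bdEqual]
    | rel R ts =>
      cases R with
      | hasLabel b =>
        change formula _ _ (4 * Nat.pair b.val (termCode varCode (ts 0)) + (1 + 1)) = true ↔ _
        obtain ⟨h1, h2, h3⟩ := key (Nat.pair b.val (termCode varCode (ts 0))) 1 (by omega)
        rw [formula, h2, h3, if_neg h1, if_neg (by omega), if_pos rfl, Nat.unpair_pair,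
          term_termCode, lb_data, decide_eq_true_eq, Language.BoundedFormula.realize_rel,
          relMap_hasLabel, hasLabel_iff, Fin.ext_iff]
  | @imp φ ψ _ _ ih₁ ih₂ =>
    change formula _ _ (4 * Nat.pair (formulaCode φ) (formulaCode ψ) + (2 + 1)) = true ↔ _
    obtain ⟨h1, h2, h3⟩ := key (Nat.pair (formulaCode φ) (formulaCode ψ)) 2 (by omega)
    rw [formula, h2, h3, if_neg h1, if_neg (by omega), if_neg (by omega), if_pos rfl,
      Nat.unpair_pair, Language.BoundedFormula.realize_imp]
    refine Iff.trans ?_ (imp_congr ih₁ ih₂)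
    dsimp only
    cases formula t.data (List.ofFn fun l => (a l).idx) (formulaCode φ) <;> simp

/-- The data of an output node. -/
def nodeData (p : F.Node t.Edge) : ℕ × List ℕ := (p.1.1, List.ofFn fun l => (p.1.2 l).idx)

variable {F}

theorem nodeData_injective : Function.Injective (nodeData F : F.Node t.Edge → _) := by
  rintro ⟨⟨i, a⟩, ha⟩ ⟨⟨j, b⟩, hb⟩ h
  obtain ⟨h1, h2⟩ := Prod.mk.inj h
  obtain rfl := Fin.ext h1
  have h3 := List.ofFn_injective h2
  have : a = b := funext fun l => idx_injective (congrFun h3 l)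
  subst this
  rfl

variable (F) in
theorem length_data : F.data.1.length = F.comps := by
  simp [QFInterp.data]

theorem dim_data (i : Fin F.comps) : dim F.data i = F.dim i := by
  unfold dim QFInterp.data
  rw [getD_ofFn]

theorem totalDim_data : totalDim F.data = F.totalDim := by
  have : ∀ l : List (ℕ × ℕ), l.foldr (fun x m => x.1 + m) 0 = (l.map Prod.fst).sum := by
    intro l
    induction l with
    | nil => rfl
    | cons x l ih => simp [ih]
  unfold totalDim QFInterp.totalDim
  rw [this]
  simp [QFInterp.data, List.map_ofFn, List.sum_ofFn]

theorem isNode_iff {q : ℕ × List ℕ} : isNode F.data t.data q = true ↔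
    ∃ p : F.Node t.Edge, nodeData F p = q := by
  have hu : ∀ i : Fin F.comps, (F.data.1.getD i (0, 0)).2 = formulaCode (F.univ i) := fun i => by
    unfold QFInterp.data
    rw [getD_ofFn]
  simp only [isNode, List.all_eq_true, Bool.and_eq_true, decide_eq_true_eq, EdgeTree.length_data,
    length_data]
  constructor
  · obtain ⟨i, l⟩ := q
    rintro ⟨⟨⟨h1, h2⟩, h3⟩, h4⟩
    dsimp only at h1 h2 h3 h4
    obtain ⟨i, rfl⟩ : ∃ i' : Fin F.comps, i'.1 = i := ⟨⟨i, h1⟩, rfl⟩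
    rw [dim_data] at h2
    have h5 : ∀ x : Fin (F.dim i), l.getD x 0 < t.size := fun x => by
      have hx : x.1 < l.length := h2.symm ▸ x.2
      rw [List.getD_eq_getElem _ _ hx]
      exact h3 _ (List.getElem_mem hx)
    choose a ha using fun x => exists_idx (h5 x)
    have hl : l = List.ofFn fun x => (a x).idx := eq_ofFn 0 h2 _ fun x => (ha x).symm
    rw [hu, hl, formula_formulaCode a (F.univ_isQF i)] at h4
    exact ⟨⟨⟨i, a⟩, h4⟩, Prod.ext rfl hl.symm⟩
  · rintro ⟨⟨⟨i, a⟩, ha⟩, rfl⟩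
    refine ⟨⟨⟨i.2, ?_⟩, ?_⟩, ?_⟩
    · change (List.ofFn _).length = dim F.data i
      rw [dim_data, List.length_ofFn]
    · intro x hx
      obtain ⟨l, rfl⟩ := List.mem_ofFn.1 hx
      exact idx_lt _
    · change formula t.data (List.ofFn fun l => (a l).idx) (F.data.1.getD i (0, 0)).2 = true
      rw [hu, formula_formulaCode a (F.univ_isQF i)]
      exact ha

theorem mem_nodes {q : ℕ × List ℕ} : q ∈ nodes F.data t.data ↔
    ∃ p : F.Node t.Edge, nodeData F p = q := by
  simp only [nodes, List.mem_flatMap, List.mem_filter, List.mem_map, List.mem_range, mem_seqs,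
    isNode_iff]
  constructor
  · rintro ⟨_, _, _, h⟩
    exact h
  · rintro ⟨p, rfl⟩
    refine ⟨p.1.1, ?_, ⟨_, ⟨?_, ?_⟩, rfl⟩, p, rfl⟩
    · rw [length_data]
      exact p.1.1.2
    · rw [dim_data, List.length_ofFn]
    · intro x hx
      obtain ⟨l, rfl⟩ := List.mem_ofFn.1 hx
      rw [EdgeTree.length_data]
      exact idx_lt _

theorem isParent_iff {p q : F.Node t.Edge} :
    isParent F.data t.data (nodeData F p) (nodeData F q) = true ↔ F.Parent t.Edge p q := by
  unfold isParent QFInterp.Parent nodeData QFInterp.data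
  dsimp only
  rw [getD_ofFn, getD_ofFn, ← formula_formulaCode _ (F.par_isQF _ _), ← List.ofFn_fin_append]
  have : (Fin.append (fun l => (p.1.2 l).idx) fun l => (q.1.2 l).idx) =
      fun l => (Fin.append p.1.2 q.1.2 l).idx := by
    funext l
    induction l using Fin.addCases <;> simp
  rw [this]

theorem mapNode_embData (f : t.Edge ↪[edgeLang s] t'.Edge) (p : F.Node t.Edge) :
    mapNode (embData f) (nodeData F p) = nodeData F (F.map f p) := by
  refine Prod.ext rfl ?_
  change (List.ofFn fun l => (p.1.2 l).idx).map _ = List.ofFn fun l => (f (p.1.2 l)).idx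
  rw [List.map_ofFn]
  congr 1
  funext l
  exact getD_embData f _

end Interp

end Raw

end TreeInterp

namespace TreeInterp

open FirstOrder

namespace Raw

open EdgeTree

theorem all_range_iff {n : ℕ} {P : ℕ → Bool} :
    (List.range n).all P = true ↔ ∀ x : Fin n, P x = true := by
  simp [Fin.forall_iff]

theorem any_range_iff {n : ℕ} {P : ℕ → Bool} :
    (List.range n).any P = true ↔ ∃ x : Fin n, P x = true := by
  simp [Fin.exists_iff]

theorem all_trees_iff {s k m : ℕ} {P : List (ℕ × ℕ) → Bool} : (trees s k m).all P = true ↔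
    ∀ t : EdgeTree s k, t.size ≤ m → P t.data = true := by
  simp only [List.all_eq_true, mem_trees, forall_exists_index, and_imp]
  exact ⟨fun h t ht => h _ t ht rfl, fun h _ t ht ht' => ht' ▸ h t ht⟩

theorem all_embs_iff {s k : ℕ} {t t' : EdgeTree s k} {P : List ℕ → Bool} :
    (embs t.data t'.data).all P = true ↔
      ∀ f : t.Edge ↪[edgeLang s] t'.Edge, P (embData f) = true := by
  simp only [List.all_eq_true, mem_embs, forall_exists_index, forall_apply_eq_imp_iff]

theorem any_embs_iff {s k : ℕ} {t t' : EdgeTree s k} {P : List ℕ → Bool} :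
    (embs t.data t'.data).any P = true ↔
      ∃ f : t.Edge ↪[edgeLang s] t'.Edge, P (embData f) = true := by
  simp only [List.any_eq_true, mem_embs, exists_exists_eq_and]

theorem all_nodes_iff {s k : ℕ} {F : QFInterp s} {t : EdgeTree s k} {P : ℕ × List ℕ → Bool} :
    (nodes F.data t.data).all P = true ↔ ∀ y : F.Node t.Edge, P (nodeData F y) = true := by
  simp only [List.all_eq_true, mem_nodes, forall_exists_index, forall_apply_eq_imp_iff]

/-! ### Correctness of the conversion of interpretations to patterns -/

section ToPattern

variable {s k n : ℕ} {F : QFInterp s} {Φ : Pattern s k}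

theorem generates_iff {t : EdgeTree s k} {d : ℕ} {a : Fin d → t.Edge} :
    generates k t.data (List.ofFn fun l => (a l).idx) = true ↔ Generates (s := s) a := by
  simp only [generates, List.all_eq_true, List.mem_range, List.any_eq_true, decide_eq_true_eq,
    EdgeTree.length_data]
  constructor
  · intro h e
    obtain ⟨j, -, b, hb, h1⟩ := h _ (idx_lt e)
    obtain ⟨l, rfl⟩ := List.mem_ofFn.1 hb
    rw [iterate_up_data] at h1
    exact ⟨j, l, idx_injective h1⟩
  · intro h i hi
    obtain ⟨e, rfl⟩ := exists_idx hi
    obtain ⟨j, l, rfl⟩ := h e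
    obtain ⟨i, hi, h1⟩ := t.exists_lt_iterate_eq j (a l)
    refine ⟨i, hi, _, List.mem_ofFn.2 ⟨l, rfl⟩, ?_⟩
    rw [iterate_up_data, h1]
    rfl

/-- The data of a family of output nodes. -/
def nodesData (p : ∀ x, F.Node (Φ.label x).Edge) : List (ℕ × List ℕ) :=
  List.ofFn fun x => nodeData F (p x)

theorem length_nodesData (p : ∀ x, F.Node (Φ.label x).Edge) :
    (nodesData p).length = Φ.last + 1 := by
  simp [nodesData]

theorem nodeAt_nodesData (p : ∀ x, F.Node (Φ.label x).Edge) (x : Fin (Φ.last + 1)) :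
    nodeAt (nodesData p) x = nodeData F (p x) :=
  getD_ofFn (fun x => nodeData F (p x)) x _

theorem nodeAt_nodesData_zero (p : ∀ x, F.Node (Φ.label x).Edge) :
    nodeAt (nodesData p) 0 = nodeData F (p 0) := nodeAt_nodesData p 0

theorem nodeAt_nodesData_succ (p : ∀ x, F.Node (Φ.label x).Edge) (z : Fin Φ.last) :
    nodeAt (nodesData p) (z + 1) = nodeData F (p z.succ) := nodeAt_nodesData p z.succ

theorem isNode_nodeData {t : EdgeTree s k} (p : F.Node t.Edge) :
    isNode F.data t.data (nodeData F p) = true := isNode_iff.2 ⟨p, rfl⟩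

theorem generates_nodeData {t : EdgeTree s k} (p : F.Node t.Edge) :
    generates k t.data (nodeData F p).2 = true ↔ Generates (s := s) p.1.2 := generates_iff

theorem surj_iff {m : ℕ} {p : ∀ x, F.Node (Φ.label x).Edge} :
    surj s k m F.data Φ.data (nodesData p) = true ↔ ∀ t : EdgeTree s k, t.size ≤ m →
      ∀ y : F.Node t.Edge, ∃ x, ∃ α : (Φ.label x).Edge ↪[edgeLang s] t.Edge,
        F.map α (p x) = y := by
  simp only [surj, all_trees_iff, all_nodes_iff, length_data_fst, any_range_iff, label_data,
    any_embs_iff, nodeAt_nodesData, mapNode_embData, decide_eq_true_eq, nodeData_injective.eq_iff]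

theorem inj_iff {p : ∀ x, F.Node (Φ.label x).Edge} :
    inj Φ.data (nodesData p) = true ↔ ∀ x x',
      ∀ β : (Φ.label x).Edge ↪[edgeLang s] (Φ.label x').Edge, F.map β (p x) = p x' → x = x' := by
  simp only [inj, length_data_fst, all_range_iff, label_data, all_embs_iff, nodeAt_nodesData, mapNode_embData,
    nodeData_injective.eq_iff, Bool.or_eq_true, Bool.not_eq_true', decide_eq_false_iff_not,
    decide_eq_true_eq, Fin.val_inj, imp_iff_not_or]

theorem represents_nodesData {p : ∀ x, F.Node (Φ.label x).Edge} :
    represents s k F.data Φ.data (nodesData p) = true ↔ F.Represents Φ p := by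
  simp only [represents, Bool.and_eq_true, length_data_fst, length_data_snd, length_nodesData,
    all_range_iff, surj_iff, inj_iff, all_nodes_iff, label_data, label_data_zero,
    label_data_succ, par_data, incl_data, nodeAt_nodesData, nodeAt_nodesData_zero,
    nodeAt_nodesData_succ, mapNode_embData, isParent_iff, generates_nodeData, isNode_nodeData,
    totalDim_data, Bool.not_eq_true', Bool.eq_false_iff, ne_eq, decide_true, true_and]
  exact ⟨fun h => ⟨h.1.1.1.1, h.1.1.1.2, h.1.1.2, h.1.2, h.2⟩,
    fun h => ⟨⟨⟨⟨h.1, h.2⟩, h.3⟩, h.4⟩, h.5⟩⟩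

theorem exists_nodesData {c : List (ℕ × List ℕ)}
    (h : represents s k F.data Φ.data c = true) :
    ∃ p : ∀ x, F.Node (Φ.label x).Edge, nodesData p = c := by
  simp only [represents, Bool.and_eq_true, decide_eq_true_eq, length_data_fst,
    all_range_iff, label_data, isNode_iff] at h
  obtain ⟨⟨⟨⟨⟨h1, h2⟩, -⟩, -⟩, -⟩, -⟩ := h
  choose p hp using fun x => (h2 x).1
  exact ⟨p, (eq_ofFn (0, []) h1 _ fun x => (hp x).symm).symm⟩

theorem label_size_lt (Φ : Pattern s k) (x : Fin (Φ.last + 1)) : (Φ.label x).size < Φ.size := by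
  have := Finset.single_le_sum (f := fun x => 1 + (Φ.label x).size) (fun _ _ => Nat.zero_le _)
    (Finset.mem_univ x)
  change 1 + (Φ.label x).size ≤ Φ.size at this
  omega

theorem last_lt_size (Φ : Pattern s k) : Φ.last < Φ.size := by
  have h : ∑ _x : Fin (Φ.last + 1), 1 ≤ Φ.size :=
    Finset.sum_le_sum fun x _ => Nat.le_add_right _ _
  simpa using h

theorem mem_candidates {m : ℕ} (p : ∀ x, F.Node (Φ.label x).Edge) (hs : s ≤ m)
    (hc : F.comps ≤ m) (hd : F.totalDim ≤ m) (hΦ : Φ.size ≤ m) :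
    (Φ.data, nodesData p) ∈ candidates m := by
  have hlast := last_lt_size Φ
  have hsize := label_size_lt Φ
  simp only [candidates, mem_pairs, mem_seqsLE, length_data_fst, length_data_snd,
    length_nodesData, List.mem_range]
  refine ⟨⟨⟨by omega, fun T hT => ?_⟩, by omega, fun y hy => ?_⟩, by omega, fun y hy => ?_⟩
  · obtain ⟨x, rfl⟩ := List.mem_ofFn.1 hT
    have := hsize x
    rw [EdgeTree.length_data]
    refine ⟨by omega, fun y hy => ?_⟩
    obtain ⟨e, rfl⟩ := List.mem_ofFn.1 hy
    exact ⟨(Fin.is_lt _).trans (by omega), (Fin.is_lt _).trans_le hs⟩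
  · obtain ⟨z, rfl⟩ := List.mem_ofFn.1 hy
    have := hsize (Φ.par z)
    have := hsize z.succ
    refine ⟨(Fin.is_lt _).trans_le (by omega), by rw [List.length_ofFn]; omega, fun i hi => ?_⟩
    obtain ⟨e, rfl⟩ := List.mem_ofFn.1 hi
    exact (Fin.is_lt _).trans (by omega)
  · obtain ⟨x, rfl⟩ := List.mem_ofFn.1 hy
    have := hsize x
    have h1 := F.dim_le (p x).1.1
    refine ⟨(p x).1.1.2.trans_le hc, ?_, fun i hi => ?_⟩
    · change (List.ofFn _).length ≤ m
      rw [List.length_ofFn]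
      omega
    · obtain ⟨l, rfl⟩ := List.mem_ofFn.1 hi
      exact (idx_lt _).trans (by omega)

/-- The constructed pattern is among the candidates and passes the test, so the search finds
something; whatever it finds represents the output nodes and therefore defines `F`. -/
theorem toPattern_spec (h : F.MapsTrees k n) :
    ∃ Φ : Pattern s k, Φ.data = toPattern (s, k, n, F.data) ∧ Φ.Defines F ∧
      Φ.size ≤ QFInterp.sizeBound s k F.comps F.totalDim := by
  obtain ⟨Φ₀, p₀, h₀, hsize⟩ := h.exists_represents
  generalize hm : s + F.comps + F.totalDim + QFInterp.sizeBound s k F.comps F.totalDim + 1 = m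
  let L := (candidates m).filter fun c => isPattern s k c.1 && represents s k F.data c.1 c.2
  have hL : toPattern (s, k, n, F.data) = (L.map fun c => c.1).headI := by
    unfold toPattern
    simp only [length_data, totalDim_data, hm]
    rfl
  have hmem : (Φ₀.data, nodesData p₀) ∈ L := by
    refine List.mem_filter.2 ⟨mem_candidates p₀ ?_ ?_ ?_ ?_, ?_⟩
    · omega
    · omega
    · omega
    · omega
    · rw [Bool.and_eq_true]
      exact ⟨isPattern_iff.2 ⟨Φ₀, rfl⟩, represents_nodesData.2 h₀⟩
  obtain ⟨⟨q, c⟩, L', hL'⟩ := List.exists_cons_of_ne_nil (List.ne_nil_of_mem hmem)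
  have hq : (q, c) ∈ L := hL' ▸ List.mem_cons_self
  have h1 := (List.mem_filter.1 hq).2
  rw [Bool.and_eq_true, isPattern_iff] at h1
  obtain ⟨⟨Φ, rfl⟩, h2⟩ := h1
  dsimp only at h2
  obtain ⟨p, rfl⟩ := exists_nodesData h2
  have hΦ : Φ.Defines F := (represents_nodesData.1 h2).defines h
  refine ⟨Φ, ?_, hΦ, ?_⟩
  · rw [hL, hL']
    rfl
  -- The found pattern inherits the size bound: it defines the same function as the constructed one,
  -- hence is isomorphic to it.
  · rw [(hΦ.equivalent (h₀.defines h) fun A _ _ => ⟨RelIso.refl _⟩).isomorphic.size_eq]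
    exact hsize

end ToPattern

/-! ### Correctness of the test for isomorphism -/

section Iso

variable {s k : ℕ} {Φ Ψ : Pattern s k}

theorem incl_iff (Ψ : Pattern s k) {x y : Fin (Ψ.last + 1)} {z : Fin Ψ.last} (hx : Ψ.par z = x)
    (hy : z.succ = y) (e : (Ψ.label x).Edge) (f : (Ψ.label y).Edge) :
    Ψ.Incl ⟨x, e⟩ ⟨y, f⟩ ↔ (incl Ψ.data z).getD e.idx 0 = f.idx := by
  subst hx
  subst hy
  rw [incl_data, getD_embData, idx_injective.eq_iff]
  constructor
  · exact fun h => h.eq_incl.symm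
  · rintro rfl
    exact Pattern.Incl.intro z e

theorem label_size_le_maxSize (x : Fin (Φ.last + 1)) : (Φ.label x).size ≤ maxSize Φ.data := by
  have key : ∀ (L : List (List (ℕ × ℕ))), ∀ T ∈ L,
      T.length ≤ L.foldr (fun T m => T.length + m) 0 := by
    intro L
    induction L with
    | nil => exact fun T hT => absurd hT List.not_mem_nil
    | cons T' L ih =>
      intro T hT
      rw [List.foldr_cons]
      rcases List.mem_cons.1 hT with rfl | hT
      · omega
      · have := ih T hT
        omega
  rw [← EdgeTree.length_data]
  exact key _ _ (List.mem_ofFn.2 ⟨x, rfl⟩)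

theorem isIso_iff (σ : Fin (Φ.last + 1) → Fin (Ψ.last + 1))
    (τ : ∀ x, (Φ.label x).Edge ↪[edgeLang s] (Ψ.label (σ x)).Edge) :
    isIso Φ.data Ψ.data (List.ofFn fun x => (σ x : ℕ)) (List.ofFn fun x => embData (τ x)) = true ↔
      σ 0 = 0 ∧ Function.Injective σ ∧ (∀ x, (Φ.label x).size = (Ψ.label (σ x)).size) ∧
      ∀ z, par Ψ.data (σ z.succ - 1) = σ (Φ.par z) ∧ ∀ e : (Φ.label (Φ.par z)).Edge,
        (incl Ψ.data (σ z.succ - 1)).getD (τ _ e).idx 0 = (τ z.succ (Φ.incl z e)).idx := by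
  have hσ : ∀ x : Fin (Φ.last + 1), (List.ofFn fun x => (σ x : ℕ)).getD x 0 = σ x :=
    fun x => getD_ofFn (fun x => (σ x : ℕ)) x 0
  have hσ0 : (List.ofFn fun x => (σ x : ℕ)).getD 0 0 = σ 0 := hσ 0
  have hσ1 : ∀ z : Fin Φ.last, (List.ofFn fun x => (σ x : ℕ)).getD (z + 1) 0 = σ z.succ :=
    fun z => hσ z.succ
  have hτ : ∀ x : Fin (Φ.last + 1), (List.ofFn fun x => embData (τ x)).getD x [] = embData (τ x) :=
    fun x => getD_ofFn (fun x => embData (τ x)) x []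
  have hτ1 : ∀ z : Fin Φ.last, (List.ofFn fun x => embData (τ x)).getD (z + 1) [] =
    embData (τ z.succ) := fun z => hτ z.succ
  have hemb : ∀ x, isEmb (Φ.label x).data (Ψ.label (σ x)).data (embData (τ x)) = true :=
    fun x => isEmb_iff.2 ⟨τ x, rfl⟩
  simp only [isIso, Bool.and_eq_true, decide_eq_true_eq, length_data_fst, length_data_snd,
    all_range_iff, hσ, hσ0, hσ1, hτ, hτ1, hemb, label_data, EdgeTree.length_data, and_true,
    par_data, incl_data, Bool.or_eq_true, Bool.not_eq_true', decide_eq_false_iff_not]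
  constructor
  · rintro ⟨⟨h1, h2⟩, h3⟩
    refine ⟨Fin.ext h1, fun x y h => ?_, fun x => (h2 x).2, fun z => ⟨(h3 z).1, fun e => ?_⟩⟩
    · exact Fin.ext (((h2 x).1 y).resolve_left fun h' => h' (congrArg Fin.val h))
    · have := (h3 z).2 e
      change (incl Ψ.data _).getD ((embData (τ (Φ.par z))).getD e.idx 0) 0 =
        (embData (τ z.succ)).getD ((embData (Φ.incl z)).getD e.idx 0) 0 at this
      rwa [getD_embData, getD_embData, getD_embData] at this
  · rintro ⟨h1, h2, h3, h4⟩
    refine ⟨⟨congrArg Fin.val h1, fun x => ⟨fun y => ?_, h3 x⟩⟩, fun z => ⟨(h4 z).1, fun e => ?_⟩⟩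
    · by_cases h : x = y
      · exact Or.inr (congrArg Fin.val h)
      · exact Or.inl fun h' => h (h2 (Fin.ext h'))
    · have key : ∀ e : (Φ.label (Φ.par z)).Edge,
          (incl Ψ.data (σ z.succ - 1)).getD ((embData (τ (Φ.par z))).getD e.idx 0) 0 =
            (embData (τ z.succ)).getD ((embData (Φ.incl z)).getD e.idx 0) 0 := fun e => by
        rw [getD_embData, getD_embData, getD_embData]
        exact (h4 z).2 e
      exact key e

/-- An isomorphism of trees fixes the root, the only node without parent. Conversely, injectivity
and equal cardinalities turn `σ` and the embeddings `τ x` into bijections, and compatibility at each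
`z` gives the parent relation in both directions. -/
theorem isomorphic_iff (hl : Φ.last = Ψ.last) : Φ.Isomorphic Ψ ↔
    ∃ (σ : Fin (Φ.last + 1) → Fin (Ψ.last + 1))
      (τ : ∀ x, (Φ.label x).Edge ↪[edgeLang s] (Ψ.label (σ x)).Edge),
      isIso Φ.data Ψ.data (List.ofFn fun x => (σ x : ℕ))
        (List.ofFn fun x => embData (τ x)) = true := by
  constructor
  · rintro ⟨σ, τ, h1, h2⟩
    refine ⟨σ, fun x => (τ x).toEmbedding, (isIso_iff _ _).2 ⟨?_, σ.injective, fun x => ?_,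
      fun z => ?_⟩⟩
    · by_contra h
      obtain ⟨z, hz⟩ := Fin.exists_succ_eq.2 h
      obtain ⟨x, hx⟩ := σ.surjective (Ψ.par z)
      refine Φ.not_isParent_zero ((h1 x 0).2 ?_)
      rw [hx, ← hz]
      exact Pattern.IsParent.intro z
    · rw [← EdgeTree.card_edge, ← EdgeTree.card_edge, Fintype.card_congr (τ x).toEquiv]
    · have hp := (h1 _ _).1 (Pattern.IsParent.intro z)
      obtain ⟨z', hz'⟩ : ∃ z', Fin.succ z' = σ z.succ := by
        refine Fin.exists_succ_eq.2 fun h => ?_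
        rw [h] at hp
        exact Ψ.not_isParent_zero hp
      rw [← hz', Pattern.isParent_succ_iff] at hp
      have hval : (σ z.succ : ℕ) - 1 = z' := by
        rw [← hz']
        simp
      rw [hval, par_data, hp]
      exact ⟨rfl, fun e => (incl_iff Ψ hp hz' _ _).1 (h2 _ _ _ _ (Pattern.Incl.intro z e))⟩
  · rintro ⟨σ, τ, h⟩
    obtain ⟨h0, hinj, hsize, h⟩ := (isIso_iff _ _).1 h
    have hbij : Function.Bijective σ :=
      (Fintype.bijective_iff_injective_and_card σ).2 ⟨hinj, by simp [hl]⟩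
    have hτ : ∀ x, Function.Surjective (τ x) := fun x =>
      ((Fintype.bijective_iff_injective_and_card (τ x)).2
        ⟨(τ x).injective, by rw [EdgeTree.card_edge, EdgeTree.card_edge, hsize]⟩).2
    have hsucc : ∀ z : Fin Φ.last, ∃ z', Fin.succ z' = σ z.succ ∧ Ψ.par z' = σ (Φ.par z) ∧
        ∀ e : (Φ.label (Φ.par z)).Edge,
          (incl Ψ.data z').getD (τ _ e).idx 0 = (τ z.succ (Φ.incl z e)).idx := by
      intro z
      obtain ⟨z', hz'⟩ : ∃ z', Fin.succ z' = σ z.succ := by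
        refine Fin.exists_succ_eq.2 fun h => ?_
        rw [← h0] at h
        exact Fin.succ_ne_zero z (hinj h)
      have hval : (σ z.succ : ℕ) - 1 = z' := by
        rw [← hz']
        simp
      obtain ⟨h1, h2⟩ := h z
      rw [hval] at h1 h2
      rw [par_data] at h1
      exact ⟨z', hz', Fin.ext h1, h2⟩
    refine ⟨Equiv.ofBijective σ hbij, fun x => equivOfSurjective (τ x) (hτ x), fun x y => ?_,
      fun x y e f hef => ?_⟩
    · change _ ↔ Ψ.IsParent (σ x) (σ y)
      induction y using Fin.cases with
      | zero =>
        rw [h0]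
        exact ⟨fun h => absurd h Φ.not_isParent_zero, fun h => absurd h Ψ.not_isParent_zero⟩
      | succ z =>
        obtain ⟨z', hz', h1, -⟩ := hsucc z
        rw [← hz', Pattern.isParent_succ_iff, Pattern.isParent_succ_iff, h1, hinj.eq_iff]
    · cases hef with
      | intro z e =>
        obtain ⟨z', hz', h1, h2⟩ := hsucc z
        exact (incl_iff Ψ h1 hz' _ _).2 (h2 e)

theorem decideIso_iff : decideIso (s, k, Φ.data, Ψ.data) = true ↔ Φ.Isomorphic Ψ := by
  simp only [decideIso, Bool.and_eq_true, decide_eq_true_eq, List.any_eq_true, mem_seqs,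
    mem_seqsLE, length_data_fst, List.mem_range]
  constructor
  · rintro ⟨hl, σ, ⟨h1, h2⟩, τ, ⟨h3, -⟩, h⟩
    have hσ : ∀ x : Fin (Φ.last + 1), σ.getD x 0 < Ψ.last + 1 := fun x => by
      have hx : x.1 < σ.length := h1.symm ▸ x.2
      rw [List.getD_eq_getElem _ _ hx, ← hl]
      exact h2 _ (List.getElem_mem hx)
    have h' := h
    simp only [isIso, Bool.and_eq_true, length_data_fst, all_range_iff, label_data] at h'
    have hτ : ∀ x : Fin (Φ.last + 1), ∃ f : (Φ.label x).Edge ↪[edgeLang s]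
        (Ψ.label ⟨σ.getD x 0, hσ x⟩).Edge, embData f = τ.getD x [] := fun x => by
      rw [← isEmb_iff, ← label_data Ψ]
      exact (h'.1.2 x).2
    choose f hf using hτ
    refine (isomorphic_iff (by omega)).2 ⟨fun x => ⟨σ.getD x 0, hσ x⟩, f, ?_⟩
    rw [← eq_ofFn 0 h1 _ fun x => rfl, ← eq_ofFn [] h3 _ fun x => (hf x).symm]
    exact h
  · intro hiso
    have hl : Φ.last = Ψ.last := by
      obtain ⟨σ, -⟩ := hiso
      have := Fintype.card_congr σ
      simpa using this
    obtain ⟨σ, τ, h⟩ := (isomorphic_iff hl).1 hiso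
    refine ⟨by rw [hl], _, ⟨List.length_ofFn, fun a ha => ?_⟩, _, ⟨List.length_ofFn, ?_⟩, h⟩
    · obtain ⟨x, rfl⟩ := List.mem_ofFn.1 ha
      rw [hl]
      exact (σ x).2
    · intro a ha
      obtain ⟨x, rfl⟩ := List.mem_ofFn.1 ha
      have h1 := label_size_le_maxSize (Φ := Φ) x
      refine ⟨by rwa [length_embData], fun b hb => ?_⟩
      obtain ⟨e, rfl⟩ := List.mem_ofFn.1 hb
      -- Corresponding labels have the same size, so `maxSize Φ.data` also bounds the values of `τ`,
      -- which lie in labels of `Ψ`.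
      have h2 := ((isIso_iff _ _).1 h).2.2.1 x
      have h3 := idx_lt (τ x e)
      omega

end Iso

end Raw

end TreeInterp

/-! ### Assembly of the four statements -/

theorem mainTheorem2 :
    -- equivalence of quantifier-free interpretations is decidable
    (∃ decideEquiv : ℕ × ℕ × ℕ × TreeInterp.InterpData × TreeInterp.InterpData → Bool,
      Computable decideEquiv ∧
      ∀ (s k n : ℕ) (F G : TreeInterp.QFInterp s), F.MapsTrees k n → G.MapsTrees k n →
        (decideEquiv (s, k, n, F.data, G.data) = true ↔
          TreeInterp.QFInterp.Equivalent k F G)) ∧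
    -- interpretations can be converted to patterns of at most exponential size
    (∃ (toPattern : ℕ × ℕ × ℕ × TreeInterp.InterpData → TreeInterp.PatternData)
        (p : Polynomial ℕ),
      Computable toPattern ∧
      ∀ (s k n : ℕ) (F : TreeInterp.QFInterp s), F.MapsTrees k n →
        ∃ Φ : TreeInterp.Pattern s k, Φ.data = toPattern (s, k, n, F.data) ∧
          Φ.Defines F ∧ Φ.size ≤ 2 ^ p.eval (s + k + n + F.size)) ∧
    -- patterns define equivalent functions if and only if they are isomorphic
    (∀ (s k : ℕ) (Φ Ψ : TreeInterp.Pattern s k),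
      TreeInterp.Pattern.Equivalent Φ Ψ ↔ TreeInterp.Pattern.Isomorphic Φ Ψ) ∧
    -- isomorphism of patterns is decidable
    (∃ decideIso : ℕ × ℕ × TreeInterp.PatternData × TreeInterp.PatternData → Bool,
      Computable decideIso ∧
      ∀ (s k : ℕ) (Φ Ψ : TreeInterp.Pattern s k),
        decideIso (s, k, Φ.data, Ψ.data) = true ↔
          TreeInterp.Pattern.Isomorphic Φ Ψ) := by
  -- Interpretations are compared by converting both to patterns and testing these for isomorphism.
  refine ⟨⟨fun x => TreeInterp.Raw.decideIso (x.1, x.2.1,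
      TreeInterp.Raw.toPattern (x.1, x.2.1, x.2.2.1, x.2.2.2.1),
      TreeInterp.Raw.toPattern (x.1, x.2.1, x.2.2.1, x.2.2.2.2)), ?_, ?_⟩, ?_, ?_,
    ⟨TreeInterp.Raw.decideIso, TreeInterp.Raw.primrec_decideIso.to_comp,
      fun s k Φ Ψ => TreeInterp.Raw.decideIso_iff⟩⟩
  · refine Primrec.to_comp ?_
    have h := TreeInterp.Raw.primrec_decideIso
    have h' := TreeInterp.Raw.primrec_toPattern
    fun_prop
  · intro s k n F G hF hG
    obtain ⟨Φ, hΦ, hΦF, -⟩ := TreeInterp.Raw.toPattern_spec hF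
    obtain ⟨Ψ, hΨ, hΨG, -⟩ := TreeInterp.Raw.toPattern_spec hG
    dsimp only
    rw [← hΦ, ← hΨ, TreeInterp.Raw.decideIso_iff]
    exact ⟨fun h => h.equivalent.interp_equivalent hΦF hΨG,
      fun h => (hΦF.equivalent hΨG h).isomorphic⟩
  · obtain ⟨p, hp⟩ := TreeInterp.QFInterp.exists_polynomial_sizeBound
    refine ⟨TreeInterp.Raw.toPattern, p, TreeInterp.Raw.primrec_toPattern.to_comp,
      fun s k n F hF => ?_⟩
    obtain ⟨Φ, hΦ, hΦF, hsize⟩ := TreeInterp.Raw.toPattern_spec hF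
    have := F.comps_add_totalDim_le
    exact ⟨Φ, hΦ, hΦF, hsize.trans (hp _ _ _ _ _ (by omega) (by omega) (by omega) (by omega))⟩
  · exact fun s k Φ Ψ => ⟨fun h => h.isomorphic, fun h => h.equivalent⟩
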